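/- **Setting.** Let $1\le n_1\le n_2$. Real $n_1\times n_2$ matrices carry the trace inner product $\langle X,Y\rangle=\sum_{i,j}X_{ij}Y_{ij}$ and the Frobenius norm $\|\cdot\|_F$; $\sigma_1(X)\ge\dots\ge\sigma_{n_1}(X)$ are the singular values, $\|X\|_*=\sum_{i=1}^{n_1}\sigma_i(X)$ is the nuclear norm and $\|X\|$ the spectral norm. Let $A_1,\dots,A_m\in\mathbb R^{n_1\times n_2}$, $\mathcal A X=(\langle A_i,X\rangle)_{i=1}^m$ with adjoint $\mathcal A^*$, and $$\vartheta_+(k)=\sup_{0<\operatorname{rank}X\le k}\frac{\langle X,\mathcal A^*\mathcal A X\rangle}{\|X\|_F^2},\qquad \vartheta_-(k)=\inf_{0<\operatorname{rank}X\le k}\frac{\langle X,\mathcal A^*\mathcal A X\rangle}{\|X\|_F^2}.$$ Let $\Omega\subseteq\mathbb R^{n_1\times n_2}$ be compact and convex, $\overline X\in\Omega$ of rank $r\ge1$, and $b=\mathcal A\overline X+\xi$ with $\|\xi\|\le\delta$, $\delta>0$. Let $\overline X=\overline U_1\operatorname{Diag}(\sigma_1(\overline X),\dots,\sigma_r(\overline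 X))\overline V_1^{\mathbb T}$ with $\overline U_1^{\mathbb T}\overline U_1=\overline V_1^{\mathbb T}\overline V_1=I_r$. Let $\mathcal T=\{X: X=\overline U_1\overline U_1^{\mathbb T}X+X\overline V_1\overline V_1^{\mathbb T}-\overline U_1\overline U_1^{\mathbb T}X\overline V_1\overline V_1^{\mathbb T}\}$, and let $\mathcal P_{\mathcal T}$, $\mathcal P_{\mathcal T^\perp}$ be the orthogonal projections onto $\mathcal T$ and $\mathcal T^\perp$. Let $\Phi$ be the family of closed proper convex $\phi:\mathbb R\to(-\infty,+\infty]$ with $[0,1]\subseteq\operatorname{int}(\operatorname{dom}\phi)$, with a unique minimizer $t^*$ over $[0,1]$ satisfying $t^*<1$ and $\phi(t^*)=0$, and with $\phi'_-(1)<+\infty$. Fix $\phi\in\Phi$; let $\psi=\phi$ on $[0,1]$, $\psi=+\infty$ elsewhere, let $\psi^*(x)=\sup_t\{xt-\psi(t)\}$, and let $(\psi^*)'_\pm$ be its one-sided derivatives. **Algorithm.** Let $W^0=0$, $\rho_1>0$, and $\rho_k=\mu_k\rho_{k-1}$ with $\mu_k\ge1$ for $k\ge2$. For $k=1,2,\dots$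 let $$X^k\in\operatorname*{arg\,min}_X\{\|X\|_*-\langle W^{k-1},X\rangle:\ \|\mathcal A X-b\|\le\delta,\ X\in\Omega\},$$ $$W^k\in\operatorname*{arg\,min}_W\Big\{\sum_{i=1}^{n_1}\phi(\sigma_i(W))-\rho_k\langle W,X^k\rangle:\ \|W\|\le1\Big\}.$$ **Restricted eigenvalue assumption.** There are a constant $c\in[0,\sqrt2)$ and an integer $s$ with $1\le s\le\frac{n_1-2r}2$ such that $\vartheta_-(2r+2s)>0$ and $\frac{\vartheta_+(s)}{\vartheta_-(2r+2s)}\le1+\frac{2c^2s}r$. For $t\ge0$ with $ct<1$ put $$\Xi(t)=\frac{2\delta\sqrt{\vartheta_+(2r+s)}}{\vartheta_-(2r+s)}\cdot\frac1{1-ct}\sqrt{1+\frac{rt^2}{2s}},\qquad \Gamma(t)=\frac{2\delta\sqrt{\vartheta_+(2r+s)}}{\vartheta_-(2r+s)}\cdot\frac{\sqrt{2r}\,t}{1-ct}.$$ For $k\ge0$ put $$\gamma_k=\frac{\|\mathcal P_{\mathcal T}(W^k-\overline U_1\overline V_1^{\mathbb T})\|_F}{\sqrt{2r}\,(1-\|\mathcal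 P_{\mathcal T^\perp}(W^k)\|)}.$$ Let $\widetilde\gamma_0=\gamma_0$ and, for $k\ge1$, $$\widetilde\gamma_k=\frac{\sqrt r(1-\widetilde b_k)+(\sqrt2\,\widetilde a_k+1)\widetilde\beta_k}{\sqrt{2r}(1-\widetilde a_k)(1-\widetilde\beta_k^2)},\qquad \widetilde a_k=(\psi^*)'_+[\rho_k\Xi(\widetilde\gamma_{k-1})],$$ $$\widetilde b_k=(\psi^*)'_-[\rho_k(\sigma_r(\overline X)-\Xi(\widetilde\gamma_{k-1}))],\qquad \widetilde\beta_k=-\frac1{\sqrt2}\ln\Big[1-\frac{\sqrt2\,\Xi(\widetilde\gamma_{k-1})}{\sigma_r(\overline X)}\Big].$$ **Theorem.** Suppose that the restricted eigenvalue assumption holds and $\sigma_r(\overline X)>2\Xi(\gamma_0)$. Suppose that $\rho_1$ is chosen such that $$\widetilde a_1<\frac{(\widetilde b_1-\widetilde\beta_1^2)\sqrt r-\widetilde\beta_1}{(1-\widetilde\beta_1^2)\sqrt r+\sqrt2\,\widetilde\beta_1}$$ and that $\mu_k\in\big[1,\Xi(\widetilde\gamma_{k-2})/\Xi(\widetilde\gamma_{k-1})\big]$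 for all $k\ge2$. Then all the bounds are well defined, that is, for every $k\ge1$: $\|\mathcal P_{\mathcal T^\perp}(W^{k-1})\|<1$, $\gamma_{k-1}$ and $\widetilde\gamma_{k-1}$ are nonnegative with $c\gamma_{k-1}<1$ and $c\widetilde\gamma_{k-1}<1$, and $\widetilde a_k<1$, $\widetilde\beta_k<1$. For every $k\ge1$, $$\|X^k-\overline X\|_F\le\Xi(\gamma_{k-1})\quad\text{and}\quad\|\mathcal P_{\mathcal T^\perp}(X^k)\|_*\le\Gamma(\gamma_{k-1}),$$ and for every $k\ge2$, $$\|X^k-\overline X\|_F\le\Xi(\gamma_{k-1})\le\Xi(\widetilde\gamma_{k-1})<\Xi(\widetilde\gamma_{k-2})<\dots<\Xi(\widetilde\gamma_0)=\Xi(\gamma_0),$$ $$\|\mathcal P_{\mathcal T^\perp}(X^k)\|_*\le\Gamma(\gamma_{k-1})\le\Gamma(\widetilde\gamma_{k-1})<\Gamma(\widetilde\gamma_{k-2})<\dots<\Gamma(\widetilde\gamma_0)=\Gamma(\gamma_0).$$ -/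

import Mathlib

noncomputable section

namespace LowRank

open Matrix

/-! Real `n₁ × n₂` matrices with the trace inner product, and their norms. -/

/-- The trace inner product `⟨X, Y⟩ = ∑ᵢⱼ Xᵢⱼ Yᵢⱼ`. -/
def trInner {n₁ n₂ : ℕ} (X Y : Matrix (Fin n₁) (Fin n₂) ℝ) : ℝ := ∑ i, ∑ j, X i j * Y i j

/-- The Frobenius norm, induced by the trace inner product. -/
def frobNorm {n₁ n₂ : ℕ} (X : Matrix (Fin n₁) (Fin n₂) ℝ) : ℝ := √(trInner X X)

/-- The singular values in non-increasing order, counted from zero: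
`sing X i` is the `(i + 1)`-st largest singular value of `X`. -/
def sing {n₁ n₂ : ℕ} (X : Matrix (Fin n₁) (Fin n₂) ℝ) (i : ℕ) : ℝ :=
  (Matrix.toEuclideanLin X).singularValues i

/-- The nuclear norm, i.e. the sum of the singular values
(at most `n₁` of them are nonzero). -/
def nuclearNorm {n₁ n₂ : ℕ} (X : Matrix (Fin n₁) (Fin n₂) ℝ) : ℝ := ∑ i : Fin n₁, sing X i

/-- The spectral norm, i.e. the operator norm between Euclidean spaces. -/
def specNorm {n₁ n₂ : ℕ} (X : Matrix (Fin n₁) (Fin n₂) ℝ) : ℝ :=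
  ‖LinearMap.toContinuousLinearMap (Matrix.toEuclideanLin X)‖

/-! The sampling operator and its restricted eigenvalues. -/

/-- The sampling operator `𝒜 X = (⟨A₁, X⟩, …, ⟨A_m, X⟩)`. -/
def sampling {n₁ n₂ m : ℕ} (A : Fin m → Matrix (Fin n₁) (Fin n₂) ℝ)
    (X : Matrix (Fin n₁) (Fin n₂) ℝ) : EuclideanSpace ℝ (Fin m) :=
  WithLp.toLp 2 fun i => trInner (A i) X

/-- The adjoint `𝒜* y = ∑ᵢ yᵢ Aᵢ` of the sampling operator. -/
def samplingAdj {n₁ n₂ m : ℕ} (A : Fin m → Matrix (Fin n₁) (Fin n₂) ℝ)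
    (y : EuclideanSpace ℝ (Fin m)) : Matrix (Fin n₁) (Fin n₂) ℝ :=
  ∑ i, y i • A i

/-- The values `⟨X, 𝒜*𝒜 X⟩ / ‖X‖_F²` over all `X` with `0 < rank X ≤ k`. -/
def rayleighSet {n₁ n₂ m : ℕ} (A : Fin m → Matrix (Fin n₁) (Fin n₂) ℝ) (k : ℕ) : Set ℝ :=
  {t | ∃ X : Matrix (Fin n₁) (Fin n₂) ℝ, 0 < X.rank ∧ X.rank ≤ k ∧
    t = trInner X (samplingAdj A (sampling A X)) / frobNorm X ^ 2}

/-- The largest rank-`k` restricted eigenvalue `ϑ₊(k)` of `𝒜*𝒜`. -/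
def thetaPlus {n₁ n₂ m : ℕ} (A : Fin m → Matrix (Fin n₁) (Fin n₂) ℝ) (k : ℕ) : ℝ :=
  sSup (rayleighSet A k)

/-- The smallest rank-`k` restricted eigenvalue `ϑ₋(k)` of `𝒜*𝒜`. -/
def thetaMinus {n₁ n₂ m : ℕ} (A : Fin m → Matrix (Fin n₁) (Fin n₂) ℝ) (k : ℕ) : ℝ :=
  sInf (rayleighSet A k)

/-- The restricted eigenvalue assumption for the constant `c ∈ [0, √2)` and the integer
`s ∈ [1, (n₁ - 2r)/2]`; the ratio of restricted eigenvalues is understood to be finite. -/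
structure RestrictedEigenvalue {n₁ n₂ m : ℕ} (A : Fin m → Matrix (Fin n₁) (Fin n₂) ℝ)
    (r s : ℕ) (c : ℝ) : Prop where
  c_nonneg : 0 ≤ c
  c_lt : c < √2
  one_le_s : 1 ≤ s
  s_le : 2 * r + 2 * s ≤ n₁
  pos : 0 < thetaMinus A (2 * r + 2 * s)
  ratio_le : thetaPlus A s / thetaMinus A (2 * r + 2 * s) ≤ 1 + 2 * c ^ 2 * s / r

/-- The error bound function
`Ξ(t) = 2δ√ϑ₊(2r+s) / ϑ₋(2r+s) · 1/(1-ct) · √(1 + rt²/(2s))`. -/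
def errBound {n₁ n₂ m : ℕ} (A : Fin m → Matrix (Fin n₁) (Fin n₂) ℝ) (δ : ℝ) (r s : ℕ) (c : ℝ)
    (t : ℝ) : ℝ :=
  2 * δ * √(thetaPlus A (2 * r + s)) / thetaMinus A (2 * r + s) * (1 / (1 - c * t)) *
    √(1 + r * t ^ 2 / (2 * s))

/-- The approximate rank bound function
`Γ(t) = 2δ√ϑ₊(2r+s) / ϑ₋(2r+s) · √(2r) t/(1-ct)`. -/
def rankBound {n₁ n₂ m : ℕ} (A : Fin m → Matrix (Fin n₁) (Fin n₂) ℝ) (δ : ℝ) (r s : ℕ) (c : ℝ)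
    (t : ℝ) : ℝ :=
  2 * δ * √(thetaPlus A (2 * r + s)) / thetaMinus A (2 * r + s) *
    (√(2 * r) * t / (1 - c * t))

/-! The singular value decomposition of the target and the tangent space. -/

/-- `X = U₁ Diag(σ₁(X), …, σ_r(X)) V₁ᵀ` with orthonormal columns in `U₁` and `V₁`: for
`r = rank X` these are the leading `r` columns of the orthogonal factors of an SVD of `X`. -/
structure IsLeadingSVD {n₁ n₂ r : ℕ} (X : Matrix (Fin n₁) (Fin n₂) ℝ)
    (U₁ : Matrix (Fin n₁) (Fin r) ℝ) (V₁ : Matrix (Fin n₂) (Fin r) ℝ) : Prop where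
  rank_eq : X.rank = r
  orth_left : U₁ᵀ * U₁ = 1
  orth_right : V₁ᵀ * V₁ = 1
  eq : X = U₁ * Matrix.diagonal (fun i : Fin r => sing X i) * V₁ᵀ

/-- The orthogonal projection onto the tangent space `𝒯`. -/
def projT {n₁ n₂ r : ℕ} (U₁ : Matrix (Fin n₁) (Fin r) ℝ) (V₁ : Matrix (Fin n₂) (Fin r) ℝ)
    (Z : Matrix (Fin n₁) (Fin n₂) ℝ) : Matrix (Fin n₁) (Fin n₂) ℝ :=
  U₁ * U₁ᵀ * Z + Z * (V₁ * V₁ᵀ) - U₁ * U₁ᵀ * Z * (V₁ * V₁ᵀ)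

/-- The orthogonal projection onto the orthogonal complement `𝒯^⊥` of the tangent space. -/
def projTperp {n₁ n₂ r : ℕ} (U₁ : Matrix (Fin n₁) (Fin r) ℝ) (V₁ : Matrix (Fin n₂) (Fin r) ℝ)
    (Z : Matrix (Fin n₁) (Fin n₂) ℝ) : Matrix (Fin n₁) (Fin n₂) ℝ :=
  Z - projT U₁ V₁ Z

/-- The tangent space `𝒯 = {X | X = U₁U₁ᵀX + XV₁V₁ᵀ - U₁U₁ᵀXV₁V₁ᵀ}` to the set of matrices of
rank at most `r`, at a matrix with leading SVD factors `U₁`, `V₁`. -/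
def tangentSet {n₁ n₂ r : ℕ} (U₁ : Matrix (Fin n₁) (Fin r) ℝ) (V₁ : Matrix (Fin n₂) (Fin r) ℝ) :
    Set (Matrix (Fin n₁) (Fin n₂) ℝ) :=
  {X | X = U₁ * U₁ᵀ * X + X * (V₁ * V₁ᵀ) - U₁ * U₁ᵀ * X * (V₁ * V₁ᵀ)}

theorem trInner_eq_trace {n₁ n₂ : ℕ} (X Y : Matrix (Fin n₁) (Fin n₂) ℝ) :
    trInner X Y = (Xᵀ * Y).trace := by
  simp only [trInner, Matrix.trace, Matrix.diag, Matrix.mul_apply, Matrix.transpose_apply]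
  exact Finset.sum_comm

/-- `projT` maps into the tangent space. -/
theorem projT_mem {n₁ n₂ r : ℕ} {U₁ : Matrix (Fin n₁) (Fin r) ℝ} {V₁ : Matrix (Fin n₂) (Fin r) ℝ}
    (hU : U₁ᵀ * U₁ = 1) (hV : V₁ᵀ * V₁ = 1) (Z : Matrix (Fin n₁) (Fin n₂) ℝ) :
    projT U₁ V₁ Z ∈ tangentSet U₁ V₁ := by
  have hP : (U₁ * U₁ᵀ) * (U₁ * U₁ᵀ) = U₁ * U₁ᵀ := by
    rw [Matrix.mul_assoc, ← Matrix.mul_assoc U₁ᵀ, hU, Matrix.one_mul]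
  have hQ : (V₁ * V₁ᵀ) * (V₁ * V₁ᵀ) = V₁ * V₁ᵀ := by
    rw [Matrix.mul_assoc, ← Matrix.mul_assoc V₁ᵀ, hV, Matrix.one_mul]
  simp only [tangentSet, Set.mem_ofPred_eq, projT]
  generalize U₁ * U₁ᵀ = P at *
  generalize V₁ * V₁ᵀ = Q at *
  simp only [Matrix.mul_add, Matrix.mul_sub, Matrix.add_mul, Matrix.sub_mul, Matrix.mul_assoc, hQ]
  simp only [← Matrix.mul_assoc, hP]
  abel

/-- `projT` fixes the tangent space. -/
theorem projT_of_mem {n₁ n₂ r : ℕ} {U₁ : Matrix (Fin n₁) (Fin r) ℝ}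
    {V₁ : Matrix (Fin n₂) (Fin r) ℝ} {Z : Matrix (Fin n₁) (Fin n₂) ℝ}
    (hZ : Z ∈ tangentSet U₁ V₁) : projT U₁ V₁ Z = Z :=
  Eq.symm hZ

/-- `projT` is symmetric for the trace inner product; together with the two preceding facts this
says that it is the orthogonal projection onto the tangent space. -/
theorem trInner_projT_left {n₁ n₂ r : ℕ} (U₁ : Matrix (Fin n₁) (Fin r) ℝ)
    (V₁ : Matrix (Fin n₂) (Fin r) ℝ) (Y Z : Matrix (Fin n₁) (Fin n₂) ℝ) :
    trInner (projT U₁ V₁ Y) Z = trInner Y (projT U₁ V₁ Z) := by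
  have hP : (U₁ * U₁ᵀ)ᵀ = U₁ * U₁ᵀ := by simp
  have hQ : (V₁ * V₁ᵀ)ᵀ = V₁ * V₁ᵀ := by simp
  simp only [trInner_eq_trace, projT]
  generalize U₁ * U₁ᵀ = P at *
  generalize V₁ * V₁ᵀ = Q at *
  simp only [Matrix.transpose_add, Matrix.transpose_sub, Matrix.transpose_mul, hP, hQ,
    Matrix.mul_add, Matrix.mul_sub, Matrix.add_mul, Matrix.sub_mul, Matrix.trace_add,
    Matrix.trace_sub]
  rw [Matrix.mul_assoc Q, Matrix.trace_mul_comm Q, Matrix.mul_assoc Q, Matrix.trace_mul_comm Q]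
  simp only [Matrix.mul_assoc]

/-- The quantity
`‖P_𝒯(W - U₁V₁ᵀ)‖_F / (√(2r) (1 - ‖P_{𝒯^⊥}(W)‖))`. -/
def gammaOf {n₁ n₂ r : ℕ} (U₁ : Matrix (Fin n₁) (Fin r) ℝ) (V₁ : Matrix (Fin n₂) (Fin r) ℝ)
    (W : Matrix (Fin n₁) (Fin n₂) ℝ) : ℝ :=
  frobNorm (projT U₁ V₁ (W - U₁ * V₁ᵀ)) / (√(2 * r) * (1 - specNorm (projTperp U₁ V₁ W)))

/-! The family `Φ` and the conjugate function. -/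

/-- The family `Φ` of closed proper convex `φ : ℝ → (-∞, ∞]` with `[0,1] ⊆ int (dom φ)`, whose
minimizer `t*` over `[0,1]` satisfies `t* < 1` and `φ(t*) = 0`, and with a finite left derivative
at `1`. -/
structure MemPhi (φ : ℝ → EReal) : Prop where
  ne_bot : ∀ t, φ t ≠ ⊥
  convex_epigraph : Convex ℝ {p : ℝ × ℝ | φ p.1 ≤ (p.2 : EReal)}
  closed : LowerSemicontinuous φ
  subset_interior_dom : Set.Icc (0 : ℝ) 1 ⊆ interior {t | φ t ≠ ⊤}
  argmin : ∃ tstar ∈ Set.Ico (0 : ℝ) 1, φ tstar = 0 ∧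
    ∀ t ∈ Set.Icc (0 : ℝ) 1, t ≠ tstar → φ tstar < φ t
  leftDeriv_one : DifferentiableWithinAt ℝ (fun t => (φ t).toReal) (Set.Iio 1) 1

open Classical in
/-- The function `ψ` equal to `φ` on `[0,1]` and to `+∞` elsewhere. -/
def psi (φ : ℝ → EReal) (t : ℝ) : EReal := if t ∈ Set.Icc (0 : ℝ) 1 then φ t else ⊤

/-- The conjugate `ψ*(x) = sup_t (x t - ψ(t))`. -/
def psiConj (φ : ℝ → EReal) (x : ℝ) : EReal := ⨆ t : ℝ, (((x * t : ℝ) : EReal) - psi φ t)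

/-- The right derivative of the (finite) function `ψ*`. -/
def psiConjRight (φ : ℝ → EReal) (x : ℝ) : ℝ :=
  derivWithin (fun y => (psiConj φ y).toReal) (Set.Ioi x) x

/-- The left derivative of the (finite) function `ψ*`. -/
def psiConjLeft (φ : ℝ → EReal) (x : ℝ) : ℝ :=
  derivWithin (fun y => (psiConj φ y).toReal) (Set.Iio x) x

/-! The multi-stage convex relaxation approach. -/

/-- `X` solves `min {‖X‖_* - ⟨W, X⟩ : ‖𝒜 X - b‖ ≤ δ, X ∈ Ω}`. -/
def SolvesX {n₁ n₂ m : ℕ} (A : Fin m → Matrix (Fin n₁) (Fin n₂) ℝ)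
    (b : EuclideanSpace ℝ (Fin m)) (δ : ℝ) (Ω : Set (Matrix (Fin n₁) (Fin n₂) ℝ))
    (W X : Matrix (Fin n₁) (Fin n₂) ℝ) : Prop :=
  X ∈ {Y | ‖sampling A Y - b‖ ≤ δ ∧ Y ∈ Ω} ∧
    IsMinOn (fun Y => nuclearNorm Y - trInner W Y) {Y | ‖sampling A Y - b‖ ≤ δ ∧ Y ∈ Ω} X

/-- `W` solves `min {∑ᵢ φ(σᵢ(W)) - ρ⟨W, X⟩ : ‖W‖ ≤ 1}`. -/
def SolvesW {n₁ n₂ : ℕ} (φ : ℝ → EReal) (ρ : ℝ) (X W : Matrix (Fin n₁) (Fin n₂) ℝ) : Prop :=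
  W ∈ {Z | specNorm Z ≤ 1} ∧
    IsMinOn (fun Z => (∑ i : Fin n₁, φ (sing Z i)) - ((ρ * trInner Z X : ℝ) : EReal))
      {Z : Matrix (Fin n₁) (Fin n₂) ℝ | specNorm Z ≤ 1} W

/-- `X¹, X², …` and `W⁰, W¹, …` are produced by the multi-stage convex relaxation approach with
the parameters `ρ₁ > 0` and `μ_k ≥ 1`, `ρ_k = μ_k ρ_{k-1}` for `k ≥ 2`. (`X 0`, `ρ 0`, `μ 0`, `μ 1`
are not used.) -/
structure IsMultiStage {n₁ n₂ m : ℕ} (A : Fin m → Matrix (Fin n₁) (Fin n₂) ℝ)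
    (b : EuclideanSpace ℝ (Fin m)) (δ : ℝ) (Ω : Set (Matrix (Fin n₁) (Fin n₂) ℝ))
    (φ : ℝ → EReal) (ρ μ : ℕ → ℝ) (X W : ℕ → Matrix (Fin n₁) (Fin n₂) ℝ) : Prop where
  init : W 0 = 0
  stepX : ∀ k, 1 ≤ k → SolvesX A b δ Ω (W (k - 1)) (X k)
  rho_one_pos : 0 < ρ 1
  one_le_mu : ∀ k, 2 ≤ k → 1 ≤ μ k
  rho_eq : ∀ k, 2 ≤ k → ρ k = μ k * ρ (k - 1)
  stepW : ∀ k, 1 ≤ k → SolvesW φ (ρ k) (X k) (W k)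

/-! The recursively defined bounds `γ̃_k`. Below `x` stands for `Ξ(γ̃_{k-1})` and `σ` for the
smallest nonzero singular value of the target. -/

/-- `ã = (ψ*)'₊(ρ x)`. -/
def aStep (φ : ℝ → EReal) (ρ x : ℝ) : ℝ := psiConjRight φ (ρ * x)

/-- `b̃ = (ψ*)'₋(ρ (σ - x))`. -/
def bStep (φ : ℝ → EReal) (σ ρ x : ℝ) : ℝ := psiConjLeft φ (ρ * (σ - x))

/-- `β̃ = -(1/√2) ln(1 - √2 x / σ)`. -/
def betaStep (σ x : ℝ) : ℝ := -(1 / √2) * Real.log (1 - √2 * x / σ)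

/-- `(√r (1 - b̃) + (√2 ã + 1) β̃) / (√(2r) (1 - ã) (1 - β̃²))`. -/
def gammaStep (r : ℕ) (a b β : ℝ) : ℝ :=
  (√r * (1 - b) + (√2 * a + 1) * β) / (√(2 * r) * (1 - a) * (1 - β ^ 2))

/-- The sequence `γ̃_k`, started at `γ̃_0 = g₀`. -/
def gammaTilde (φ : ℝ → EReal) (Ξ : ℝ → ℝ) (r : ℕ) (σ g₀ : ℝ) (ρ : ℕ → ℝ) : ℕ → ℝ
  | 0 => g₀
  | k + 1 =>
    let x := Ξ (gammaTilde φ Ξ r σ g₀ ρ k)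
    gammaStep r (aStep φ (ρ (k + 1)) x) (bStep φ σ (ρ (k + 1)) x) (betaStep σ x)

end LowRank

end

/-!
The error bound for a single relaxation is a null space argument. Optimality of `X^k` against the
target, together with the fact that `U₁V₁ᵀ + P_{𝒯^⊥}(Z)` is a subgradient of the nuclear norm for
every contraction `Z`, bounds the nuclear norm of the normal component of the error
`H = X^k - X̄` by `√(2r) γ_{k-1} ‖P_𝒯(H)‖_F` (`nuclearNorm_projTperp_le`). Cutting the singular
values of the normal component into blocks of length `s` and estimating the correlation of the
leading part (rank at most `2r + s`) with each later block by restricted eigenvalues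
(`abs_inner_sampling_le`) controls the leading part
(`RestrictedEigenvalue.exists_leading_part`), which gives `Ξ` and `Γ` (`SolvesX.error_bound`).

The weight step is analysed through von Neumann's trace inequality. At the optimum it holds with
equality and the singular values of `W^k` are subgradients of `ψ*` at those of `ρ_k X^k`
(`SolvesW.optimality`), so the first `r` of them are at least `b̃_k` and the others at most `ã_k`.
As `ã_k < b̃_k`, equality forces the leading factor of `W^k` to be the leading factor `Q` of `X^k`
(`kyFan_eq_of_vonNeumann_eq`, `svdMat_headInd_unique`).

What remains is the distance of `Q` to `P = U₁V₁ᵀ`. Both are subgradients of the Ky Fan `r`-norm, at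
`X^k` and at `X̄`, and the gaps after the `r`-th singular value make the subdifferential strongly
monotone there: `⟨P - Q, X̄ - X^k⟩ ≥ ½(σ_r(X̄) + σ_r(X^k) - σ_{r+1}(X^k)) ‖P - Q‖_F²`
(`kyFan_gap`, `frobNorm_leading_sub_le`). If `‖X^k - X̄‖_F ≤ x`, then
`σ_r(X̄) - σ_r(X^k) + σ_{r+1}(X^k) ≤ √2 x`, so `‖P - Q‖_F ≤ 2x / (2σ_r(X̄) - √2 x)`, and this is at
most `β̃_k` because `-ln(1 - u) ≥ 2u / (2 - u)`. Both the overlap of the leading singular vectors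
with `𝒯^⊥` and that of the trailing ones with `𝒯` are bounded by `‖P - Q‖_F`, which yields
`γ_k ≤ γ̃_k` (`gammaOf_le_gammaStep`).

Finally `γ₀ = 1/√2`, the condition on `ã_1` says exactly that `γ̃_1 < γ̃_0`, and the range of `μ_k`
makes `ã_k` and `β̃_k` decrease and `b̃_k` increase, so `γ̃` keeps decreasing by induction.
-/

namespace LowRank

open Matrix

/-! ### Trace inner product and Frobenius norm -/

section TraceInner

variable {a b c : ℕ}

theorem trInner_comm (X Y : Matrix (Fin a) (Fin b) ℝ) : trInner X Y = trInner Y X := by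
  simp only [trInner, mul_comm]

theorem trInner_add_left (X Y Z : Matrix (Fin a) (Fin b) ℝ) :
    trInner (X + Y) Z = trInner X Z + trInner Y Z := by
  simp [trInner, add_mul, Finset.sum_add_distrib]

theorem trInner_sub_left (X Y Z : Matrix (Fin a) (Fin b) ℝ) :
    trInner (X - Y) Z = trInner X Z - trInner Y Z := by
  simp [trInner, sub_mul, Finset.sum_sub_distrib]

theorem trInner_smul_left (t : ℝ) (X Y : Matrix (Fin a) (Fin b) ℝ) :
    trInner (t • X) Y = t * trInner X Y := by
  simp [trInner, Finset.mul_sum, mul_assoc]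

theorem trInner_add_right (X Y Z : Matrix (Fin a) (Fin b) ℝ) :
    trInner X (Y + Z) = trInner X Y + trInner X Z := by
  simp [trInner, mul_add, Finset.sum_add_distrib]

theorem trInner_sub_right (X Y Z : Matrix (Fin a) (Fin b) ℝ) :
    trInner X (Y - Z) = trInner X Y - trInner X Z := by
  simp [trInner, mul_sub, Finset.sum_sub_distrib]

theorem trInner_smul_right (t : ℝ) (X Y : Matrix (Fin a) (Fin b) ℝ) :
    trInner X (t • Y) = t * trInner X Y := by
  rw [trInner_comm, trInner_smul_left, trInner_comm]

@[simp]
theorem trInner_zero_left (X : Matrix (Fin a) (Fin b) ℝ) : trInner 0 X = 0 := by simp [trInner]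

@[simp]
theorem trInner_zero_right (X : Matrix (Fin a) (Fin b) ℝ) : trInner X 0 = 0 := by simp [trInner]

theorem trInner_sum_right {ι : Type*} (s : Finset ι) (X : Matrix (Fin a) (Fin b) ℝ)
    (Y : ι → Matrix (Fin a) (Fin b) ℝ) : trInner X (∑ i ∈ s, Y i) = ∑ i ∈ s, trInner X (Y i) := by
  classical
  induction s using Finset.induction_on with
  | empty => simp
  | insert i s hi ih => rw [Finset.sum_insert hi, trInner_add_right, ih, Finset.sum_insert hi]

theorem trInner_mul_left (A : Matrix (Fin c) (Fin a) ℝ) (X : Matrix (Fin a) (Fin b) ℝ)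
    (Y : Matrix (Fin c) (Fin b) ℝ) : trInner (A * X) Y = trInner X (Aᵀ * Y) := by
  rw [trInner_eq_trace, trInner_eq_trace, transpose_mul, Matrix.mul_assoc]

theorem trInner_mul_right (X : Matrix (Fin a) (Fin b) ℝ) (B : Matrix (Fin b) (Fin c) ℝ)
    (Y : Matrix (Fin a) (Fin c) ℝ) : trInner (X * B) Y = trInner X (Y * Bᵀ) := by
  rw [trInner_eq_trace, trInner_eq_trace, transpose_mul, Matrix.mul_assoc,
    Matrix.trace_mul_comm, Matrix.mul_assoc]

theorem trInner_transpose (X Y : Matrix (Fin a) (Fin b) ℝ) : trInner Xᵀ Yᵀ = trInner X Y := by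
  simp only [trInner, transpose_apply]
  exact Finset.sum_comm

theorem trInner_self_nonneg (X : Matrix (Fin a) (Fin b) ℝ) : 0 ≤ trInner X X :=
  Finset.sum_nonneg fun _ _ => Finset.sum_nonneg fun _ _ => mul_self_nonneg _

theorem frobNorm_nonneg (X : Matrix (Fin a) (Fin b) ℝ) : 0 ≤ frobNorm X := Real.sqrt_nonneg _

theorem frobNorm_sq (X : Matrix (Fin a) (Fin b) ℝ) : frobNorm X ^ 2 = trInner X X :=
  Real.sq_sqrt (trInner_self_nonneg X)

theorem frobNorm_sq_eq_sum (X : Matrix (Fin a) (Fin b) ℝ) :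
    frobNorm X ^ 2 = ∑ i, ∑ j, X i j ^ 2 := by
  rw [frobNorm_sq]
  simp only [trInner, sq]

theorem frobNorm_eq_zero {X : Matrix (Fin a) (Fin b) ℝ} : frobNorm X = 0 ↔ X = 0 := by
  constructor
  · intro h
    have h2 : ∑ i, ∑ j, X i j ^ 2 = 0 := by rw [← frobNorm_sq_eq_sum, h]; norm_num
    ext i j
    have h3 := (Finset.sum_eq_zero_iff_of_nonneg
      (fun i _ => Finset.sum_nonneg fun j _ => sq_nonneg (X i j))).1 h2 i (Finset.mem_univ _)
    have h4 := (Finset.sum_eq_zero_iff_of_nonneg (fun j _ => sq_nonneg (X i j))).1 h3 j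
      (Finset.mem_univ _)
    simpa using h4
  · rintro rfl
    simp [frobNorm]

theorem frobNorm_zero : frobNorm (0 : Matrix (Fin a) (Fin b) ℝ) = 0 := frobNorm_eq_zero.2 rfl

theorem frobNorm_neg (X : Matrix (Fin a) (Fin b) ℝ) : frobNorm (-X) = frobNorm X := by
  simp [frobNorm, trInner]

theorem frobNorm_sub_comm (X Y : Matrix (Fin a) (Fin b) ℝ) :
    frobNorm (X - Y) = frobNorm (Y - X) := by
  rw [← frobNorm_neg, neg_sub]

theorem frobNorm_transpose (X : Matrix (Fin a) (Fin b) ℝ) : frobNorm Xᵀ = frobNorm X := by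
  rw [frobNorm, trInner_transpose, frobNorm]

open scoped Matrix.Norms.Frobenius in
theorem frobNorm_eq_norm (X : Matrix (Fin a) (Fin b) ℝ) : frobNorm X = ‖X‖ := by
  rw [Matrix.frobenius_norm_def, ← Real.sqrt_eq_rpow, frobNorm]
  simp [trInner, sq]

open scoped Matrix.Norms.Frobenius in
theorem frobNorm_add_le (X Y : Matrix (Fin a) (Fin b) ℝ) :
    frobNorm (X + Y) ≤ frobNorm X + frobNorm Y := by
  simpa only [frobNorm_eq_norm] using norm_add_le X Y

open scoped Matrix.Norms.Frobenius in
theorem frobNorm_mul_le (X : Matrix (Fin a) (Fin b) ℝ) (Y : Matrix (Fin b) (Fin c) ℝ) :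
    frobNorm (X * Y) ≤ frobNorm X * frobNorm Y := by
  simpa only [frobNorm_eq_norm] using Matrix.frobenius_norm_mul X Y

theorem trInner_le_frobNorm_mul (X Y : Matrix (Fin a) (Fin b) ℝ) :
    trInner X Y ≤ frobNorm X * frobNorm Y := by
  have h := Finset.sum_mul_sq_le_sq_mul_sq (Finset.univ : Finset (Fin a × Fin b))
    (fun p => X p.1 p.2) (fun p => Y p.1 p.2)
  simp only [Fintype.sum_prod_type] at h
  rw [← frobNorm_sq_eq_sum X, ← frobNorm_sq_eq_sum Y, ← mul_pow] at h
  exact (le_abs_self _).trans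
    (abs_le_of_sq_le_sq h (mul_nonneg (frobNorm_nonneg X) (frobNorm_nonneg Y)))

/-- Multiplication by a matrix with orthonormal columns is an isometry. -/
theorem frobNorm_mul_transpose_of_orth {V : Matrix (Fin c) (Fin b) ℝ} (hV : Vᵀ * V = 1)
    (X : Matrix (Fin a) (Fin b) ℝ) : frobNorm (X * Vᵀ) = frobNorm X := by
  rw [frobNorm, trInner_mul_right, transpose_transpose, Matrix.mul_assoc, hV, Matrix.mul_one,
    frobNorm]

theorem frobNorm_mul_of_orth {U : Matrix (Fin c) (Fin a) ℝ} (hU : Uᵀ * U = 1)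
    (X : Matrix (Fin a) (Fin b) ℝ) : frobNorm (U * X) = frobNorm X := by
  rw [frobNorm, trInner_mul_left, ← Matrix.mul_assoc, hU, Matrix.one_mul, frobNorm]

/-- Pythagoras for the orthogonal projector `U Uᵀ`. -/
theorem frobNorm_sq_projector_add {U : Matrix (Fin a) (Fin c) ℝ} (hU : Uᵀ * U = 1)
    (X : Matrix (Fin a) (Fin b) ℝ) :
    frobNorm (Uᵀ * X) ^ 2 + frobNorm (X - U * Uᵀ * X) ^ 2 = frobNorm X ^ 2 := by
  have h : Uᵀ * (X - U * Uᵀ * X) = 0 := by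
    rw [Matrix.mul_sub, Matrix.mul_assoc, ← Matrix.mul_assoc Uᵀ U, hU, Matrix.one_mul, sub_self]
  have e1 : trInner (Uᵀ * X) (Uᵀ * X) = trInner X (U * Uᵀ * X) := by
    rw [trInner_mul_left, transpose_transpose, Matrix.mul_assoc]
  have e2 : trInner (U * Uᵀ * X) (X - U * Uᵀ * X) = 0 := by
    rw [Matrix.mul_assoc, trInner_mul_left, ← Matrix.mul_assoc U, h, trInner_zero_right]
  have e3 : trInner (X - U * Uᵀ * X) (X - U * Uᵀ * X) = trInner X (X - U * Uᵀ * X) := by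
    rw [trInner_sub_left X, e2, sub_zero]
  rw [frobNorm_sq, frobNorm_sq, frobNorm_sq, e1, e3, trInner_sub_right]
  ring

/-- Bessel's inequality. -/
theorem frobNorm_transpose_mul_le {U : Matrix (Fin a) (Fin c) ℝ} (hU : Uᵀ * U = 1)
    (X : Matrix (Fin a) (Fin b) ℝ) : frobNorm (Uᵀ * X) ^ 2 ≤ frobNorm X ^ 2 := by
  have := frobNorm_sq_projector_add hU X
  nlinarith [sq_nonneg (frobNorm (X - U * Uᵀ * X))]

theorem frobNorm_sq_of_orth {U : Matrix (Fin a) (Fin c) ℝ} (hU : Uᵀ * U = 1) :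
    frobNorm U ^ 2 = c := by
  rw [frobNorm_sq, trInner_eq_trace, hU, trace_one, Fintype.card_fin]

/-- The squared entries of `Uᵀ B` in a column sum to at most `1` when both factors have
orthonormal columns. -/
theorem sum_sq_transpose_mul_col_le {k : ℕ} {U : Matrix (Fin a) (Fin c) ℝ} (hU : Uᵀ * U = 1)
    {B : Matrix (Fin a) (Fin k) ℝ} (hB : Bᵀ * B = 1) (j : Fin k) :
    ∑ i, (Uᵀ * B) i j ^ 2 ≤ 1 := by
  have h := frobNorm_transpose_mul_le hU (B.submatrix id (fun _ : Fin 1 => j))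
  have h1 : (Bᵀ * B) j j = 1 := by rw [hB]; simp
  rw [Matrix.mul_apply] at h1
  simp only [frobNorm_sq_eq_sum, Fin.sum_univ_one, submatrix_apply, id, Matrix.mul_apply,
    transpose_apply] at h h1 ⊢
  calc _ ≤ _ := h
    _ = 1 := by rw [← h1]; exact Finset.sum_congr rfl fun _ _ => sq _

end TraceInner

/-! ### Spectral norm -/

section SpecNorm

variable {a b c : ℕ}

open scoped Matrix.Norms.L2Operator in
theorem specNorm_eq_norm (X : Matrix (Fin a) (Fin b) ℝ) : specNorm X = ‖X‖ := rfl

theorem specNorm_nonneg (X : Matrix (Fin a) (Fin b) ℝ) : 0 ≤ specNorm X := norm_nonneg _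

open scoped Matrix.Norms.L2Operator in
theorem specNorm_zero : specNorm (0 : Matrix (Fin a) (Fin b) ℝ) = 0 := by
  rw [specNorm_eq_norm, norm_zero]

open scoped Matrix.Norms.L2Operator in
theorem specNorm_add_le (X Y : Matrix (Fin a) (Fin b) ℝ) :
    specNorm (X + Y) ≤ specNorm X + specNorm Y := by
  simpa only [specNorm_eq_norm] using norm_add_le X Y

open scoped Matrix.Norms.L2Operator in
theorem specNorm_mul_le (X : Matrix (Fin a) (Fin b) ℝ) (Y : Matrix (Fin b) (Fin c) ℝ) :
    specNorm (X * Y) ≤ specNorm X * specNorm Y := by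
  simpa only [specNorm_eq_norm] using Matrix.l2_opNorm_mul X Y

open scoped Matrix.Norms.L2Operator in
theorem specNorm_transpose (X : Matrix (Fin a) (Fin b) ℝ) : specNorm Xᵀ = specNorm X := by
  rw [← conjTranspose_eq_transpose_of_trivial]
  exact Matrix.l2_opNorm_conjTranspose X

open scoped Matrix.Norms.L2Operator in
theorem specNorm_transpose_mul_self (X : Matrix (Fin a) (Fin b) ℝ) :
    specNorm (Xᵀ * X) = specNorm X * specNorm X := by
  rw [← conjTranspose_eq_transpose_of_trivial]
  exact Matrix.l2_opNorm_conjTranspose_mul_self X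

open scoped Matrix.Norms.L2Operator in
theorem specNorm_diagonal_le {d : Fin a → ℝ} {t : ℝ} (ht : 0 ≤ t) (h : ∀ i, |d i| ≤ t) :
    specNorm (diagonal d) ≤ t := by
  rw [specNorm_eq_norm, Matrix.l2_opNorm_diagonal]
  exact (pi_norm_le_iff_of_nonneg ht).2 h

theorem specNorm_orth_le {U : Matrix (Fin a) (Fin c) ℝ} (hU : Uᵀ * U = 1) : specNorm U ≤ 1 := by
  have h := specNorm_transpose_mul_self U
  have h1 : specNorm (1 : Matrix (Fin c) (Fin c) ℝ) ≤ 1 := by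
    rw [← diagonal_one]
    exact specNorm_diagonal_le zero_le_one fun _ => by simp
  rw [hU] at h
  nlinarith [specNorm_nonneg U]

theorem specNorm_projector_compl_le {U : Matrix (Fin a) (Fin c) ℝ} (hU : Uᵀ * U = 1) :
    specNorm (1 - U * Uᵀ) ≤ 1 := by
  have h := specNorm_transpose_mul_self (1 - U * Uᵀ)
  have hp : U * Uᵀ * (U * Uᵀ) = U * Uᵀ := by
    rw [Matrix.mul_assoc, ← Matrix.mul_assoc Uᵀ, hU, Matrix.one_mul]
  have e : (1 - U * Uᵀ)ᵀ * (1 - U * Uᵀ) = 1 - U * Uᵀ := by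
    simp only [transpose_sub, transpose_one, transpose_mul, transpose_transpose, Matrix.mul_sub,
      Matrix.sub_mul, Matrix.one_mul, Matrix.mul_one, hp]
    abel
  rw [e] at h
  nlinarith [specNorm_nonneg (1 - U * Uᵀ)]

open scoped Matrix.Norms.L2Operator in
theorem abs_apply_le_specNorm (X : Matrix (Fin a) (Fin b) ℝ) (i : Fin a) (j : Fin b) :
    |X i j| ≤ specNorm X := by
  have h := Matrix.l2_opNorm_mulVec X (EuclideanSpace.single j (1 : ℝ))
  have h2 := PiLp.norm_apply_le (p := 2)
    (WithLp.toLp 2 (X *ᵥ (EuclideanSpace.single j (1 : ℝ)).ofLp)) i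
  simp at h h2
  exact h2.trans h

theorem frobNorm_mul_col_le (Z : Matrix (Fin a) (Fin b) ℝ) (x : Matrix (Fin b) (Fin 1) ℝ) :
    frobNorm (Z * x) ≤ specNorm Z * frobNorm x := by
  have h := ContinuousLinearMap.le_opNorm
    (LinearMap.toContinuousLinearMap (Matrix.toEuclideanLin Z)) (WithLp.toLp 2 fun i => x i 0)
  have e1 : frobNorm x = ‖(WithLp.toLp 2 fun i => x i 0 : EuclideanSpace ℝ (Fin b))‖ := by
    rw [frobNorm, EuclideanSpace.norm_eq]
    simp [trInner, sq]
  have e2 : frobNorm (Z * x) = ‖Matrix.toEuclideanLin Z (WithLp.toLp 2 fun i => x i 0)‖ := by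
    rw [frobNorm, EuclideanSpace.norm_eq]
    simp [trInner, sq, Matrix.mul_apply, Matrix.mulVec, dotProduct]
  rw [e1, e2]
  exact h

theorem specNorm_le_of_col {Z : Matrix (Fin a) (Fin b) ℝ} {t : ℝ} (ht : 0 ≤ t)
    (h : ∀ x : Matrix (Fin b) (Fin 1) ℝ, frobNorm (Z * x) ≤ t * frobNorm x) : specNorm Z ≤ t := by
  refine ContinuousLinearMap.opNorm_le_bound _ ht fun x => ?_
  have h := h (Matrix.of fun (i : Fin b) (_ : Fin 1) => x i)
  have e1 : frobNorm (Matrix.of fun (i : Fin b) (_ : Fin 1) => x i) = ‖x‖ := by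
    rw [frobNorm, EuclideanSpace.norm_eq]
    simp [trInner, sq]
  have e2 : frobNorm (Z * Matrix.of fun (i : Fin b) (_ : Fin 1) => x i) =
      ‖Matrix.toEuclideanLin Z x‖ := by
    rw [frobNorm, EuclideanSpace.norm_eq]
    simp [trInner, sq, Matrix.mul_apply, Matrix.mulVec, dotProduct]
  rw [e1, e2] at h
  exact h

theorem specNorm_le_frobNorm (X : Matrix (Fin a) (Fin b) ℝ) : specNorm X ≤ frobNorm X :=
  specNorm_le_of_col (frobNorm_nonneg X) fun x => frobNorm_mul_le X x

end SpecNorm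

/-! ### Singular value decompositions and trace inequalities -/

/-- The matrix `U Diag(d) Vᵀ`. -/
noncomputable def svdMat {a b c : ℕ} (U : Matrix (Fin a) (Fin c) ℝ) (d : Fin c → ℝ)
    (V : Matrix (Fin b) (Fin c) ℝ) : Matrix (Fin a) (Fin b) ℝ :=
  U * diagonal d * Vᵀ

/-- The indicator of the first `k` of `c` indices; `svdMat U (headInd c k) V` is the product of the
first `k` columns of `U` with the transposed first `k` columns of `V`. -/
noncomputable def headInd (c k : ℕ) (i : Fin c) : ℝ := if (i : ℕ) < k then 1 else 0

section SvdMat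

variable {a b c l : ℕ}

theorem svdMat_add (U : Matrix (Fin a) (Fin c) ℝ) (d e : Fin c → ℝ) (V : Matrix (Fin b) (Fin c) ℝ) :
    svdMat U (fun i => d i + e i) V = svdMat U d V + svdMat U e V := by
  rw [svdMat, ← diagonal_add, Matrix.mul_add, Matrix.add_mul, svdMat, svdMat]

theorem svdMat_sum {ι : Type*} (s : Finset ι) (U : Matrix (Fin a) (Fin c) ℝ) (d : ι → Fin c → ℝ)
    (V : Matrix (Fin b) (Fin c) ℝ) :
    svdMat U (fun i => ∑ j ∈ s, d j i) V = ∑ j ∈ s, svdMat U (d j) V := by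
  classical
  induction s using Finset.induction_on with
  | empty =>
    have : (diagonal fun _ : Fin c => (0 : ℝ)) = 0 := diagonal_zero
    simp [svdMat, this]
  | insert j s hj ih =>
    rw [Finset.sum_insert hj, ← ih, ← svdMat_add]
    congr 1
    funext i
    rw [Finset.sum_insert hj]

theorem trInner_svdMat_left (U : Matrix (Fin a) (Fin c) ℝ) (d : Fin c → ℝ)
    (V : Matrix (Fin b) (Fin c) ℝ) (X : Matrix (Fin a) (Fin b) ℝ) :
    trInner (svdMat U d V) X = ∑ i, d i * (Uᵀ * X * V) i i := by
  rw [svdMat, trInner_mul_right, transpose_transpose, trInner_mul_left, trInner_eq_trace,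
    diagonal_transpose, ← Matrix.mul_assoc Uᵀ, Matrix.trace]
  simp [Matrix.diagonal_mul]

theorem transpose_mul_svdMat_mul {U : Matrix (Fin a) (Fin c) ℝ} {V : Matrix (Fin b) (Fin c) ℝ}
    (hU : Uᵀ * U = 1) (hV : Vᵀ * V = 1) (d : Fin c → ℝ) :
    Uᵀ * svdMat U d V * V = diagonal d := by
  rw [svdMat, Matrix.mul_assoc, Matrix.mul_assoc (U * diagonal d), hV, Matrix.mul_one,
    ← Matrix.mul_assoc, hU, Matrix.one_mul]

theorem trInner_svdMat_svdMat {U : Matrix (Fin a) (Fin c) ℝ} {V : Matrix (Fin b) (Fin c) ℝ}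
    (hU : Uᵀ * U = 1) (hV : Vᵀ * V = 1) (d e : Fin c → ℝ) :
    trInner (svdMat U d V) (svdMat U e V) = ∑ i, d i * e i := by
  rw [trInner_svdMat_left, transpose_mul_svdMat_mul hU hV]
  simp

theorem frobNorm_sq_svdMat {U : Matrix (Fin a) (Fin c) ℝ} {V : Matrix (Fin b) (Fin c) ℝ}
    (hU : Uᵀ * U = 1) (hV : Vᵀ * V = 1) (d : Fin c → ℝ) :
    frobNorm (svdMat U d V) ^ 2 = ∑ i, d i ^ 2 := by
  rw [frobNorm_sq, trInner_svdMat_svdMat hU hV]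
  exact Finset.sum_congr rfl fun _ _ => (sq _).symm

theorem specNorm_svdMat_le {U : Matrix (Fin a) (Fin c) ℝ} {V : Matrix (Fin b) (Fin c) ℝ}
    (hU : Uᵀ * U = 1) (hV : Vᵀ * V = 1) {d : Fin c → ℝ} {t : ℝ} (ht : 0 ≤ t)
    (h : ∀ i, |d i| ≤ t) : specNorm (svdMat U d V) ≤ t := by
  have h1 := specNorm_mul_le (U * diagonal d) Vᵀ
  have h2 := specNorm_mul_le U (diagonal d)
  rw [specNorm_transpose] at h1
  have hd := specNorm_diagonal_le ht h
  calc specNorm (svdMat U d V) ≤ specNorm (U * diagonal d) * specNorm V := h1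
    _ ≤ specNorm (U * diagonal d) * 1 :=
        mul_le_mul_of_nonneg_left (specNorm_orth_le hV) (specNorm_nonneg _)
    _ ≤ specNorm U * specNorm (diagonal d) := by rw [mul_one]; exact h2
    _ ≤ 1 * t := mul_le_mul (specNorm_orth_le hU) hd (specNorm_nonneg _) zero_le_one
    _ = t := one_mul t

theorem abs_diag_transpose_mul_mul_le {U : Matrix (Fin a) (Fin c) ℝ} {V : Matrix (Fin b) (Fin c) ℝ}
    (hU : Uᵀ * U = 1) (hV : Vᵀ * V = 1) (Z : Matrix (Fin a) (Fin b) ℝ) (i : Fin c) :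
    |(Uᵀ * Z * V) i i| ≤ specNorm Z := by
  have h1 := specNorm_mul_le (Uᵀ * Z) V
  have h2 := specNorm_mul_le Uᵀ Z
  rw [specNorm_transpose] at h2
  have h3 := specNorm_orth_le hU
  have h4 := specNorm_orth_le hV
  have h5 := specNorm_nonneg Z
  have h6 := specNorm_nonneg (Uᵀ * Z)
  calc _ ≤ _ := abs_apply_le_specNorm _ i i
    _ ≤ specNorm (Uᵀ * Z) * specNorm V := h1
    _ ≤ specNorm (Uᵀ * Z) := mul_le_of_le_one_right h6 h4
    _ ≤ specNorm U * specNorm Z := h2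
    _ ≤ specNorm Z := mul_le_of_le_one_left h5 h3

theorem rank_svdMat_le (U : Matrix (Fin a) (Fin c) ℝ) (d : Fin c → ℝ)
    (V : Matrix (Fin b) (Fin c) ℝ) :
    (svdMat U d V).rank ≤ Fintype.card {i // d i ≠ 0} := by
  rw [← rank_diagonal]
  exact (rank_mul_le_left _ _).trans (rank_mul_le_right _ _)

theorem sum_headInd_mul {k : ℕ} (hk : k ≤ c) (s : ℕ → ℝ) :
    ∑ i : Fin c, headInd c k i * s i = ∑ i ∈ Finset.range k, s i := by
  have h := Fin.sum_univ_eq_sum_range (fun i => (if i < k then (1 : ℝ) else 0) * s i) c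
  simp only [headInd]
  rw [h]
  simp only [ite_mul, one_mul, zero_mul]
  rw [← Finset.sum_filter]
  congr 1
  ext i
  simp only [Finset.mem_filter, Finset.mem_range]
  omega

theorem sum_headInd {k : ℕ} (hk : k ≤ c) : ∑ i : Fin c, headInd c k i = k := by
  simpa using sum_headInd_mul hk (fun _ => (1 : ℝ))

theorem headInd_nonneg (k : ℕ) (i : Fin c) : 0 ≤ headInd c k i := by
  unfold headInd; split_ifs <;> norm_num

theorem headInd_le_one (k : ℕ) (i : Fin c) : headInd c k i ≤ 1 := by
  unfold headInd; split_ifs <;> norm_num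

theorem headInd_self (i : Fin c) : headInd c c i = 1 := if_pos i.2

end SvdMat

section Trace

variable {a b c l : ℕ} {U : Matrix (Fin a) (Fin c) ℝ} {V : Matrix (Fin b) (Fin c) ℝ}
  {A : Matrix (Fin a) (Fin l) ℝ} {B : Matrix (Fin b) (Fin l) ℝ}

theorem diag_transpose_mul_svdMat_mul (U : Matrix (Fin a) (Fin c) ℝ) (V : Matrix (Fin b) (Fin c) ℝ)
    (A : Matrix (Fin a) (Fin l) ℝ) (B : Matrix (Fin b) (Fin l) ℝ) (e : Fin l → ℝ) (i : Fin c) :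
    (Uᵀ * svdMat A e B * V) i i = ∑ j, e j * ((Uᵀ * A) i j * (Vᵀ * B) i j) := by
  have h : Uᵀ * svdMat A e B * V = Uᵀ * A * diagonal e * (Vᵀ * B)ᵀ := by
    simp only [svdMat, transpose_mul, transpose_transpose, Matrix.mul_assoc]
  rw [h, Matrix.mul_apply]
  refine Finset.sum_congr rfl fun j _ => ?_
  rw [Matrix.mul_diagonal, transpose_apply]
  ring

theorem abs_diag_le_one (hU : Uᵀ * U = 1) (hV : Vᵀ * V = 1) (hA : Aᵀ * A = 1) (hB : Bᵀ * B = 1)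
    {e : Fin l → ℝ} (he0 : ∀ j, 0 ≤ e j) (he1 : ∀ j, e j ≤ 1) (i : Fin c) :
    |(Uᵀ * svdMat A e B * V) i i| ≤ 1 :=
  (abs_diag_transpose_mul_mul_le hU hV _ i).trans
    (specNorm_svdMat_le hA hB zero_le_one fun j => by rw [abs_of_nonneg (he0 j)]; exact he1 j)

/-- In any pair of orthonormal systems, the absolute values of the diagonal entries sum to at most
the nuclear norm. -/
theorem sum_abs_diag_le (hU : Uᵀ * U = 1) (hV : Vᵀ * V = 1) (hA : Aᵀ * A = 1) (hB : Bᵀ * B = 1)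
    {e : Fin l → ℝ} (he0 : ∀ j, 0 ≤ e j) :
    ∑ i, |(Uᵀ * svdMat A e B * V) i i| ≤ ∑ j, e j := by
  calc ∑ i, |(Uᵀ * svdMat A e B * V) i i|
      ≤ ∑ i, ∑ j, e j * (((Uᵀ * A) i j ^ 2 + (Vᵀ * B) i j ^ 2) / 2) := by
        refine Finset.sum_le_sum fun i _ => ?_
        rw [diag_transpose_mul_svdMat_mul]
        refine (Finset.abs_sum_le_sum_abs _ _).trans (Finset.sum_le_sum fun j _ => ?_)
        rw [abs_mul, abs_of_nonneg (he0 j)]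
        refine mul_le_mul_of_nonneg_left (abs_le.2 ⟨?_, ?_⟩) (he0 j)
        · nlinarith [sq_nonneg ((Uᵀ * A) i j + (Vᵀ * B) i j)]
        · nlinarith [sq_nonneg ((Uᵀ * A) i j - (Vᵀ * B) i j)]
    _ = ∑ j, e j * ((∑ i, (Uᵀ * A) i j ^ 2 + ∑ i, (Vᵀ * B) i j ^ 2) / 2) := by
        rw [Finset.sum_comm]
        refine Finset.sum_congr rfl fun j _ => ?_
        rw [← Finset.mul_sum, ← Finset.sum_div, Finset.sum_add_distrib]
    _ ≤ ∑ j, e j := by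
        refine Finset.sum_le_sum fun j _ => mul_le_of_le_one_right (he0 j) ?_
        linarith [sum_sq_transpose_mul_col_le hU hA j, sum_sq_transpose_mul_col_le hV hB j]

/-- Ky Fan's inequality with a defect term: a matrix `P` with singular values in `[0, 1]` summing
to at most `k` satisfies `⟨P, X⟩ ≤ s₁ + ⋯ + s_k`, with a loss proportional to the gap
`s_k - s_{k+1}` and to the distance of `P` to the leading factor of `X`. -/
theorem kyFan_gap (hU : Uᵀ * U = 1) (hV : Vᵀ * V = 1) (hA : Aᵀ * A = 1) (hB : Bᵀ * B = 1)
    {e : Fin l → ℝ} (he0 : ∀ j, 0 ≤ e j) (he1 : ∀ j, e j ≤ 1) {k : ℕ} (hk1 : 1 ≤ k) (hk : k ≤ c)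
    (hek : ∑ j, e j ≤ k) {s : ℕ → ℝ} (hs : Antitone s) (hs0 : ∀ i, 0 ≤ s i) :
    trInner (svdMat A e B) (svdMat U (fun i => s i) V) ≤ ∑ i ∈ Finset.range k, s i -
      (s (k - 1) - s k) * (k - trInner (svdMat A e B) (svdMat U (headInd c k) V)) := by
  set p : Fin c → ℝ := fun i => (Uᵀ * svdMat A e B * V) i i with hp
  have hp1 : ∀ i, |p i| ≤ 1 := abs_diag_le_one hU hV hA hB he0 he1
  have hps : ∑ i, |p i| ≤ k := (sum_abs_diag_le hU hV hA hB he0).trans hek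
  rw [trInner_comm, trInner_svdMat_left, trInner_comm, trInner_svdMat_left]
  change ∑ i : Fin c, s i * p i ≤ _ - _ * (_ - ∑ i, headInd c k i * p i)
  have key : ∀ i : Fin c, s i * p i ≤ headInd c k i * s i -
      (s (k - 1) - s k) * (headInd c k i - headInd c k i * p i) +
        s k * (|p i| - headInd c k i) := by
    intro i
    have h1 := abs_le.1 (hp1 i)
    have h2 := le_abs_self (p i)
    unfold headInd
    split_ifs with hi
    · have h3 : s (k - 1) ≤ s i := hs (by omega)
      nlinarith [mul_nonneg (sub_nonneg.2 h3) (sub_nonneg.2 h1.2),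
        mul_nonneg (hs0 k) (sub_nonneg.2 h2)]
    · have h3 : s i ≤ s k := hs (by omega)
      nlinarith [mul_le_mul_of_nonneg_left h2 (hs0 i),
        mul_le_mul_of_nonneg_right h3 (abs_nonneg (p i))]
  calc _ ≤ _ := Finset.sum_le_sum fun i _ => key i
    _ = ∑ i ∈ Finset.range k, s i -
      (s (k - 1) - s k) * (k - ∑ i, headInd c k i * p i) + s k * (∑ i, |p i| - k) := by
        rw [Finset.sum_add_distrib, Finset.sum_sub_distrib, ← Finset.mul_sum, ← Finset.mul_sum,
          Finset.sum_sub_distrib, Finset.sum_sub_distrib, sum_headInd hk, sum_headInd_mul hk]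
    _ ≤ _ := by nlinarith [mul_nonneg (hs0 k) (sub_nonneg.2 hps)]

/-- Ky Fan's inequality. -/
theorem kyFan (hU : Uᵀ * U = 1) (hV : Vᵀ * V = 1) (hA : Aᵀ * A = 1) (hB : Bᵀ * B = 1)
    {k : ℕ} (hk : k ≤ c) (hkl : k ≤ l) {s : ℕ → ℝ} (hs : Antitone s) (hs0 : ∀ i, 0 ≤ s i) :
    trInner (svdMat A (headInd l k) B) (svdMat U (fun i => s i) V) ≤ ∑ i ∈ Finset.range k, s i := by
  rcases Nat.eq_zero_or_pos k with rfl | hk1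
  · rw [trInner_svdMat_left]
    simp [headInd]
  refine (kyFan_gap hU hV hA hB (headInd_nonneg k) (headInd_le_one k) hk1 hk
    (sum_headInd hkl).le hs hs0).trans
      (sub_le_self _ (mul_nonneg (sub_nonneg.2 (hs (by omega))) ?_))
  rw [sub_nonneg, trInner_svdMat_left, ← sum_headInd hkl]
  refine Finset.sum_le_sum fun j _ => mul_le_of_le_one_right (headInd_nonneg k j) ?_
  exact (abs_le.1 (abs_diag_le_one hA hB hU hV (headInd_nonneg k) (headInd_le_one k) j)).2

/-- Summation by parts: nonnegative partial sums stay nonnegative under decreasing weights, and a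
gap in the weights controls the corresponding partial sum. -/
theorem gap_mul_sum_range_le {w D : ℕ → ℝ} (hw : Antitone w) (hw0 : ∀ i, 0 ≤ w i) {r n : ℕ}
    (hr1 : 1 ≤ r) (hrn : r < n) (hS : ∀ k ≤ n, 0 ≤ ∑ i ∈ Finset.range k, D i) :
    (w (r - 1) - w r) * ∑ i ∈ Finset.range r, D i ≤ ∑ i ∈ Finset.range n, w i * D i := by
  have base : ∀ k, k + 1 ≤ n →
      w k * ∑ i ∈ Finset.range (k + 1), D i ≤ ∑ i ∈ Finset.range (k + 1), w i * D i := by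
    intro k
    induction k with
    | zero => intro _; simp
    | succ k ih =>
      intro hk
      have h1 := ih (by omega)
      have h2 := hS (k + 1) (by omega)
      have h3 : w (k + 1) ≤ w k := hw (by omega)
      rw [Finset.sum_range_succ _ (k + 1), Finset.sum_range_succ _ (k + 1)]
      nlinarith [mul_le_mul_of_nonneg_right h3 h2]
  have step : ∀ k, r ≤ k → k + 1 ≤ n → (w (r - 1) - w r) * ∑ i ∈ Finset.range r, D i +
      w k * ∑ i ∈ Finset.range (k + 1), D i ≤ ∑ i ∈ Finset.range (k + 1), w i * D i := by
    intro k hk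
    induction k, hk using Nat.le_induction with
    | base =>
      intro hk
      have h1 := base (r - 1) (by omega)
      rw [Nat.sub_add_cancel hr1] at h1
      rw [Finset.sum_range_succ _ r, Finset.sum_range_succ _ r]
      linarith
    | succ k hrk ih =>
      intro hk
      have h1 := ih (by omega)
      have h2 := hS (k + 1) (by omega)
      have h3 : w (k + 1) ≤ w k := hw (by omega)
      rw [Finset.sum_range_succ _ (k + 1), Finset.sum_range_succ _ (k + 1)]
      nlinarith [mul_le_mul_of_nonneg_right h3 h2]
  have h := step (n - 1) (by omega) (by omega)
  rw [Nat.sub_add_cancel (by omega : 1 ≤ n)] at h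
  linarith [mul_nonneg (hw0 (n - 1)) (hS n le_rfl)]

theorem sum_range_mul_nonneg {w D : ℕ → ℝ} (hw : Antitone w) (hw0 : ∀ i, 0 ≤ w i) {n : ℕ}
    (hS : ∀ k ≤ n, 0 ≤ ∑ i ∈ Finset.range k, D i) : 0 ≤ ∑ i ∈ Finset.range n, w i * D i := by
  rcases lt_or_ge 1 n with hn | hn
  · exact (mul_nonneg (sub_nonneg.2 (hw (by omega))) (hS 1 hn.le)).trans
      (gap_mul_sum_range_le hw hw0 le_rfl hn hS)
  · interval_cases n
    · simp
    · simpa using mul_nonneg (hw0 0) (by simpa using hS 1 le_rfl)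

/-- The partial sums of the differences `sᵢ - uᵢᵀ X vᵢ` are nonnegative. -/
theorem exists_diag_defect (hU : Uᵀ * U = 1) (hV : Vᵀ * V = 1) (hA : Aᵀ * A = 1) (hB : Bᵀ * B = 1)
    (hlc : l ≤ c) {s : ℕ → ℝ} (hs : Antitone s) (hs0 : ∀ i, 0 ≤ s i) :
    ∃ D : ℕ → ℝ, (∀ i : Fin l, D i = s i - (Aᵀ * svdMat U (fun i => s i) V * B) i i) ∧
      (∀ k ≤ l, ∑ i ∈ Finset.range k, D i = ∑ i ∈ Finset.range k, s i -
        trInner (svdMat A (headInd l k) B) (svdMat U (fun i => s i) V)) ∧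
      ∀ k ≤ l, 0 ≤ ∑ i ∈ Finset.range k, D i := by
  obtain ⟨D, hD⟩ : ∃ D : ℕ → ℝ, ∀ i : Fin l,
      D i = s i - (Aᵀ * svdMat U (fun i => s i) V * B) i i :=
    ⟨fun i => s i - if h : i < l then
      (Aᵀ * svdMat U (fun i => s i) V * B) ⟨i, h⟩ ⟨i, h⟩ else 0, fun i => by simp⟩
  have hsum : ∀ k ≤ l, ∑ i ∈ Finset.range k, D i = ∑ i ∈ Finset.range k, s i -
        trInner (svdMat A (headInd l k) B) (svdMat U (fun i => s i) V) := by
    intro k hk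
    rw [← sum_headInd_mul hk, ← sum_headInd_mul hk, trInner_svdMat_left, ← Finset.sum_sub_distrib]
    refine Finset.sum_congr rfl fun i _ => ?_
    rw [hD]
    ring
  refine ⟨D, hD, hsum, fun k hk => ?_⟩
  rw [hsum k hk, sub_nonneg]
  exact kyFan hU hV hA hB (hk.trans hlc) hk hs hs0

/-- Von Neumann's trace inequality. -/
theorem vonNeumann (hU : Uᵀ * U = 1) (hV : Vᵀ * V = 1) (hA : Aᵀ * A = 1) (hB : Bᵀ * B = 1)
    (hlc : l ≤ c) {s w : ℕ → ℝ} (hs : Antitone s) (hs0 : ∀ i, 0 ≤ s i) (hw : Antitone w)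
    (hw0 : ∀ i, 0 ≤ w i) :
    trInner (svdMat A (fun i => w i) B) (svdMat U (fun i => s i) V) ≤
      ∑ i ∈ Finset.range l, w i * s i := by
  obtain ⟨D, hD, -, hS⟩ := exists_diag_defect hU hV hA hB hlc hs hs0
  have h := sum_range_mul_nonneg hw hw0 hS
  rw [← Fin.sum_univ_eq_sum_range] at h ⊢
  rw [trInner_svdMat_left, ← sub_nonneg, ← Finset.sum_sub_distrib]
  convert h using 2 with i
  rw [hD]
  ring

/-- In the equality case of von Neumann's inequality, a gap `w_r > w_{r+1}` forces the leading
factor `U_r V_rᵀ` of the first matrix to attain the Ky Fan `r`-norm of the second one. -/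
theorem kyFan_eq_of_vonNeumann_eq (hU : Uᵀ * U = 1) (hV : Vᵀ * V = 1) (hA : Aᵀ * A = 1)
    (hB : Bᵀ * B = 1) (hlc : l ≤ c) {s w : ℕ → ℝ} (hs : Antitone s) (hs0 : ∀ i, 0 ≤ s i)
    (hw : Antitone w) (hw0 : ∀ i, 0 ≤ w i) {r : ℕ} (hr1 : 1 ≤ r) (hrl : r < l)
    (hgap : w r < w (r - 1))
    (heq : trInner (svdMat A (fun i => w i) B) (svdMat U (fun i => s i) V) =
      ∑ i ∈ Finset.range l, w i * s i) :
    trInner (svdMat A (headInd l r) B) (svdMat U (fun i => s i) V) =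
      ∑ i ∈ Finset.range r, s i := by
  obtain ⟨D, hD, hsum, hS⟩ := exists_diag_defect hU hV hA hB hlc hs hs0
  have h := gap_mul_sum_range_le hw hw0 hr1 hrl hS
  have h0 : ∑ i ∈ Finset.range l, w i * D i = 0 := by
    rw [← Fin.sum_univ_eq_sum_range] at heq ⊢
    rw [trInner_svdMat_left, ← sub_eq_zero, ← Finset.sum_sub_distrib, ← neg_eq_zero,
      ← Finset.sum_neg_distrib] at heq
    rw [← heq]
    refine Finset.sum_congr rfl fun i _ => ?_
    rw [hD]
    ring
  rw [h0] at h
  have h2 := hS r hrl.le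
  rw [hsum r hrl.le] at h h2
  nlinarith [sub_pos.2 hgap]

/-- Two decompositions of one matrix have the same singular values, as each of them computes all
Ky Fan norms. -/
theorem svdMat_singularValues_unique (hU : Uᵀ * U = 1) (hV : Vᵀ * V = 1)
    {A : Matrix (Fin a) (Fin c) ℝ} {B : Matrix (Fin b) (Fin c) ℝ} (hA : Aᵀ * A = 1)
    (hB : Bᵀ * B = 1) {s w : ℕ → ℝ} (hs : Antitone s) (hs0 : ∀ i, 0 ≤ s i) (hw : Antitone w)
    (hw0 : ∀ i, 0 ≤ w i) (h : svdMat U (fun i => s i) V = svdMat A (fun i => w i) B)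
    (i : Fin c) : s i = w i := by
  have key : ∀ k ≤ c, ∑ i ∈ Finset.range k, s i = ∑ i ∈ Finset.range k, w i := by
    intro k hk
    have h1 := kyFan hU hV hA hB hk hk hs hs0
    have h2 := kyFan hA hB hU hV hk hk hw hw0
    rw [h, trInner_svdMat_svdMat hA hB, sum_headInd_mul hk] at h1
    rw [← h, trInner_svdMat_svdMat hU hV, sum_headInd_mul hk] at h2
    linarith
  have h1 := key i i.2.le
  have h2 := key (i + 1) i.2
  rw [Finset.sum_range_succ, Finset.sum_range_succ] at h2
  linarith

end Trace

section Sing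

variable {a b : ℕ}

theorem sing_nonneg (X : Matrix (Fin a) (Fin b) ℝ) (i : ℕ) : 0 ≤ sing X i :=
  LinearMap.singularValues_nonneg _ i

theorem sing_antitone (X : Matrix (Fin a) (Fin b) ℝ) : Antitone (sing X) :=
  LinearMap.singularValues_antitone _

/-- The matrix whose columns are the given vectors. -/
noncomputable def colMat {c : ℕ} (v : Fin c → EuclideanSpace ℝ (Fin a)) :
    Matrix (Fin a) (Fin c) ℝ := Matrix.of fun i j => v j i

theorem colMat_orth {c : ℕ} {v : Fin c → EuclideanSpace ℝ (Fin a)} (hv : Orthonormal ℝ v) :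
    (colMat v)ᵀ * colMat v = 1 := by
  ext i j
  have h := orthonormal_iff_ite.1 hv i j
  rw [Matrix.one_apply, ← h, Matrix.mul_apply, PiLp.inner_apply]
  exact Finset.sum_congr rfl fun k _ => by simp [colMat, mul_comm]

/-- Every matrix with at most as many rows as columns has a singular value decomposition. -/
theorem exists_svd (hab : a ≤ b) (X : Matrix (Fin a) (Fin b) ℝ) :
    ∃ (U : Matrix (Fin a) (Fin a) ℝ) (V : Matrix (Fin b) (Fin a) ℝ), Uᵀ * U = 1 ∧ Vᵀ * V = 1 ∧
      X = svdMat U (fun i => sing X i) V := by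
  obtain ⟨d, rfl⟩ := Nat.exists_eq_add_of_le hab
  set T := Matrix.toEuclideanLin X with hT
  have hfin : Module.finrank ℝ (EuclideanSpace ℝ (Fin (a + d))) = a + d :=
    finrank_euclideanSpace_fin
  set v := T.isSymmetric_adjoint_comp_self.eigenvectorBasis hfin with hv
  have hsing : ∀ i, sing X i = T.singularValues i := fun _ => rfl
  have hinner : ∀ i j : Fin (a + d), inner ℝ (T (v i)) (T (v j)) =
      if i = j then sing X i ^ 2 else 0 := by
    intro i j
    have h1 : inner ℝ (T (v i)) (T (v j)) = inner ℝ (v i) ((LinearMap.adjoint T ∘ₗ T) (v j)) := by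
      rw [LinearMap.comp_apply, LinearMap.adjoint_inner_right]
    rw [h1, hv, T.isSymmetric_adjoint_comp_self.apply_eigenvectorBasis hfin j,
      inner_smul_right, orthonormal_iff_ite.1 (OrthonormalBasis.orthonormal _) i j, hsing,
      T.sq_singularValues_fin hfin i]
    split_ifs with h
    · subst h; simp
    · simp
  have hzero : ∀ i : Fin (a + d), sing X i = 0 → T (v i) = 0 := by
    intro i hi
    have := hinner i i
    rw [if_pos rfl, hi] at this
    simpa using this
  set S : Set (Fin a) := {i | 0 < sing X i} with hS
  set u₀ : Fin a → EuclideanSpace ℝ (Fin a) :=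
    fun i => (sing X i)⁻¹ • T (v (Fin.castAdd d i)) with hu₀
  have hon : Orthonormal ℝ (S.domRestrict u₀) := by
    rw [orthonormal_iff_ite]
    rintro ⟨i, hi⟩ ⟨j, hj⟩
    have hi' : sing X i ≠ 0 := ne_of_gt hi
    simp only [Set.domRestrict_apply, hu₀, inner_smul_left, inner_smul_right, hinner]
    by_cases h : i = j
    · subst h
      simp
      field_simp
    · have h' : Fin.castAdd d i ≠ Fin.castAdd d j := fun hh => h (Fin.castAdd_injective _ _ hh)
      simp [h]
  obtain ⟨u, hu⟩ := hon.exists_orthonormalBasis_extension_of_card_eq (by simp)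
  have hTv : ∀ i : Fin a, T (v (Fin.castAdd d i)) = sing X i • u i := by
    intro i
    by_cases hi : 0 < sing X i
    · rw [hu i hi, hu₀]
      simp only
      rw [smul_inv_smul₀ hi.ne']
    · have h0 : sing X i = 0 := le_antisymm (not_lt.1 hi) (sing_nonneg X i)
      rw [h0, zero_smul]
      exact hzero _ h0
  have hTv' : ∀ i : Fin d, T (v (Fin.natAdd a i)) = 0 := by
    intro i
    apply hzero
    rw [hsing, LinearMap.singularValues_eq_zero_iff_le_finrank_range]
    refine (Submodule.finrank_le _).trans ?_
    simp
  refine ⟨colMat u, colMat fun i => v (Fin.castAdd d i), colMat_orth u.orthonormal,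
    colMat_orth (v.orthonormal.comp _ (Fin.castAdd_injective _ _)), ?_⟩
  ext i j
  have h1 : X i j = T (EuclideanSpace.single j (1 : ℝ)) i := by
    simp [hT]
  have h2 : T (EuclideanSpace.single j (1 : ℝ)) = ∑ k, v k j • T (v k) := by
    conv_lhs => rw [← v.sum_repr' (EuclideanSpace.single j (1 : ℝ))]
    rw [map_sum]
    refine Finset.sum_congr rfl fun k _ => ?_
    rw [map_smul, EuclideanSpace.inner_single_right]
    simp
  rw [h1, h2, Fin.sum_univ_add]
  simp only [hTv, hTv', smul_zero, Finset.sum_const_zero, add_zero]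
  rw [svdMat, Matrix.mul_apply]
  simp only [Matrix.mul_diagonal, transpose_apply, colMat, of_apply]
  simp [mul_comm]

/-- The singular values can be read off from any decomposition with decreasing weights. -/
theorem sing_svdMat (hab : a ≤ b) {U : Matrix (Fin a) (Fin a) ℝ} {V : Matrix (Fin b) (Fin a) ℝ}
    (hU : Uᵀ * U = 1) (hV : Vᵀ * V = 1) {w : ℕ → ℝ} (hw : Antitone w) (hw0 : ∀ i, 0 ≤ w i)
    (i : Fin a) : sing (svdMat U (fun i => w i) V) i = w i := by
  obtain ⟨U', V', hU', hV', h⟩ := exists_svd hab (svdMat U (fun i => w i) V)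
  exact svdMat_singularValues_unique hU' hV' hU hV (sing_antitone _) (sing_nonneg _) hw hw0 h.symm i

theorem sing_le_specNorm (hab : a ≤ b) (X : Matrix (Fin a) (Fin b) ℝ) (i : Fin a) :
    sing X i ≤ specNorm X := by
  obtain ⟨U, V, hU, hV, h⟩ := exists_svd hab X
  have h1 := abs_diag_transpose_mul_mul_le hU hV X i
  have h2 : (Uᵀ * X * V) i i = sing X i := by
    conv_lhs => rw [h]
    rw [transpose_mul_svdMat_mul hU hV, diagonal_apply_eq]
  rw [h2] at h1
  exact (le_abs_self _).trans h1

theorem nuclearNorm_eq_sum_range (X : Matrix (Fin a) (Fin b) ℝ) :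
    nuclearNorm X = ∑ i ∈ Finset.range a, sing X i :=
  Fin.sum_univ_eq_sum_range (fun i => sing X i) a

theorem nuclearNorm_nonneg (X : Matrix (Fin a) (Fin b) ℝ) : 0 ≤ nuclearNorm X :=
  Finset.sum_nonneg fun _ _ => sing_nonneg _ _

/-- The nuclear norm is dual to the spectral norm. -/
theorem trInner_le_specNorm_mul_nuclearNorm (hab : a ≤ b) (Z X : Matrix (Fin a) (Fin b) ℝ) :
    trInner Z X ≤ specNorm Z * nuclearNorm X := by
  obtain ⟨U, V, hU, hV, h⟩ := exists_svd hab X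
  rw [trInner_comm]
  conv_lhs => rw [h]
  rw [trInner_svdMat_left, nuclearNorm, Finset.mul_sum]
  refine Finset.sum_le_sum fun i _ => ?_
  rw [mul_comm (specNorm Z)]
  exact mul_le_mul_of_nonneg_left
    ((le_abs_self _).trans (abs_diag_transpose_mul_mul_le hU hV Z i)) (sing_nonneg _ _)

/-- The supremum in the duality of the spectral and the nuclear norm is attained. -/
theorem exists_dual_certificate (hab : a ≤ b) (X : Matrix (Fin a) (Fin b) ℝ) :
    ∃ Z : Matrix (Fin a) (Fin b) ℝ, specNorm Z ≤ 1 ∧ trInner Z X = nuclearNorm X := by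
  obtain ⟨U, V, hU, hV, h⟩ := exists_svd hab X
  refine ⟨svdMat U (fun _ => 1) V, specNorm_svdMat_le hU hV zero_le_one (by simp), ?_⟩
  conv_lhs => rw [h]
  rw [trInner_svdMat_svdMat hU hV]
  simp [nuclearNorm]

/-- Two terms of Mirsky's inequality `∑ᵢ (σᵢ(X) - σᵢ(Y))² ≤ ‖X - Y‖_F²`, for `Y` of rank at most
`l`. -/
theorem sing_perturbation {l : ℕ} (hab : a ≤ b) (X Y : Matrix (Fin a) (Fin b) ℝ)
    {A : Matrix (Fin a) (Fin l) ℝ} {B : Matrix (Fin b) (Fin l) ℝ} (hA : Aᵀ * A = 1)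
    (hB : Bᵀ * B = 1) (hl : 1 ≤ l) (hla : l < a) (hY : Y = svdMat A (fun i => sing Y i) B) :
    (sing Y (l - 1) - sing X (l - 1)) ^ 2 + sing X l ^ 2 ≤ frobNorm (X - Y) ^ 2 := by
  obtain ⟨U, V, hU, hV, h⟩ := exists_svd hab X
  have h1 := vonNeumann hU hV hA hB hla.le (sing_antitone X) (sing_nonneg X) (sing_antitone Y)
    (sing_nonneg Y)
  rw [← h, ← hY] at h1
  have h2 := frobNorm_sq_svdMat hU hV (fun i : Fin a => sing X i)
  have h3 := frobNorm_sq_svdMat hA hB (fun i : Fin l => sing Y i)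
  rw [← h, Fin.sum_univ_eq_sum_range (fun i => sing X i ^ 2)] at h2
  rw [← hY, Fin.sum_univ_eq_sum_range (fun i => sing Y i ^ 2)] at h3
  have h4 : frobNorm (X - Y) ^ 2 = frobNorm X ^ 2 + frobNorm Y ^ 2 - 2 * trInner Y X := by
    rw [frobNorm_sq, frobNorm_sq, frobNorm_sq, trInner_sub_left, trInner_sub_right,
      trInner_sub_right, trInner_comm X Y]
    ring
  have h5 : ∑ i ∈ Finset.range (l + 1), sing X i ^ 2 ≤ ∑ i ∈ Finset.range a, sing X i ^ 2 :=
    Finset.sum_le_sum_of_subset_of_nonneg (Finset.range_mono (by omega))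
      fun _ _ _ => sq_nonneg _
  rw [Finset.sum_range_succ] at h5
  have h6 : (sing Y (l - 1) - sing X (l - 1)) ^ 2 ≤
      ∑ i ∈ Finset.range l, (sing Y i - sing X i) ^ 2 :=
    Finset.single_le_sum (f := fun i => (sing Y i - sing X i) ^ 2) (fun _ _ => sq_nonneg _)
      (Finset.mem_range.2 (by omega))
  have h7 : ∑ i ∈ Finset.range l, (sing Y i - sing X i) ^ 2 = ∑ i ∈ Finset.range l, sing X i ^ 2 +
      ∑ i ∈ Finset.range l, sing Y i ^ 2 - 2 * ∑ i ∈ Finset.range l, sing Y i * sing X i := by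
    rw [Finset.mul_sum, ← Finset.sum_add_distrib, ← Finset.sum_sub_distrib]
    exact Finset.sum_congr rfl fun _ _ => by ring
  linarith

end Sing

/-! ### Perturbation of the leading factor -/

theorem sing_rank_eq_zero {a b : ℕ} (X : Matrix (Fin a) (Fin b) ℝ) : sing X X.rank = 0 := by
  have h : X.rank = Module.finrank ℝ (Matrix.toEuclideanLin X).range := by
    rw [Matrix.toEuclideanLin_eq_toLin_orthonormal]
    exact Matrix.rank_eq_finrank_range_toLin X _ _
  rw [h]
  exact LinearMap.singularValues_finrank_range_self _

section Leading

variable {a b r : ℕ} {Y : Matrix (Fin a) (Fin b) ℝ} {U₁ : Matrix (Fin a) (Fin r) ℝ}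
  {V₁ : Matrix (Fin b) (Fin r) ℝ}

theorem IsLeadingSVD.eq_svdMat (h : IsLeadingSVD Y U₁ V₁) :
    Y = svdMat U₁ (fun i => sing Y i) V₁ := h.eq

theorem IsLeadingSVD.sing_eq_zero (h : IsLeadingSVD Y U₁ V₁) : sing Y r = 0 := by
  have := sing_rank_eq_zero Y
  rwa [h.rank_eq] at this

theorem svdMat_headInd_self {c : ℕ} (U : Matrix (Fin a) (Fin c) ℝ) (V : Matrix (Fin b) (Fin c) ℝ) :
    svdMat U (headInd c c) V = U * Vᵀ := by
  have : headInd c c = fun _ => 1 := funext headInd_self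
  rw [svdMat, this, diagonal_one, Matrix.mul_one]

theorem trInner_svdMat_headInd_self {c k : ℕ} {U : Matrix (Fin a) (Fin c) ℝ}
    {V : Matrix (Fin b) (Fin c) ℝ} (hU : Uᵀ * U = 1) (hV : Vᵀ * V = 1) (hk : k ≤ c) :
    trInner (svdMat U (headInd c k) V) (svdMat U (headInd c k) V) = k := by
  rw [trInner_svdMat_svdMat hU hV, ← sum_headInd hk]
  refine Finset.sum_congr rfl fun i _ => ?_
  unfold headInd
  split_ifs <;> norm_num

theorem frobNorm_sq_sub (X Y : Matrix (Fin a) (Fin b) ℝ) :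
    frobNorm (X - Y) ^ 2 = trInner X X + trInner Y Y - 2 * trInner X Y := by
  rw [frobNorm_sq, trInner_sub_left, trInner_sub_right, trInner_sub_right, trInner_comm Y X]
  ring

/-- Monotonicity estimate for the leading factors: the Ky Fan `r`-norm has the subgradients
`U₁V₁ᵀ` at `Y` and `U_rV_rᵀ` at `X`, and it is strongly monotone there with a modulus given by
the spectral gaps. -/
theorem frobNorm_leading_sub_le (h : IsLeadingSVD Y U₁ V₁) (hr : 1 ≤ r) (hra : r < a)
    {X : Matrix (Fin a) (Fin b) ℝ} {U : Matrix (Fin a) (Fin a) ℝ} {V : Matrix (Fin b) (Fin a) ℝ}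
    (hU : Uᵀ * U = 1) (hV : Vᵀ * V = 1) (hX : X = svdMat U (fun i => sing X i) V) :
    (sing Y (r - 1) + sing X (r - 1) - sing X r) *
      frobNorm (U₁ * V₁ᵀ - svdMat U (headInd a r) V) ≤ 2 * frobNorm (X - Y) := by
  have hU₁ := h.orth_left
  have hV₁ := h.orth_right
  rw [← svdMat_headInd_self]
  set P := svdMat U₁ (headInd r r) V₁ with hP
  set Q := svdMat U (headInd a r) V with hQ
  have h1 := kyFan_gap hU hV hU₁ hV₁ (headInd_nonneg r) (headInd_le_one r) hr hra.le
    (sum_headInd le_rfl).le (sing_antitone X) (sing_nonneg X)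
  have h2 := kyFan_gap hU₁ hV₁ hU hV (headInd_nonneg r) (headInd_le_one r) hr le_rfl
    (sum_headInd hra.le).le (sing_antitone Y) (sing_nonneg Y)
  rw [← hX, ← hP, ← hQ] at h1
  rw [← h.eq_svdMat, ← hP, ← hQ, h.sing_eq_zero, trInner_comm Q P] at h2
  have h3 : trInner Q X = ∑ i ∈ Finset.range r, sing X i := by
    conv_lhs => rw [hX]
    rw [hQ, trInner_svdMat_svdMat hU hV, sum_headInd_mul hra.le]
  have h4 : trInner P Y = ∑ i ∈ Finset.range r, sing Y i := by
    conv_lhs => rw [h.eq_svdMat]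
    rw [hP, trInner_svdMat_svdMat hU₁ hV₁, sum_headInd_mul le_rfl]
  have h5 : frobNorm (P - Q) ^ 2 = 2 * (r - trInner P Q) := by
    rw [frobNorm_sq_sub, hP, hQ, trInner_svdMat_headInd_self hU₁ hV₁ le_rfl,
      trInner_svdMat_headInd_self hU hV hra.le]
    ring
  have h6 := trInner_le_frobNorm_mul (P - Q) (Y - X)
  rw [trInner_sub_left, trInner_sub_right, trInner_sub_right, frobNorm_sub_comm Y X] at h6
  rcases (frobNorm_nonneg (P - Q)).eq_or_lt with h0 | h0
  · rw [← h0, mul_zero]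
    exact mul_nonneg zero_le_two (frobNorm_nonneg _)
  · refine le_of_mul_le_mul_right ?_ h0
    have h7 : (sing Y (r - 1) + sing X (r - 1) - sing X r) * (r - trInner P Q) ≤
        frobNorm (P - Q) * frobNorm (X - Y) := by linarith
    rw [mul_assoc, ← sq, h5]
    linarith

/-- A matrix `U_rV_rᵀ` that attains the Ky Fan `r`-norm of `X` is the leading factor of `X` when
there is a gap after the `r`-th singular value. -/
theorem svdMat_headInd_unique (hr : 1 ≤ r) (hra : r < a)
    {X : Matrix (Fin a) (Fin b) ℝ} {U A : Matrix (Fin a) (Fin a) ℝ}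
    {V B : Matrix (Fin b) (Fin a) ℝ} (hU : Uᵀ * U = 1) (hV : Vᵀ * V = 1)
    (hX : X = svdMat U (fun i => sing X i) V) (hA : Aᵀ * A = 1) (hB : Bᵀ * B = 1)
    (hgap : sing X r < sing X (r - 1))
    (heq : trInner (svdMat A (headInd a r) B) X = ∑ i ∈ Finset.range r, sing X i) :
    svdMat A (headInd a r) B = svdMat U (headInd a r) V := by
  have h1 := kyFan_gap hU hV hA hB (headInd_nonneg r) (headInd_le_one r) hr hra.le
    (sum_headInd hra.le).le (sing_antitone X) (sing_nonneg X)
  rw [← hX, heq] at h1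
  have h5 := frobNorm_sq_sub (svdMat A (headInd a r) B) (svdMat U (headInd a r) V)
  rw [trInner_svdMat_headInd_self hA hB hra.le, trInner_svdMat_headInd_self hU hV hra.le] at h5
  have h6 : (r : ℝ) - trInner (svdMat A (headInd a r) B) (svdMat U (headInd a r) V) ≤ 0 := by
    by_contra hcon
    push Not at hcon
    nlinarith [mul_pos (sub_pos.2 hgap) hcon]
  have h7 : frobNorm (svdMat A (headInd a r) B - svdMat U (headInd a r) V) = 0 := by
    have := sq_nonneg (frobNorm (svdMat A (headInd a r) B - svdMat U (headInd a r) V))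
    exact pow_eq_zero_iff two_ne_zero |>.1 (by linarith)
  exact sub_eq_zero.1 (frobNorm_eq_zero.1 h7)

theorem two_mul_div_le_neg_log {u : ℝ} (h0 : 0 ≤ u) (h1 : u < 1) :
    2 * u / (2 - u) ≤ -Real.log (1 - u) := by
  have h := Real.le_log_one_add_of_nonneg (x := u / (1 - u)) (div_nonneg h0 (by linarith))
  have e1 : 1 + u / (1 - u) = (1 - u)⁻¹ := by
    field_simp [(by linarith : (1 - u) ≠ 0)]
    ring
  have hu : (1 - u) ≠ 0 := by linarith
  have hu2 : (2 - u) ≠ 0 := by linarith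
  have e2 : 2 * (u / (1 - u)) / (u / (1 - u) + 2) = 2 * u / (2 - u) := by
    have : u / (1 - u) + 2 = (2 - u) / (1 - u) := by field_simp; ring
    rw [this]
    field_simp
  rwa [e1, Real.log_inv, e2] at h

/-- The direct perturbation bound `x / (σ - x/√2)` is sharper than `β̃`. -/
theorem div_le_betaStep {σ x : ℝ} (hx : 0 ≤ x) (hxσ : √2 * x < σ) :
    2 * x / (2 * σ - √2 * x) ≤ betaStep σ x := by
  have h2 : 0 < √2 := by positivity
  have hs : √2 * √2 = 2 := Real.mul_self_sqrt (by norm_num)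
  have hσ : 0 < σ := (mul_nonneg h2.le hx).trans_lt hxσ
  have h := two_mul_div_le_neg_log (u := √2 * x / σ) (by positivity) ((div_lt_one hσ).2 hxσ)
  have hne : 2 * σ - √2 * x ≠ 0 := by linarith
  have e : 2 * x / (2 * σ - √2 * x) = 1 / √2 * (2 * (√2 * x / σ) / (2 - √2 * x / σ)) := by
    have : 2 - √2 * x / σ = (2 * σ - √2 * x) / σ := by field_simp
    rw [this]
    field_simp
  rw [e, betaStep, neg_mul, ← mul_neg]
  exact mul_le_mul_of_nonneg_left h (by positivity)

/-- The singular values of a matrix near the rank `r` matrix `Y` separate after the `r`-th one. -/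
theorem sing_near (hab : a ≤ b) (h : IsLeadingSVD Y U₁ V₁) (hr : 1 ≤ r) (hra : r < a)
    {X : Matrix (Fin a) (Fin b) ℝ} {x : ℝ} (hx : frobNorm (X - Y) ≤ x) :
    sing Y (r - 1) - x ≤ sing X (r - 1) ∧ sing X r ≤ x ∧
      sing Y (r - 1) - sing X (r - 1) + sing X r ≤ √2 * x := by
  have h1 := sing_perturbation hab X Y h.orth_left h.orth_right hr hra h.eq_svdMat
  have h0 := frobNorm_nonneg (X - Y)
  have h2 : frobNorm (X - Y) ^ 2 ≤ x ^ 2 := by gcongr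
  have hx0 := h0.trans hx
  have hs : √2 ^ 2 = 2 := Real.sq_sqrt (by norm_num)
  refine ⟨?_, ?_, ?_⟩
  · have := abs_le_of_sq_le_sq (a := sing Y (r - 1) - sing X (r - 1)) (b := x)
      (by nlinarith [sq_nonneg (sing X r)]) hx0
    linarith [(abs_le.1 this).2, le_abs_self (sing Y (r - 1) - sing X (r - 1))]
  · exact le_of_sq_le_sq (by nlinarith [sq_nonneg (sing Y (r - 1) - sing X (r - 1))]) hx0
  · refine le_of_sq_le_sq ?_ (by positivity)
    rw [mul_pow, hs]
    nlinarith [sq_nonneg (sing Y (r - 1) - sing X (r - 1) - sing X r)]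

theorem frobNorm_leading_sub_le_betaStep (hab : a ≤ b) (h : IsLeadingSVD Y U₁ V₁) (hr : 1 ≤ r)
    (hra : r < a) {X : Matrix (Fin a) (Fin b) ℝ} {U : Matrix (Fin a) (Fin a) ℝ}
    {V : Matrix (Fin b) (Fin a) ℝ} (hU : Uᵀ * U = 1) (hV : Vᵀ * V = 1)
    (hX : X = svdMat U (fun i => sing X i) V) {x : ℝ} (hx : frobNorm (X - Y) ≤ x)
    (hxσ : √2 * x < sing Y (r - 1)) :
    frobNorm (U₁ * V₁ᵀ - svdMat U (headInd a r) V) ≤ betaStep (sing Y (r - 1)) x := by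
  have h1 := frobNorm_leading_sub_le h hr hra hU hV hX
  obtain ⟨-, -, h2⟩ := sing_near hab h hr hra hx
  have hx0 := (frobNorm_nonneg (X - Y)).trans hx
  refine le_trans ?_ (div_le_betaStep hx0 hxσ)
  have h3 : 0 ≤ √2 * x := by positivity
  rw [le_div_iff₀ (by linarith)]
  have h4 := frobNorm_nonneg (U₁ * V₁ᵀ - svdMat U (headInd a r) V)
  nlinarith

end Leading

/-! ### The conjugate function -/

section Conjugate

variable {φ : ℝ → EReal}

theorem MemPhi.coe_toReal (hφ : MemPhi φ) {t : ℝ} (ht : t ∈ Set.Icc (0 : ℝ) 1) :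
    (((φ t).toReal : ℝ) : EReal) = φ t :=
  EReal.coe_toReal (interior_subset (hφ.subset_interior_dom ht)) (hφ.ne_bot t)

/-- `t` maximizes `y t - ψ(t)`, that is, `t` is a subgradient of `ψ*` at `y`. -/
def IsConjMax (φ : ℝ → EReal) (y t : ℝ) : Prop :=
  t ∈ Set.Icc (0 : ℝ) 1 ∧
    ∀ t' ∈ Set.Icc (0 : ℝ) 1, y * t' - (φ t').toReal ≤ y * t - (φ t).toReal

theorem MemPhi.exists_isConjMax (hφ : MemPhi φ) (y : ℝ) : ∃ t, IsConjMax φ y t := by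
  -- `φ` is finite on `[0, 1]`, so its real part inherits lower semicontinuity there
  have h1 : LowerSemicontinuousOn (fun t => (φ t).toReal) (Set.Icc (0 : ℝ) 1) := by
    intro t ht c hc
    have h2 : (c : EReal) < φ t := by
      rw [← hφ.coe_toReal ht]
      exact_mod_cast hc
    have h3 := hφ.closed.lowerSemicontinuousOn (Set.Icc (0 : ℝ) 1) t ht _ h2
    filter_upwards [h3, self_mem_nhdsWithin] with t' h4 h5
    rw [← hφ.coe_toReal h5] at h4
    exact_mod_cast h4
  have h2 : LowerSemicontinuousOn (fun t : ℝ => -(y * t)) (Set.Icc (0 : ℝ) 1) :=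
    (by fun_prop : Continuous fun t : ℝ => -(y * t)).continuousOn.lowerSemicontinuousOn
  obtain ⟨t, ht, hmin⟩ := LowerSemicontinuousOn.exists_isMinOn
    (Set.nonempty_Icc.2 zero_le_one) isCompact_Icc (h1.add h2)
  refine ⟨t, ht, fun t' ht' => ?_⟩
  have := hmin ht'
  simp only [Set.mem_ofPred_eq] at this
  linarith

theorem IsConjMax.mono {y y' t t' : ℝ} (h : IsConjMax φ y t) (h' : IsConjMax φ y' t')
    (hy : y < y') : t ≤ t' := by
  have h1 := h.2 t' h'.1
  have h2 := h'.2 t h.1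
  by_contra hcon
  nlinarith [mul_pos (sub_pos.2 hy) (sub_pos.2 (not_le.1 hcon))]

theorem MemPhi.psiConj_eq (hφ : MemPhi φ) {y t : ℝ} (h : IsConjMax φ y t) :
    psiConj φ y = ((y * t - (φ t).toReal : ℝ) : EReal) := by
  have hval : ∀ t' ∈ Set.Icc (0 : ℝ) 1,
      ((y * t' : ℝ) : EReal) - psi φ t' = ((y * t' - (φ t').toReal : ℝ) : EReal) := by
    intro t' ht'
    rw [psi, if_pos ht', ← hφ.coe_toReal ht', EReal.toReal_coe, EReal.coe_sub]
  refine le_antisymm (iSup_le fun t' => ?_) ?_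
  · by_cases ht' : t' ∈ Set.Icc (0 : ℝ) 1
    · rw [hval t' ht']
      exact_mod_cast h.2 t' ht'
    · rw [psi, if_neg ht', EReal.sub_top]
      exact bot_le
  · rw [← hval t h.1]
    exact le_iSup (fun t' : ℝ => ((y * t' : ℝ) : EReal) - psi φ t') t

theorem MemPhi.toReal_psiConj_eq (hφ : MemPhi φ) {y t : ℝ} (h : IsConjMax φ y t) :
    (psiConj φ y).toReal = y * t - (φ t).toReal := by
  rw [hφ.psiConj_eq h, EReal.toReal_coe]

theorem MemPhi.le_toReal_psiConj (hφ : MemPhi φ) (y : ℝ) {t : ℝ} (ht : t ∈ Set.Icc (0 : ℝ) 1) :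
    y * t - (φ t).toReal ≤ (psiConj φ y).toReal := by
  obtain ⟨u, hu⟩ := hφ.exists_isConjMax y
  rw [hφ.toReal_psiConj_eq hu]
  exact hu.2 t ht

theorem MemPhi.convexOn_psiConj (hφ : MemPhi φ) :
    ConvexOn ℝ Set.univ fun y => (psiConj φ y).toReal := by
  refine ⟨convex_univ, fun y _ z _ p q hp hq hpq => ?_⟩
  obtain ⟨t, ht⟩ := hφ.exists_isConjMax (p • y + q • z)
  simp only [smul_eq_mul] at ht ⊢
  rw [hφ.toReal_psiConj_eq ht]
  have h1 := mul_le_mul_of_nonneg_left (hφ.le_toReal_psiConj y ht.1) hp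
  have h2 := mul_le_mul_of_nonneg_left (hφ.le_toReal_psiConj z ht.1) hq
  have h3 : (φ t).toReal = p * (φ t).toReal + q * (φ t).toReal := by rw [← add_mul, hpq, one_mul]
  rw [h3]
  linarith

theorem MemPhi.psiConjRight_mono (hφ : MemPhi φ) : Monotone (psiConjRight φ) := fun x y hxy =>
  hφ.convexOn_psiConj.monotoneOn_rightDeriv (by simp) (by simp) hxy

theorem MemPhi.psiConjLeft_mono (hφ : MemPhi φ) : Monotone (psiConjLeft φ) := fun x y hxy =>
  hφ.convexOn_psiConj.monotoneOn_leftDeriv (by simp) (by simp) hxy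

theorem MemPhi.slope_bound (hφ : MemPhi φ) {y t : ℝ} (h : IsConjMax φ y t) (z : ℝ) :
    t * (z - y) ≤ (psiConj φ z).toReal - (psiConj φ y).toReal := by
  rw [hφ.toReal_psiConj_eq h]
  linarith [hφ.le_toReal_psiConj z h.1]

theorem MemPhi.le_psiConjRight (hφ : MemPhi φ) {y t : ℝ} (h : IsConjMax φ y t) :
    t ≤ psiConjRight φ y := by
  rw [psiConjRight, hφ.convexOn_psiConj.rightDeriv_eq_sInf_slope_of_mem_interior (by simp)]
  refine le_csInf ⟨_, y + 1, ⟨Set.mem_univ _, by linarith⟩, rfl⟩ ?_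
  rintro _ ⟨z, ⟨-, hz⟩, rfl⟩
  rw [slope_def_field, le_div_iff₀ (sub_pos.2 hz)]
  exact hφ.slope_bound h z

theorem MemPhi.psiConjLeft_le (hφ : MemPhi φ) {y t : ℝ} (h : IsConjMax φ y t) :
    psiConjLeft φ y ≤ t := by
  rw [psiConjLeft, hφ.convexOn_psiConj.leftDeriv_eq_sSup_slope_of_mem_interior (by simp)]
  refine csSup_le ⟨_, y - 1, ⟨Set.mem_univ _, by linarith⟩, rfl⟩ ?_
  rintro _ ⟨z, ⟨-, hz⟩, rfl⟩
  rw [slope_def_field, div_le_iff_of_neg (sub_neg.2 hz)]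
  exact hφ.slope_bound h z

theorem MemPhi.psiConjRight_nonneg (hφ : MemPhi φ) (y : ℝ) : 0 ≤ psiConjRight φ y := by
  obtain ⟨t, ht⟩ := hφ.exists_isConjMax y
  exact ht.1.1.trans (hφ.le_psiConjRight ht)

theorem MemPhi.psiConjLeft_le_one (hφ : MemPhi φ) (y : ℝ) : psiConjLeft φ y ≤ 1 := by
  obtain ⟨t, ht⟩ := hφ.exists_isConjMax y
  exact (hφ.psiConjLeft_le ht).trans ht.1.2

end Conjugate

/-! ### Optimality in the weight step -/

theorem coe_finset_sum_ereal {ι : Type*} (s : Finset ι) (f : ι → ℝ) :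
    ((∑ i ∈ s, f i : ℝ) : EReal) = ∑ i ∈ s, (f i : EReal) := by
  classical
  induction s using Finset.induction_on with
  | empty => simp
  | insert i s hi ih => rw [Finset.sum_insert hi, Finset.sum_insert hi, EReal.coe_add, ih]

/-- Optimality conditions for the weight step: the singular values of `W` are subgradients of `ψ*`
at those of `ρ X`, and `W`, `X` satisfy von Neumann's inequality with equality. -/
theorem SolvesW.optimality {a b : ℕ} (hab : a ≤ b) {φ : ℝ → EReal} (hφ : MemPhi φ) {ρ : ℝ}
    (hρ : 0 < ρ) {X W : Matrix (Fin a) (Fin b) ℝ} (h : SolvesW φ ρ X W) :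
    (∀ i : Fin a, IsConjMax φ (ρ * sing X i) (sing W i)) ∧
      trInner W X = ∑ i ∈ Finset.range a, sing W i * sing X i := by
  obtain ⟨hW1, hmin⟩ := h
  obtain ⟨U, V, hU, hV, hX⟩ := exists_svd hab X
  obtain ⟨A, B, hA, hB, hW⟩ := exists_svd hab W
  choose τ hτ using hφ.exists_isConjMax
  have hτm : Monotone τ := by
    intro y y' hy
    rcases hy.eq_or_lt with rfl | hy
    · exact le_rfl
    · exact (hτ y).mono (hτ y') hy
  -- the competitor shares the singular vectors of `X`; its singular values are maximizers
  set t : ℕ → ℝ := fun i => τ (ρ * sing X i) with ht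
  have htanti : Antitone t := fun i j hij =>
    hτm (mul_le_mul_of_nonneg_left (sing_antitone X hij) hρ.le)
  have ht01 : ∀ i, t i ∈ Set.Icc (0 : ℝ) 1 := fun i => (hτ _).1
  set Z := svdMat U (fun i => t i) V with hZ
  have hZ1 : specNorm Z ≤ 1 := specNorm_svdMat_le hU hV zero_le_one fun i => by
    rw [abs_of_nonneg (ht01 i).1]; exact (ht01 i).2
  have hZX : trInner Z X = ∑ i : Fin a, t i * sing X i := by
    conv_lhs => rw [hX]
    rw [hZ, trInner_svdMat_svdMat hU hV]
  have hw01 : ∀ i : Fin a, sing W i ∈ Set.Icc (0 : ℝ) 1 := fun i =>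
    ⟨sing_nonneg W i, (sing_le_specNorm hab W i).trans hW1⟩
  have hle := hmin (show Z ∈ {Z | specNorm Z ≤ 1} from hZ1)
  have hcoe : ∀ (w : Fin a → ℝ), (∀ i, w i ∈ Set.Icc (0 : ℝ) 1) →
      ∑ i, φ (w i) = ((∑ i, (φ (w i)).toReal : ℝ) : EReal) := by
    intro w hw
    rw [coe_finset_sum_ereal]
    exact Finset.sum_congr rfl fun i _ => (hφ.coe_toReal (hw i)).symm
  have hsingZ : ∀ i : Fin a, sing Z i = t i :=
    sing_svdMat hab hU hV htanti fun i => (ht01 i).1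
  simp only [Set.mem_ofPred_eq, hsingZ] at hle
  rw [hcoe _ hw01, hcoe (fun i => t i) (fun i => ht01 i), ← EReal.coe_sub, ← EReal.coe_sub,
    EReal.coe_le_coe_iff, hZX] at hle
  have hvN := vonNeumann hU hV hA hB le_rfl (sing_antitone X) (sing_nonneg X) (sing_antitone W)
    (sing_nonneg W)
  rw [← hX, ← hW, ← Fin.sum_univ_eq_sum_range (fun i => sing W i * sing X i)] at hvN
  have hterm : ∀ i ∈ (Finset.univ : Finset (Fin a)),
      ρ * sing X i * sing W i - (φ (sing W i)).toReal ≤ ρ * sing X i * t i - (φ (t i)).toReal :=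
    fun i _ => (hτ _).2 _ (hw01 i)
  have e1 : ∀ w : ℕ → ℝ, ∑ i : Fin a, (ρ * sing X i * w i - (φ (w i)).toReal) =
      ρ * ∑ i : Fin a, w i * sing X i - ∑ i : Fin a, (φ (w i)).toReal := by
    intro w
    rw [Finset.sum_sub_distrib, Finset.mul_sum]
    congr 1
    exact Finset.sum_congr rfl fun _ _ => by ring
  have hsum := Finset.sum_le_sum hterm
  rw [e1 (sing W), e1 t] at hsum
  have hvN' := mul_le_mul_of_nonneg_left hvN hρ.le
  refine ⟨fun i => ⟨hw01 i, fun t' ht' => ?_⟩, ?_⟩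
  · have heq := (Finset.sum_eq_sum_iff_of_le hterm).1
      (by rw [e1 (sing W), e1 t]; linarith) i (Finset.mem_univ i)
    rw [heq]
    exact (hτ _).2 t' ht'
  · rw [← Fin.sum_univ_eq_sum_range (fun i => sing W i * sing X i)]
    exact mul_left_cancel₀ hρ.ne' (by linarith)

/-! ### The tangent space projections and the bound for the weights -/

section Tangent

variable {a b r : ℕ} {U₁ : Matrix (Fin a) (Fin r) ℝ} {V₁ : Matrix (Fin b) (Fin r) ℝ}

theorem projT_add (U₁ : Matrix (Fin a) (Fin r) ℝ) (V₁ : Matrix (Fin b) (Fin r) ℝ)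
    (Y Z : Matrix (Fin a) (Fin b) ℝ) : projT U₁ V₁ (Y + Z) = projT U₁ V₁ Y + projT U₁ V₁ Z := by
  simp only [projT, Matrix.mul_add, Matrix.add_mul]
  abel

theorem projT_sub (U₁ : Matrix (Fin a) (Fin r) ℝ) (V₁ : Matrix (Fin b) (Fin r) ℝ)
    (Y Z : Matrix (Fin a) (Fin b) ℝ) : projT U₁ V₁ (Y - Z) = projT U₁ V₁ Y - projT U₁ V₁ Z := by
  simp only [projT, Matrix.mul_sub, Matrix.sub_mul]
  abel

theorem projTperp_eq_mul (U₁ : Matrix (Fin a) (Fin r) ℝ) (V₁ : Matrix (Fin b) (Fin r) ℝ)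
    (Z : Matrix (Fin a) (Fin b) ℝ) :
    projTperp U₁ V₁ Z = (1 - U₁ * U₁ᵀ) * Z * (1 - V₁ * V₁ᵀ) := by
  simp only [projTperp, projT, Matrix.mul_sub, Matrix.sub_mul, Matrix.one_mul, Matrix.mul_one]
  abel

theorem projT_projT (hU : U₁ᵀ * U₁ = 1) (hV : V₁ᵀ * V₁ = 1) (Z : Matrix (Fin a) (Fin b) ℝ) :
    projT U₁ V₁ (projT U₁ V₁ Z) = projT U₁ V₁ Z := projT_of_mem (projT_mem hU hV Z)

theorem frobNorm_projT_le (hU : U₁ᵀ * U₁ = 1) (hV : V₁ᵀ * V₁ = 1) (Z : Matrix (Fin a) (Fin b) ℝ) :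
    frobNorm (projT U₁ V₁ Z) ≤ frobNorm Z := by
  have h : frobNorm (projT U₁ V₁ Z) ^ 2 ≤ frobNorm (projT U₁ V₁ Z) * frobNorm Z := by
    rw [frobNorm_sq, trInner_projT_left, projT_projT hU hV, trInner_comm]
    exact trInner_le_frobNorm_mul _ _
  rcases (frobNorm_nonneg (projT U₁ V₁ Z)).eq_or_lt with h0 | h0
  · rw [← h0]; exact frobNorm_nonneg Z
  · exact le_of_mul_le_mul_left (by rwa [sq] at h) h0

theorem projT_mul_transpose (hU : U₁ᵀ * U₁ = 1) : projT U₁ V₁ (U₁ * V₁ᵀ) = U₁ * V₁ᵀ := by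
  have : U₁ * U₁ᵀ * (U₁ * V₁ᵀ) = U₁ * V₁ᵀ := by
    rw [Matrix.mul_assoc, ← Matrix.mul_assoc U₁ᵀ, hU, Matrix.one_mul]
  rw [projT, this]
  abel

/-- `P_𝒯(Z)` splits orthogonally into `U₁U₁ᵀ Z` and `(1 - U₁U₁ᵀ) Z V₁V₁ᵀ`. -/
theorem frobNorm_sq_projT_le (hU : U₁ᵀ * U₁ = 1) (hV : V₁ᵀ * V₁ = 1)
    (Z : Matrix (Fin a) (Fin b) ℝ) :
    frobNorm (projT U₁ V₁ Z) ^ 2 ≤ frobNorm (U₁ᵀ * Z) ^ 2 + frobNorm (Z * V₁) ^ 2 := by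
  have hUU : U₁ᵀ * (U₁ * U₁ᵀ) = U₁ᵀ := by rw [← Matrix.mul_assoc, hU, Matrix.one_mul]
  have hPP : U₁ * U₁ᵀ * (U₁ * U₁ᵀ) = U₁ * U₁ᵀ := by rw [Matrix.mul_assoc, hUU]
  have h1 := frobNorm_sq_projector_add hU (projT U₁ V₁ Z)
  have e1 : U₁ᵀ * projT U₁ V₁ Z = U₁ᵀ * Z := by
    simp only [projT, Matrix.mul_sub, Matrix.mul_add, ← Matrix.mul_assoc]
    simp only [Matrix.mul_assoc U₁ᵀ U₁ U₁ᵀ, hUU]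
    abel
  have e2 : projT U₁ V₁ Z - U₁ * U₁ᵀ * projT U₁ V₁ Z =
      Z * V₁ * V₁ᵀ - U₁ * U₁ᵀ * (Z * V₁ * V₁ᵀ) := by
    rw [Matrix.mul_assoc U₁ U₁ᵀ (projT U₁ V₁ Z), e1]
    simp only [projT, Matrix.mul_assoc]
    abel
  have h2 := frobNorm_sq_projector_add hU (Z * V₁ * V₁ᵀ)
  rw [frobNorm_mul_transpose_of_orth hV (Z * V₁)] at h2
  rw [e1, e2] at h1
  nlinarith [sq_nonneg (frobNorm (U₁ᵀ * (Z * V₁ * V₁ᵀ)))]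

theorem frobNorm_mul_diagonal_le {c : ℕ} (M : Matrix (Fin a) (Fin c) ℝ) {d : Fin c → ℝ} {t : ℝ}
    (ht : 0 ≤ t) (hd : ∀ i, |d i| ≤ t) : frobNorm (M * diagonal d) ≤ t * frobNorm M := by
  refine le_of_sq_le_sq ?_ (mul_nonneg ht (frobNorm_nonneg M))
  rw [mul_pow, frobNorm_sq_eq_sum, frobNorm_sq_eq_sum, Finset.mul_sum]
  refine Finset.sum_le_sum fun i _ => ?_
  rw [Finset.mul_sum]
  refine Finset.sum_le_sum fun j _ => ?_
  rw [Matrix.mul_diagonal, mul_pow, mul_comm]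
  exact mul_le_mul_of_nonneg_right (sq_le_sq' (by linarith [(abs_le.1 (hd j)).1])
    (abs_le.1 (hd j)).2) (sq_nonneg _)

/-- The part of the leading left factor outside the range of `U₁` is controlled by the distance of
the leading factors. -/
theorem frobNorm_compl_mul_head_le {c : ℕ} {U : Matrix (Fin a) (Fin c) ℝ}
    {V : Matrix (Fin b) (Fin c) ℝ} (hU₁ : U₁ᵀ * U₁ = 1) (hV : Vᵀ * V = 1) {k : ℕ} {β : ℝ}
    (h : frobNorm (U₁ * V₁ᵀ - svdMat U (headInd c k) V) ≤ β) :
    frobNorm ((1 - U₁ * U₁ᵀ) * (U * diagonal (headInd c k))) ≤ β := by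
  refine le_trans ?_ h
  rw [frobNorm_sub_comm, ← frobNorm_mul_transpose_of_orth hV]
  set D := svdMat U (headInd c k) V - U₁ * V₁ᵀ with hD
  have hP : U₁ * U₁ᵀ * (U₁ * V₁ᵀ) = U₁ * V₁ᵀ := by
    rw [Matrix.mul_assoc, ← Matrix.mul_assoc U₁ᵀ, hU₁, Matrix.one_mul]
  have e : (1 - U₁ * U₁ᵀ) * (U * diagonal (headInd c k)) * Vᵀ = D - U₁ * U₁ᵀ * D := by
    rw [hD, Matrix.mul_sub, hP, svdMat, Matrix.sub_mul, Matrix.sub_mul, Matrix.one_mul,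
      Matrix.mul_assoc (U₁ * U₁ᵀ)]
    abel
  rw [e]
  refine le_of_sq_le_sq ?_ (frobNorm_nonneg D)
  nlinarith [frobNorm_sq_projector_add hU₁ D, sq_nonneg (frobNorm (U₁ᵀ * D))]

/-- The trailing singular vectors overlap with the range of `U₁` no more than the leading ones
leave it. -/
theorem frobNorm_transpose_mul_tail_le {c : ℕ} {U : Matrix (Fin a) (Fin c) ℝ} (hU₁ : U₁ᵀ * U₁ = 1)
    (hU : Uᵀ * U = 1) (hrc : r ≤ c) {β t : ℝ}
    (h : frobNorm ((1 - U₁ * U₁ᵀ) * (U * diagonal (headInd c r))) ≤ β) {d : Fin c → ℝ}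
    (ht : 0 ≤ t) (hd : ∀ i, |d i| ≤ t) (hd0 : ∀ i : Fin c, (i : ℕ) < r → d i = 0) :
    frobNorm (U₁ᵀ * (U * diagonal d)) ≤ t * β := by
  set M := U₁ᵀ * U with hM
  set T := M * diagonal (fun i => 1 - headInd c r i) with hT
  have e1 : U₁ᵀ * (U * diagonal d) = T * diagonal d := by
    rw [hT, Matrix.mul_assoc M, diagonal_mul_diagonal, hM, Matrix.mul_assoc]
    congr 3
    funext i
    unfold headInd
    split_ifs with hi
    · rw [hd0 i hi, mul_zero]
    · ring
  have h1 := frobNorm_sq_projector_add hU₁ (U * diagonal (headInd c r))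
  rw [frobNorm_mul_of_orth hU] at h1
  have e2 : frobNorm (diagonal (headInd c r)) ^ 2 = r := by
    rw [frobNorm_sq_eq_sum, ← sum_headInd hrc]
    refine Finset.sum_congr rfl fun i _ => ?_
    rw [Finset.sum_eq_single i]
    · rw [diagonal_apply_eq]; unfold headInd; split_ifs <;> norm_num
    · intro j _ hj; rw [diagonal_apply_ne _ hj.symm]; norm_num
    · simp
  have e3 : U * diagonal (headInd c r) - U₁ * U₁ᵀ * (U * diagonal (headInd c r)) =
      (1 - U₁ * U₁ᵀ) * (U * diagonal (headInd c r)) := by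
    rw [Matrix.sub_mul, Matrix.one_mul]
  rw [e2, e3, ← Matrix.mul_assoc, ← hM] at h1
  have h2 : frobNorm M ^ 2 ≤ r := by
    rw [hM, ← frobNorm_transpose, transpose_mul, transpose_transpose, ← frobNorm_sq_of_orth hU₁]
    exact frobNorm_transpose_mul_le hU U₁
  have h3 : frobNorm M ^ 2 = frobNorm (M * diagonal (headInd c r)) ^ 2 + frobNorm T ^ 2 := by
    rw [hT, frobNorm_sq_eq_sum, frobNorm_sq_eq_sum, frobNorm_sq_eq_sum, ← Finset.sum_add_distrib]
    refine Finset.sum_congr rfl fun i _ => ?_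
    rw [← Finset.sum_add_distrib]
    refine Finset.sum_congr rfl fun j _ => ?_
    rw [Matrix.mul_diagonal, Matrix.mul_diagonal]
    unfold headInd
    split_ifs <;> ring
  have h4 : frobNorm T ≤ β := by
    refine le_trans ?_ h
    refine le_of_sq_le_sq ?_ (frobNorm_nonneg _)
    linarith
  rw [e1]
  exact (frobNorm_mul_diagonal_le T ht hd).trans (mul_le_mul_of_nonneg_left h4 ht)

theorem svdMat_transpose {c : ℕ} (U : Matrix (Fin a) (Fin c) ℝ) (d : Fin c → ℝ)
    (V : Matrix (Fin b) (Fin c) ℝ) : (svdMat U d V)ᵀ = svdMat V d U := by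
  rw [svdMat, transpose_mul, transpose_mul, transpose_transpose, diagonal_transpose, svdMat,
    Matrix.mul_assoc]

section Weight

variable {U : Matrix (Fin a) (Fin a) ℝ} {V : Matrix (Fin b) (Fin a) ℝ} {w : Fin a → ℝ}
  {α κ β : ℝ}

/-- A weight whose first `r` singular values are at least `α` and whose others are at most `α` has a
`𝒯^⊥` part of spectral norm at most `α + (1 - α) β²`. -/
theorem specNorm_projTperp_svdMat_le (hU₁ : U₁ᵀ * U₁ = 1) (hV₁ : V₁ᵀ * V₁ = 1) (hU : Uᵀ * U = 1)
    (hV : Vᵀ * V = 1) (hβ : frobNorm (U₁ * V₁ᵀ - svdMat U (headInd a r) V) ≤ β)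
    (hα0 : 0 ≤ α) (hα1 : α ≤ 1) (hw : ∀ i, w i ∈ Set.Icc (0 : ℝ) 1)
    (hhead : ∀ i : Fin a, (i : ℕ) < r → α ≤ w i) (htail : ∀ i : Fin a, r ≤ (i : ℕ) → w i ≤ α) :
    1 - specNorm (projTperp U₁ V₁ (svdMat U w V)) ≥ (1 - α) * (1 - β ^ 2) := by
  have hβ' : frobNorm (V₁ * U₁ᵀ - svdMat V (headInd a r) U) ≤ β := by
    rwa [← frobNorm_transpose, transpose_sub, svdMat_transpose, transpose_mul,
      transpose_transpose]
  have hβ0 := (frobNorm_nonneg _).trans hβ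
  -- lower the leading singular values to `α`; the rest has rank `r` and small `𝒯^⊥` part
  set d : Fin a → ℝ := fun i => if (i : ℕ) < r then w i - α else 0 with hd
  have hd1 : ∀ i, |d i| ≤ 1 - α := by
    intro i
    simp only [hd]
    split_ifs with hi
    · rw [abs_of_nonneg (by linarith [hhead i hi])]; linarith [(hw i).2]
    · rw [abs_zero]; linarith
  have hsplit : svdMat U w V = svdMat U (fun i => w i - d i) V + svdMat U d V := by
    rw [← svdMat_add]
    simp
  have h1 : specNorm (svdMat U (fun i => w i - d i) V) ≤ α := by
    refine specNorm_svdMat_le hU hV hα0 fun i => ?_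
    simp only [hd]
    split_ifs with hi
    · rw [abs_of_nonneg (by linarith)]; linarith
    · rw [sub_zero, abs_of_nonneg (hw i).1]; exact htail i (not_lt.1 hi)
  have hU' := specNorm_projector_compl_le hU₁
  have hV' := specNorm_projector_compl_le hV₁
  have h2 : specNorm (projTperp U₁ V₁ (svdMat U (fun i => w i - d i) V)) ≤ α := by
    rw [projTperp_eq_mul]
    calc _ ≤ _ := specNorm_mul_le _ _
      _ ≤ specNorm ((1 - U₁ * U₁ᵀ) * svdMat U (fun i => w i - d i) V) :=
        mul_le_of_le_one_right (specNorm_nonneg _) hV'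
      _ ≤ _ := specNorm_mul_le _ _
      _ ≤ specNorm (svdMat U (fun i => w i - d i) V) :=
        mul_le_of_le_one_left (specNorm_nonneg _) hU'
      _ ≤ α := h1
  have h3 : specNorm (projTperp U₁ V₁ (svdMat U d V)) ≤ (1 - α) * β ^ 2 := by
    have hdd : diagonal d = diagonal (headInd a r) * diagonal d * (diagonal (headInd a r))ᵀ := by
      rw [diagonal_transpose, diagonal_mul_diagonal, diagonal_mul_diagonal]
      congr 1
      funext i
      simp only [hd, headInd]
      split_ifs <;> ring
    have e : projTperp U₁ V₁ (svdMat U d V) = ((1 - U₁ * U₁ᵀ) * (U * diagonal (headInd a r))) *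
        diagonal d * ((1 - V₁ * V₁ᵀ) * (V * diagonal (headInd a r)))ᵀ := by
      have hs : (1 - V₁ * V₁ᵀ)ᵀ = 1 - V₁ * V₁ᵀ := by simp
      rw [projTperp_eq_mul, svdMat, transpose_mul, transpose_mul, hs]
      conv_lhs => rw [hdd]
      simp only [Matrix.mul_assoc]
    have hα : 0 ≤ 1 - α := by linarith
    rw [e]
    refine (specNorm_le_frobNorm _).trans ((frobNorm_mul_le _ _).trans ?_)
    rw [frobNorm_transpose, show (1 - α) * β ^ 2 = (1 - α) * β * β by ring]
    refine mul_le_mul ((frobNorm_mul_diagonal_le _ hα hd1).trans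
      (mul_le_mul_of_nonneg_left (frobNorm_compl_mul_head_le hU₁ hV hβ) hα))
      (frobNorm_compl_mul_head_le hV₁ hU hβ') (frobNorm_nonneg _) (mul_nonneg hα hβ0)
  have h4 : projTperp U₁ V₁ (svdMat U w V) =
      projTperp U₁ V₁ (svdMat U (fun i => w i - d i) V) + projTperp U₁ V₁ (svdMat U d V) := by
    conv_lhs => rw [hsplit]
    rw [projTperp_eq_mul, projTperp_eq_mul, projTperp_eq_mul, Matrix.mul_add, Matrix.add_mul]
  have h5 := specNorm_add_le (projTperp U₁ V₁ (svdMat U (fun i => w i - d i) V))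
    (projTperp U₁ V₁ (svdMat U d V))
  rw [← h4] at h5
  linarith

/-- The tangential distance of a weight to `U₁V₁ᵀ`: the leading singular values contribute
`√r (1 - κ)`, the rotation of the leading factor `β`, and the trailing singular values
`√2 α β`. -/
theorem frobNorm_projT_svdMat_sub_le (hra : r ≤ a) (hU₁ : U₁ᵀ * U₁ = 1) (hV₁ : V₁ᵀ * V₁ = 1)
    (hU : Uᵀ * U = 1) (hV : Vᵀ * V = 1)
    (hβ : frobNorm (U₁ * V₁ᵀ - svdMat U (headInd a r) V) ≤ β) (hα0 : 0 ≤ α) (hκ : κ ≤ 1)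
    (hw : ∀ i, w i ∈ Set.Icc (0 : ℝ) 1) (hhead : ∀ i : Fin a, (i : ℕ) < r → κ ≤ w i)
    (htail : ∀ i : Fin a, r ≤ (i : ℕ) → w i ≤ α) :
    frobNorm (projT U₁ V₁ (svdMat U w V - U₁ * V₁ᵀ)) ≤ √r * (1 - κ) + (√2 * α + 1) * β := by
  have hβ' : frobNorm (V₁ * U₁ᵀ - svdMat V (headInd a r) U) ≤ β := by
    rwa [← frobNorm_transpose, transpose_sub, svdMat_transpose, transpose_mul,
      transpose_transpose]
  have hβ0 := (frobNorm_nonneg _).trans hβ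
  set d : Fin a → ℝ := fun i => if (i : ℕ) < r then 0 else w i with hd
  set e : Fin a → ℝ := fun i => if (i : ℕ) < r then w i - 1 else 0 with he
  have hsplit : svdMat U w V - U₁ * V₁ᵀ = svdMat U e V +
      (svdMat U (headInd a r) V - U₁ * V₁ᵀ) + svdMat U d V := by
    have : svdMat U w V = svdMat U e V + svdMat U (headInd a r) V + svdMat U d V := by
      rw [← svdMat_add, ← svdMat_add]
      congr 1
      funext i
      simp only [hd, he, headInd]
      split_ifs <;> ring
    rw [this]
    abel
  have h1 : frobNorm (svdMat U e V) ≤ √r * (1 - κ) := by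
    refine le_of_sq_le_sq ?_ (mul_nonneg (Real.sqrt_nonneg _) (by linarith))
    rw [frobNorm_sq_svdMat hU hV, mul_pow, Real.sq_sqrt (Nat.cast_nonneg r), ← sum_headInd hra,
      Finset.sum_mul]
    refine Finset.sum_le_sum fun i _ => ?_
    simp only [he, headInd]
    split_ifs with hi
    · have := hhead i hi
      have := (hw i).2
      nlinarith
    · norm_num
  have h2 : frobNorm (projT U₁ V₁ (svdMat U d V)) ≤ √2 * α * β := by
    have hd1 : ∀ i, |d i| ≤ α := by
      intro i
      simp only [hd]
      split_ifs with hi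
      · rwa [abs_zero]
      · rw [abs_of_nonneg (hw i).1]; exact htail i (not_lt.1 hi)
    have hd0 : ∀ i : Fin a, (i : ℕ) < r → d i = 0 := fun i hi => if_pos hi
    have hl := frobNorm_transpose_mul_tail_le hU₁ hU hra
      (frobNorm_compl_mul_head_le hU₁ hV hβ) hα0 hd1 hd0
    have hr := frobNorm_transpose_mul_tail_le hV₁ hV hra
      (frobNorm_compl_mul_head_le hV₁ hU hβ') hα0 hd1 hd0
    have e1 : frobNorm (U₁ᵀ * svdMat U d V) = frobNorm (U₁ᵀ * (U * diagonal d)) := by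
      rw [svdMat, ← Matrix.mul_assoc, frobNorm_mul_transpose_of_orth hV]
    have e2 : frobNorm (svdMat U d V * V₁) = frobNorm (V₁ᵀ * (V * diagonal d)) := by
      rw [← frobNorm_transpose, transpose_mul, svdMat_transpose, svdMat, ← Matrix.mul_assoc,
        frobNorm_mul_transpose_of_orth hU]
    have h3 := frobNorm_sq_projT_le hU₁ hV₁ (svdMat U d V)
    rw [e1, e2] at h3
    refine le_of_sq_le_sq ?_ (by positivity)
    have hs : √2 ^ 2 = (2 : ℝ) := Real.sq_sqrt (by norm_num)
    rw [mul_assoc, mul_pow, hs]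
    have hl2 := pow_le_pow_left₀ (frobNorm_nonneg _) hl 2
    have hr2 := pow_le_pow_left₀ (frobNorm_nonneg _) hr 2
    linarith
  rw [hsplit, projT_add, projT_add]
  have h4 := frobNorm_add_le (projT U₁ V₁ (svdMat U e V) +
    projT U₁ V₁ (svdMat U (headInd a r) V - U₁ * V₁ᵀ)) (projT U₁ V₁ (svdMat U d V))
  have h5 := frobNorm_add_le (projT U₁ V₁ (svdMat U e V))
    (projT U₁ V₁ (svdMat U (headInd a r) V - U₁ * V₁ᵀ))
  have h6 := frobNorm_projT_le hU₁ hV₁ (svdMat U e V)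
  have h7 := frobNorm_projT_le hU₁ hV₁ (svdMat U (headInd a r) V - U₁ * V₁ᵀ)
  rw [frobNorm_sub_comm (svdMat U (headInd a r) V)] at h7
  linarith

end Weight

/-- The bound for `γ` after one weight step, at a matrix `X` within distance `x` of the target. -/
theorem gammaOf_le_gammaStep (hab : a ≤ b) {Y : Matrix (Fin a) (Fin b) ℝ}
    (h : IsLeadingSVD Y U₁ V₁) (hr : 1 ≤ r) (hra : r < a) {φ : ℝ → EReal} (hφ : MemPhi φ) {ρ : ℝ}
    (hρ : 0 < ρ) {X W : Matrix (Fin a) (Fin b) ℝ} (hW : SolvesW φ ρ X W) {x σ : ℝ}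
    (hσ : σ = sing Y (r - 1)) (hx : frobNorm (X - Y) ≤ x) (hxσ : 2 * x < σ)
    (hα : aStep φ ρ x < 1) (hακ : aStep φ ρ x < bStep φ σ ρ x) (hβ : betaStep σ x < 1) :
    specNorm (projTperp U₁ V₁ W) < 1 ∧
      gammaOf U₁ V₁ W ≤ gammaStep r (aStep φ ρ x) (bStep φ σ ρ x) (betaStep σ x) := by
  subst hσ
  set σ := sing Y (r - 1) with hσ
  have hx0 := (frobNorm_nonneg (X - Y)).trans hx
  obtain ⟨U, V, hU, hV, hX⟩ := exists_svd hab X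
  obtain ⟨A, B, hA, hB, hWs⟩ := exists_svd hab W
  obtain ⟨hmax, htr⟩ := hW.optimality hab hφ hρ
  obtain ⟨hs1, hs2, -⟩ := sing_near hab h hr hra hx
  have h2 : √2 ≤ 2 := Real.sqrt_le_iff.2 ⟨by norm_num, by norm_num⟩
  have hxσ' : √2 * x < σ := by nlinarith
  have htail : ∀ i : Fin a, r ≤ (i : ℕ) → sing W i ≤ aStep φ ρ x := fun i hi =>
    (hφ.le_psiConjRight (hmax i)).trans (hφ.psiConjRight_mono
      (mul_le_mul_of_nonneg_left ((sing_antitone X hi).trans hs2) hρ.le))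
  have hhead : ∀ i : Fin a, (i : ℕ) < r → bStep φ σ ρ x ≤ sing W i := fun i hi =>
    le_trans (hφ.psiConjLeft_mono (mul_le_mul_of_nonneg_left
      (hs1.trans (sing_antitone X (by omega))) hρ.le)) (hφ.psiConjLeft_le (hmax i))
  have hgapW : sing W r < sing W (r - 1) :=
    ((htail ⟨r, hra⟩ le_rfl).trans_lt hακ).trans_le (hhead ⟨r - 1, by omega⟩ (by simp; omega))
  have hgapX : sing X r < sing X (r - 1) := by linarith
  have hQ : svdMat A (headInd a r) B = svdMat U (headInd a r) V := by
    refine svdMat_headInd_unique hr hra hU hV hX hA hB hgapX ?_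
    have := kyFan_eq_of_vonNeumann_eq hU hV hA hB le_rfl (sing_antitone X) (sing_nonneg X)
      (sing_antitone W) (sing_nonneg W) hr hra hgapW
    rw [← hX, ← hWs] at this
    exact this htr
  have hPQ := frobNorm_leading_sub_le_betaStep hab h hr hra hU hV hX hx hxσ'
  rw [← hQ] at hPQ
  have hw01 : ∀ i : Fin a, sing W i ∈ Set.Icc (0 : ℝ) 1 := fun i => (hmax i).1
  have hα0 : 0 ≤ aStep φ ρ x := hφ.psiConjRight_nonneg _
  have hβ0 := (frobNorm_nonneg _).trans hPQ
  have hden := specNorm_projTperp_svdMat_le h.orth_left h.orth_right hA hB hPQ hα0 hα.le hw01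
    (fun i hi => hακ.le.trans (hhead i hi)) htail
  have hnum := frobNorm_projT_svdMat_sub_le hra.le h.orth_left h.orth_right hA hB hPQ hα0
    (hφ.psiConjLeft_le_one _) hw01 hhead htail
  rw [← hWs] at hden hnum
  have hβ2 : 0 < 1 - betaStep σ x ^ 2 := by nlinarith
  have hpos : 0 < (1 - aStep φ ρ x) * (1 - betaStep σ x ^ 2) := mul_pos (by linarith) hβ2
  have hr0 : (0 : ℝ) < r := by exact_mod_cast hr
  refine ⟨by linarith, ?_⟩
  rw [gammaOf, gammaStep, mul_assoc (√(2 * r))]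
  refine div_le_div₀ ((frobNorm_nonneg _).trans hnum) hnum (mul_pos (by positivity) hpos) ?_
  exact mul_le_mul_of_nonneg_left hden (Real.sqrt_nonneg _)

end Tangent

/-! ### Restricted eigenvalues -/

section Sampling

variable {a b m : ℕ} (A : Fin m → Matrix (Fin a) (Fin b) ℝ)

theorem sampling_add (X Y : Matrix (Fin a) (Fin b) ℝ) :
    sampling A (X + Y) = sampling A X + sampling A Y := by
  ext i; simp [sampling, trInner_add_right]

theorem sampling_sub (X Y : Matrix (Fin a) (Fin b) ℝ) :
    sampling A (X - Y) = sampling A X - sampling A Y := by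
  ext i; simp [sampling, trInner_sub_right]

theorem sampling_smul (t : ℝ) (X : Matrix (Fin a) (Fin b) ℝ) :
    sampling A (t • X) = t • sampling A X := by
  ext i; simp [sampling, trInner_smul_right]

theorem sampling_zero : sampling A 0 = 0 := by
  ext i; simp [sampling]

theorem sampling_sum {ι : Type*} (s : Finset ι) (Y : ι → Matrix (Fin a) (Fin b) ℝ) :
    sampling A (∑ i ∈ s, Y i) = ∑ i ∈ s, sampling A (Y i) := by
  classical
  induction s using Finset.induction_on with
  | empty => simp [sampling_zero]
  | insert i s hi ih => rw [Finset.sum_insert hi, Finset.sum_insert hi, sampling_add, ih]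

theorem trInner_samplingAdj_sampling (X : Matrix (Fin a) (Fin b) ℝ) :
    trInner X (samplingAdj A (sampling A X)) = ‖sampling A X‖ ^ 2 := by
  rw [samplingAdj, trInner_sum_right, EuclideanSpace.norm_sq_eq]
  refine Finset.sum_congr rfl fun i _ => ?_
  rw [trInner_smul_right, trInner_comm X, Real.norm_eq_abs, sq_abs, sq]
  rfl

theorem norm_sq_sampling_le (X : Matrix (Fin a) (Fin b) ℝ) :
    ‖sampling A X‖ ^ 2 ≤ (∑ i, frobNorm (A i) ^ 2) * frobNorm X ^ 2 := by
  rw [EuclideanSpace.norm_sq_eq, Finset.sum_mul]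
  refine Finset.sum_le_sum fun i _ => ?_
  rw [← mul_pow, Real.norm_eq_abs]
  refine pow_le_pow_left₀ (abs_nonneg _) (abs_le.2 ⟨?_, trInner_le_frobNorm_mul _ _⟩) 2
  have h := trInner_le_frobNorm_mul (A i) (-X)
  rw [frobNorm_neg] at h
  have e : trInner (A i) (-X) = -trInner (A i) X := by simp [trInner]
  change _ ≤ trInner (A i) X
  linarith

theorem bddAbove_rayleighSet (k : ℕ) : BddAbove (rayleighSet A k) := by
  refine ⟨∑ i, frobNorm (A i) ^ 2, ?_⟩
  rintro _ ⟨X, -, -, rfl⟩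
  rw [trInner_samplingAdj_sampling]
  exact div_le_of_le_mul₀ (sq_nonneg _) (Finset.sum_nonneg fun _ _ => sq_nonneg _)
    (norm_sq_sampling_le A X)

theorem bddBelow_rayleighSet (k : ℕ) : BddBelow (rayleighSet A k) := by
  refine ⟨0, ?_⟩
  rintro _ ⟨X, -, -, rfl⟩
  rw [trInner_samplingAdj_sampling]
  positivity

theorem rank_pos_of_ne_zero {X : Matrix (Fin a) (Fin b) ℝ} (hX : X ≠ 0) : 0 < X.rank := by
  rw [Nat.pos_iff_ne_zero]
  intro h
  apply hX
  have h0 : sing X 0 = 0 := by rw [← h]; exact sing_rank_eq_zero X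
  have h1 : (Matrix.toEuclideanLin X).singularValues = 0 := by
    ext i
    exact le_antisymm ((sing_antitone X (Nat.zero_le i)).trans_eq h0) (sing_nonneg X i)
  rw [LinearMap.singularValues_eq_zero_iff] at h1
  exact (map_eq_zero_iff _ (Matrix.toEuclideanLin).injective).1 h1

variable {A}

theorem mem_rayleighSet {k : ℕ} {X : Matrix (Fin a) (Fin b) ℝ} (hX : X.rank ≤ k) (h0 : X ≠ 0) :
    ‖sampling A X‖ ^ 2 / frobNorm X ^ 2 ∈ rayleighSet A k :=
  ⟨X, rank_pos_of_ne_zero h0, hX, by rw [trInner_samplingAdj_sampling]⟩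

theorem thetaMinus_mul_le {k : ℕ} {X : Matrix (Fin a) (Fin b) ℝ} (hX : X.rank ≤ k) :
    thetaMinus A k * frobNorm X ^ 2 ≤ ‖sampling A X‖ ^ 2 := by
  by_cases h0 : X = 0
  · subst h0; simp [frobNorm_zero, sampling_zero]
  have hpos : 0 < frobNorm X ^ 2 :=
    pow_pos (lt_of_le_of_ne (frobNorm_nonneg X) fun h => h0 (frobNorm_eq_zero.1 h.symm)) 2
  rw [← le_div_iff₀ hpos]
  exact csInf_le (bddBelow_rayleighSet A k) (mem_rayleighSet hX h0)

theorem le_thetaPlus_mul {k : ℕ} {X : Matrix (Fin a) (Fin b) ℝ} (hX : X.rank ≤ k) :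
    ‖sampling A X‖ ^ 2 ≤ thetaPlus A k * frobNorm X ^ 2 := by
  by_cases h0 : X = 0
  · subst h0; simp [frobNorm_zero, sampling_zero]
  have hpos : 0 < frobNorm X ^ 2 :=
    pow_pos (lt_of_le_of_ne (frobNorm_nonneg X) fun h => h0 (frobNorm_eq_zero.1 h.symm)) 2
  rw [← div_le_iff₀ hpos]
  exact le_csSup (bddAbove_rayleighSet A k) (mem_rayleighSet hX h0)

theorem rayleighSet_mono {k l : ℕ} (hkl : k ≤ l) : rayleighSet A k ⊆ rayleighSet A l := by
  rintro _ ⟨X, h1, h2, rfl⟩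
  exact ⟨X, h1, h2.trans hkl, rfl⟩

theorem thetaMinus_anti {k l : ℕ} (hkl : k ≤ l) (hne : (rayleighSet A k).Nonempty) :
    thetaMinus A l ≤ thetaMinus A k :=
  csInf_le_csInf (bddBelow_rayleighSet A l) hne (rayleighSet_mono hkl)

theorem thetaMinus_le_thetaPlus {k : ℕ} (hne : (rayleighSet A k).Nonempty) :
    thetaMinus A k ≤ thetaPlus A k := by
  obtain ⟨x, hx⟩ := hne
  exact (csInf_le (bddBelow_rayleighSet A k) hx).trans (le_csSup (bddAbove_rayleighSet A k) hx)

theorem rank_add_le (X Y : Matrix (Fin a) (Fin b) ℝ) : (X + Y).rank ≤ X.rank + Y.rank := by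
  have h : (X + Y).mulVecLin.range ≤ X.mulVecLin.range ⊔ Y.mulVecLin.range := by
    rintro _ ⟨v, rfl⟩
    rw [Matrix.mulVecLin_add]
    exact Submodule.add_mem_sup ⟨v, rfl⟩ ⟨v, rfl⟩
  exact (Submodule.finrank_mono h).trans (Submodule.finrank_add_le_finrank_add_finrank _ _)

theorem rank_smul_le (t : ℝ) (X : Matrix (Fin a) (Fin b) ℝ) : (t • X).rank ≤ X.rank := by
  have : t • X = (t • (1 : Matrix (Fin a) (Fin a) ℝ)) * X := by simp
  rw [this]
  exact rank_mul_le_right _ _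

/-- The restricted eigenvalues control the correlation, after sampling, of orthogonal matrices of
small rank. The bound comes from the discriminant of `t ↦ ‖𝒜 (Z + t Y)‖²`. -/
theorem abs_inner_sampling_le {k s K : ℕ} (hK : k + s ≤ K) {κ : ℝ} (hκ : 0 ≤ κ)
    (hθ : 0 < thetaMinus A K) (hratio : thetaPlus A s / thetaMinus A K ≤ 1 + 4 * κ ^ 2)
    {Z Y : Matrix (Fin a) (Fin b) ℝ} (hZ : Z.rank ≤ k) (hY : Y.rank ≤ s)
    (hZY : trInner Z Y = 0) :
    |inner ℝ (sampling A Z) (sampling A Y)| * frobNorm Z ≤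
      κ * (‖sampling A Z‖ ^ 2 * frobNorm Y) := by
  set p : ℝ := inner ℝ (sampling A Z) (sampling A Y) with hp
  set q := ‖sampling A Z‖ ^ 2 with hq
  set z := frobNorm Z with hz
  set y := frobNorm Y with hy
  set θ := thetaMinus A K with hθd
  have hratio' : thetaPlus A s ≤ θ * (1 + 4 * κ ^ 2) := by
    rwa [div_le_iff₀ hθ, mul_comm] at hratio
  have hq0 : 0 ≤ q := sq_nonneg _
  have hquad : ∀ t : ℝ, 0 ≤ (4 * κ ^ 2 * θ * y ^ 2) * (t * t) + (2 * p) * t + (q - θ * z ^ 2) := by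
    intro t
    have h1 := thetaMinus_mul_le (A := A) (k := K) (X := Z + t • Y)
      ((rank_add_le _ _).trans ((add_le_add hZ ((rank_smul_le t Y).trans hY)).trans hK))
    have h2 : frobNorm (Z + t • Y) ^ 2 = z ^ 2 + t ^ 2 * y ^ 2 := by
      rw [frobNorm_sq, trInner_add_left, trInner_add_right, trInner_add_right, trInner_smul_left,
        trInner_smul_left, trInner_smul_right, trInner_smul_right, trInner_comm Y Z, hZY, hz, hy,
        frobNorm_sq, frobNorm_sq]
      ring
    have h3 : ‖sampling A (Z + t • Y)‖ ^ 2 = q + 2 * (t * p) + t ^ 2 * ‖sampling A Y‖ ^ 2 := by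
      rw [sampling_add, sampling_smul, norm_add_sq_real, inner_smul_right, norm_smul, mul_pow,
        Real.norm_eq_abs, sq_abs]
    have h4 : ‖sampling A Y‖ ^ 2 ≤ θ * (1 + 4 * κ ^ 2) * y ^ 2 :=
      (le_thetaPlus_mul hY).trans (mul_le_mul_of_nonneg_right hratio' (sq_nonneg _))
    rw [h2, h3] at h1
    nlinarith [mul_le_mul_of_nonneg_left h4 (sq_nonneg t)]
  have hdisc := discrim_le_zero hquad
  rw [discrim] at hdisc
  have hp2 : p ^ 2 ≤ 4 * κ ^ 2 * θ * y ^ 2 * (q - θ * z ^ 2) := by linarith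
  have h5 : (p * z) ^ 2 ≤ (κ * (q * y)) ^ 2 := by
    have h6 : 4 * (θ * z ^ 2) * (q - θ * z ^ 2) ≤ q ^ 2 := by
      nlinarith [sq_nonneg (q - 2 * (θ * z ^ 2))]
    calc (p * z) ^ 2 = p ^ 2 * z ^ 2 := mul_pow _ _ _
      _ ≤ 4 * κ ^ 2 * θ * y ^ 2 * (q - θ * z ^ 2) * z ^ 2 :=
        mul_le_mul_of_nonneg_right hp2 (sq_nonneg _)
      _ = (κ * y) ^ 2 * (4 * (θ * z ^ 2) * (q - θ * z ^ 2)) := by ring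
      _ ≤ (κ * y) ^ 2 * q ^ 2 := mul_le_mul_of_nonneg_left h6 (sq_nonneg _)
      _ = (κ * (q * y)) ^ 2 := by ring
  have h7 := abs_le_of_sq_le_sq h5 (mul_nonneg hκ (mul_nonneg hq0 (frobNorm_nonneg Y)))
  rwa [abs_mul, abs_of_nonneg (frobNorm_nonneg Z)] at h7

end Sampling

/-! ### Splitting the normal component into blocks -/

section Blocks

variable {a b : ℕ}

/-- The part of an SVD with indices in the `j`-th block of length `s`. -/
noncomputable def svdBlock (U : Matrix (Fin a) (Fin a) ℝ) (t : ℕ → ℝ) (V : Matrix (Fin b) (Fin a) ℝ)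
    (s j : ℕ) : Matrix (Fin a) (Fin b) ℝ :=
  svdMat U (fun i => if (i : ℕ) / s = j then t i else 0) V

/-- The part of an SVD after the first `s` indices. -/
noncomputable def svdTail (U : Matrix (Fin a) (Fin a) ℝ) (t : ℕ → ℝ) (V : Matrix (Fin b) (Fin a) ℝ)
    (s : ℕ) : Matrix (Fin a) (Fin b) ℝ :=
  svdMat U (fun i => if (i : ℕ) < s then 0 else t i) V

variable {U : Matrix (Fin a) (Fin a) ℝ} {V : Matrix (Fin b) (Fin a) ℝ} {t : ℕ → ℝ} {s : ℕ}

theorem svdTail_eq_sum (hs : 1 ≤ s) :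
    svdTail U t V s = ∑ j ∈ Finset.range a, svdBlock U t V s (j + 1) := by
  simp only [svdBlock]
  rw [← svdMat_sum, svdTail]
  congr 1
  funext i
  split_ifs with hi
  · rw [Nat.div_eq_of_lt hi]
    simp
  · have h1 : 1 ≤ (i : ℕ) / s := (Nat.one_le_div_iff (by omega)).2 (not_lt.1 hi)
    have h2 : (i : ℕ) / s ≤ i := Nat.div_le_self _ _
    have h3 := i.2
    rw [Finset.sum_eq_single ((i : ℕ) / s - 1)]
    · rw [if_pos (by omega)]
    · intro j _ hj
      rw [if_neg (by omega)]
    · intro h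
      simp at h
      omega

theorem svdBlock_zero_add_svdTail (hs : 1 ≤ s) :
    svdBlock U t V s 0 + svdTail U t V s = svdMat U (fun i => t i) V := by
  rw [svdBlock, svdTail, ← svdMat_add]
  congr 1
  funext i
  have h : (i : ℕ) / s = 0 ↔ (i : ℕ) < s := by rw [Nat.div_eq_zero_iff]; omega
  simp only [h]
  split_ifs <;> ring

theorem mem_Ico_of_div_eq (hs : 1 ≤ s) {i j : ℕ} (h : i / s = j) :
    i ∈ Finset.Ico (s * j) (s * j + s) := by
  have h1 := Nat.div_add_mod i s
  have h2 := Nat.mod_lt i hs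
  rw [h] at h1
  rw [Finset.mem_Ico]
  omega

theorem rank_svdBlock_le (hs : 1 ≤ s) (j : ℕ) : (svdBlock U t V s j).rank ≤ s := by
  refine (rank_svdMat_le _ _ _).trans ?_
  have h : ∀ i : {i : Fin a // (if (i : ℕ) / s = j then t i else 0) ≠ 0},
      ((i : Fin a) : ℕ) ∈ Finset.Ico (s * j) (s * j + s) := by
    rintro ⟨i, hi⟩
    refine mem_Ico_of_div_eq hs ?_
    by_contra hne
    exact hi (if_neg hne)
  calc _ ≤ Fintype.card (Finset.Ico (s * j) (s * j + s)) :=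
        Fintype.card_le_of_injective (fun i => ⟨_, h i⟩) fun x y hxy => by
          apply Subtype.ext
          apply Fin.ext
          simpa using hxy
    _ = s := by simp

theorem trInner_svdBlock_svdBlock (hU : Uᵀ * U = 1) (hV : Vᵀ * V = 1) {i j : ℕ} (hij : i ≠ j) :
    trInner (svdBlock U t V s i) (svdBlock U t V s j) = 0 := by
  rw [svdBlock, svdBlock, trInner_svdMat_svdMat hU hV]
  refine Finset.sum_eq_zero fun k _ => ?_
  split_ifs with h1 h2
  · exact absurd (h1.symm.trans h2) hij
  all_goals simp

theorem frobNorm_svdBlock_le (hs : 1 ≤ s) (hU : Uᵀ * U = 1) (hV : Vᵀ * V = 1) (ht : Antitone t)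
    (ht0 : ∀ i, 0 ≤ t i) (j : ℕ) : frobNorm (svdBlock U t V s j) ≤ √s * t (s * j) := by
  refine le_of_sq_le_sq ?_ (mul_nonneg (Real.sqrt_nonneg _) (ht0 _))
  rw [svdBlock, frobNorm_sq_svdMat hU hV, mul_pow, Real.sq_sqrt (Nat.cast_nonneg s),
    Fin.sum_univ_eq_sum_range (fun i => (if i / s = j then t i else 0) ^ 2)]
  calc ∑ i ∈ Finset.range a, (if i / s = j then t i else 0) ^ 2
      ≤ ∑ i ∈ Finset.range a, if i ∈ Finset.Ico (s * j) (s * j + s) then t (s * j) ^ 2 else 0 := by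
        refine Finset.sum_le_sum fun i _ => ?_
        by_cases h : i / s = j
        · have h1 := mem_Ico_of_div_eq hs h
          rw [if_pos h, if_pos h1]
          exact pow_le_pow_left₀ (ht0 i) (ht (Finset.mem_Ico.1 h1).1) 2
        · rw [if_neg h, zero_pow two_ne_zero]
          split_ifs
          · exact sq_nonneg _
          · exact le_rfl
    _ = ∑ i ∈ (Finset.range a).filter (· ∈ Finset.Ico (s * j) (s * j + s)), t (s * j) ^ 2 :=
        (Finset.sum_filter _ _).symm
    _ ≤ ∑ i ∈ Finset.Ico (s * j) (s * j + s), t (s * j) ^ 2 :=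
        Finset.sum_le_sum_of_subset_of_nonneg (fun i hi => (Finset.mem_filter.1 hi).2)
          fun _ _ _ => sq_nonneg _
    _ = s * t (s * j) ^ 2 := by simp

theorem sum_frobNorm_svdBlock_le (hs : 1 ≤ s) (hU : Uᵀ * U = 1) (hV : Vᵀ * V = 1) (ht : Antitone t)
    (ht0 : ∀ i, 0 ≤ t i) (J : ℕ) : √s * ∑ j ∈ Finset.range J, frobNorm (svdBlock U t V s (j + 1)) ≤
      ∑ i ∈ Finset.range (s * J), t i := by
  induction J with
  | zero => simp
  | succ J ih =>
    rw [Finset.sum_range_succ, mul_add, Nat.mul_succ, Finset.sum_range_add]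
    refine add_le_add ih ?_
    have hss : √(s : ℝ) * √s = s := Real.mul_self_sqrt (Nat.cast_nonneg s)
    calc √(s : ℝ) * frobNorm (svdBlock U t V s (J + 1)) ≤ √s * (√s * t (s * (J + 1))) :=
          mul_le_mul_of_nonneg_left (frobNorm_svdBlock_le hs hU hV ht ht0 _) (Real.sqrt_nonneg _)
      _ = ∑ _i ∈ Finset.range s, t (s * (J + 1)) := by
          rw [← mul_assoc, hss, Finset.sum_const, Finset.card_range, nsmul_eq_mul]
      _ ≤ _ := Finset.sum_le_sum fun i hi => ht (by
          rw [Finset.mem_range] at hi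
          rw [Nat.mul_succ]
          omega)

theorem frobNorm_sq_svdTail_le (hs : 1 ≤ s) (hsa : s ≤ a) (hU : Uᵀ * U = 1) (hV : Vᵀ * V = 1)
    (ht : Antitone t) (ht0 : ∀ i, 0 ≤ t i) :
    4 * s * frobNorm (svdTail U t V s) ^ 2 ≤ (∑ i ∈ Finset.range a, t i) ^ 2 := by
  obtain ⟨d, rfl⟩ := Nat.exists_eq_add_of_le hsa
  rw [svdTail, frobNorm_sq_svdMat hU hV,
    Fin.sum_univ_eq_sum_range (fun i => (if i < s then 0 else t i) ^ 2), Finset.sum_range_add,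
    Finset.sum_range_add]
  have h0 : ∑ i ∈ Finset.range s, (if i < s then 0 else t i) ^ 2 = 0 :=
    Finset.sum_eq_zero fun i hi => by rw [if_pos (Finset.mem_range.1 hi)]; norm_num
  have h1 : ∑ i ∈ Finset.range d, (if s + i < s then 0 else t (s + i)) ^ 2 ≤
      t s * ∑ i ∈ Finset.range d, t (s + i) := by
    rw [Finset.mul_sum]
    refine Finset.sum_le_sum fun i _ => ?_
    rw [if_neg (by omega), sq]
    exact mul_le_mul_of_nonneg_right (ht (by omega)) (ht0 _)
  have h2 : s * t s ≤ ∑ i ∈ Finset.range s, t i := by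
    calc (s : ℝ) * t s = ∑ _i ∈ Finset.range s, t s := by simp
      _ ≤ _ := Finset.sum_le_sum fun i hi => ht (Finset.mem_range.1 hi).le
  have h3 : 0 ≤ ∑ i ∈ Finset.range d, t (s + i) := Finset.sum_nonneg fun _ _ => ht0 _
  have h4 : 0 ≤ (s : ℝ) * t s := mul_nonneg (Nat.cast_nonneg s) (ht0 s)
  rw [h0, zero_add]
  set R := ∑ i ∈ Finset.range d, t (s + i)
  have hs0 : (0 : ℝ) ≤ s := Nat.cast_nonneg s
  calc _ ≤ 4 * s * (t s * R) := mul_le_mul_of_nonneg_left h1 (by positivity)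
    _ ≤ (s * t s + R) ^ 2 := by nlinarith [sq_nonneg (s * t s - R)]
    _ ≤ _ := pow_le_pow_left₀ (by linarith) (by linarith) 2

end Blocks

/-! ### The error bound for one convex relaxation -/

section Cone

variable {a b r : ℕ} {U₁ : Matrix (Fin a) (Fin r) ℝ} {V₁ : Matrix (Fin b) (Fin r) ℝ}

theorem frobNorm_compl_mul_le {c : ℕ} (hU : U₁ᵀ * U₁ = 1) (X : Matrix (Fin a) (Fin c) ℝ) :
    frobNorm ((1 - U₁ * U₁ᵀ) * X) ≤ frobNorm X := by
  refine le_of_sq_le_sq ?_ (frobNorm_nonneg _)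
  rw [Matrix.sub_mul, Matrix.one_mul]
  nlinarith [frobNorm_sq_projector_add hU X, sq_nonneg (frobNorm (U₁ᵀ * X))]

/-- The subdifferential of the nuclear norm: `U₁V₁ᵀ + P_{𝒯^⊥}(Z)` is a contraction whenever `Z`
is. -/
theorem specNorm_add_projTperp_le (hU : U₁ᵀ * U₁ = 1) (hV : V₁ᵀ * V₁ = 1)
    {Z : Matrix (Fin a) (Fin b) ℝ} (hZ : specNorm Z ≤ 1) :
    specNorm (U₁ * V₁ᵀ + projTperp U₁ V₁ Z) ≤ 1 := by
  refine specNorm_le_of_col zero_le_one fun x => ?_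
  rw [one_mul]
  refine le_of_sq_le_sq ?_ (frobNorm_nonneg _)
  have h0 : U₁ᵀ * (1 - U₁ * U₁ᵀ) = 0 := by
    rw [Matrix.mul_sub, ← Matrix.mul_assoc, hU, Matrix.one_mul, Matrix.mul_one, sub_self]
  have e1 : U₁ᵀ * ((U₁ * V₁ᵀ + projTperp U₁ V₁ Z) * x) = V₁ᵀ * x := by
    rw [projTperp_eq_mul, ← Matrix.mul_assoc, Matrix.mul_add, ← Matrix.mul_assoc, hU,
      Matrix.one_mul, ← Matrix.mul_assoc, ← Matrix.mul_assoc, h0]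
    simp
  have h1 := frobNorm_sq_projector_add hU ((U₁ * V₁ᵀ + projTperp U₁ V₁ Z) * x)
  have h2 := frobNorm_sq_projector_add hV x
  have e2 : (U₁ * V₁ᵀ + projTperp U₁ V₁ Z) * x -
      U₁ * U₁ᵀ * ((U₁ * V₁ᵀ + projTperp U₁ V₁ Z) * x) =
      (1 - U₁ * U₁ᵀ) * (Z * ((1 - V₁ * V₁ᵀ) * x)) := by
    rw [Matrix.mul_assoc U₁ U₁ᵀ, e1, Matrix.add_mul, projTperp_eq_mul]
    simp only [Matrix.mul_assoc]
    abel
  rw [e1, e2] at h1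
  have h3 : frobNorm ((1 - U₁ * U₁ᵀ) * (Z * ((1 - V₁ * V₁ᵀ) * x))) ≤
      frobNorm (x - V₁ * V₁ᵀ * x) := by
    refine (frobNorm_compl_mul_le hU _).trans ((frobNorm_mul_col_le _ _).trans ?_)
    rw [Matrix.sub_mul, Matrix.one_mul]
    exact mul_le_of_le_one_left (frobNorm_nonneg _) hZ
  have h4 := pow_le_pow_left₀ (frobNorm_nonneg _) h3 2
  linarith

theorem trInner_projTperp_left (Y Z : Matrix (Fin a) (Fin b) ℝ) :
    trInner (projTperp U₁ V₁ Y) Z = trInner Y (projTperp U₁ V₁ Z) := by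
  rw [projTperp, projTperp, trInner_sub_left, trInner_sub_right, trInner_projT_left]

theorem projTperp_sub (Y Z : Matrix (Fin a) (Fin b) ℝ) :
    projTperp U₁ V₁ (Y - Z) = projTperp U₁ V₁ Y - projTperp U₁ V₁ Z := by
  simp only [projTperp, projT_sub]
  abel

theorem projTperp_projTperp (hU : U₁ᵀ * U₁ = 1) (hV : V₁ᵀ * V₁ = 1) (Z : Matrix (Fin a) (Fin b) ℝ) :
    projTperp U₁ V₁ (projTperp U₁ V₁ Z) = projTperp U₁ V₁ Z := by
  conv_lhs => rw [projTperp]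
  rw [sub_eq_self, projTperp, projT_sub, projT_projT hU hV, sub_self]

theorem projT_add_projTperp (Z : Matrix (Fin a) (Fin b) ℝ) :
    projT U₁ V₁ Z + projTperp U₁ V₁ Z = Z := by rw [projTperp]; abel

theorem projTperp_mul_transpose (hU : U₁ᵀ * U₁ = 1) : projTperp U₁ V₁ (U₁ * V₁ᵀ) = 0 := by
  rw [projTperp, projT_mul_transpose hU, sub_self]

variable {Y : Matrix (Fin a) (Fin b) ℝ}

theorem IsLeadingSVD.projTperp_eq_zero (h : IsLeadingSVD Y U₁ V₁) : projTperp U₁ V₁ Y = 0 := by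
  have hY : U₁ * U₁ᵀ * Y = Y := by
    rw [h.eq]
    simp only [← Matrix.mul_assoc]
    rw [Matrix.mul_assoc U₁ U₁ᵀ U₁, h.orth_left, Matrix.mul_one]
  rw [projTperp_eq_mul, Matrix.sub_mul 1, Matrix.one_mul, hY, sub_self, Matrix.zero_mul]

theorem IsLeadingSVD.nuclearNorm_eq (h : IsLeadingSVD Y U₁ V₁) (hra : r ≤ a) :
    nuclearNorm Y = trInner (U₁ * V₁ᵀ) Y := by
  conv_rhs => rw [h.eq_svdMat]
  rw [← svdMat_headInd_self, trInner_svdMat_svdMat h.orth_left h.orth_right,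
    sum_headInd_mul le_rfl, nuclearNorm_eq_sum_range]
  symm
  refine Finset.sum_subset (Finset.range_mono hra) fun i _ hi => ?_
  rw [Finset.mem_range, not_lt] at hi
  exact le_antisymm ((sing_antitone Y hi).trans_eq h.sing_eq_zero) (sing_nonneg Y i)

/-- The cone condition: optimality of `X` against `Y` bounds the normal component of the error by
its tangential component. -/
theorem nuclearNorm_projTperp_le (hab : a ≤ b) (hr : 1 ≤ r) (hra : r ≤ a)
    (h : IsLeadingSVD Y U₁ V₁) {W X : Matrix (Fin a) (Fin b) ℝ}
    (hW : specNorm (projTperp U₁ V₁ W) < 1)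
    (hopt : nuclearNorm X - trInner W X ≤ nuclearNorm Y - trInner W Y) :
    nuclearNorm (projTperp U₁ V₁ (X - Y)) ≤
      √(2 * r) * gammaOf U₁ V₁ W * frobNorm (projT U₁ V₁ (X - Y)) := by
  have hU := h.orth_left
  have hV := h.orth_right
  set H := X - Y with hH
  obtain ⟨Z, hZ1, hZ⟩ := exists_dual_certificate hab (projTperp U₁ V₁ H)
  have h1 := trInner_le_specNorm_mul_nuclearNorm hab (U₁ * V₁ᵀ + projTperp U₁ V₁ Z) X
  have h2 : trInner (U₁ * V₁ᵀ + projTperp U₁ V₁ Z) X =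
      nuclearNorm Y + trInner (U₁ * V₁ᵀ) H + nuclearNorm (projTperp U₁ V₁ H) := by
    have hX : X = Y + H := by rw [hH]; abel
    rw [trInner_add_left, trInner_projTperp_left]
    conv_lhs => rw [hX]
    have e : projTperp U₁ V₁ (Y + H) = projTperp U₁ V₁ H := by
      have e' : H = Y + H - Y := by abel
      conv_rhs => rw [e', projTperp_sub, h.projTperp_eq_zero, sub_zero]
    rw [e, hZ, trInner_add_right, h.nuclearNorm_eq hra]
  have h3 : trInner (U₁ * V₁ᵀ + projTperp U₁ V₁ Z) X ≤ nuclearNorm X :=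
    h1.trans (mul_le_of_le_one_left (nuclearNorm_nonneg X) (specNorm_add_projTperp_le hU hV hZ1))
  have h4 : trInner (W - U₁ * V₁ᵀ) H = trInner (projT U₁ V₁ (W - U₁ * V₁ᵀ)) (projT U₁ V₁ H) +
      trInner (projTperp U₁ V₁ W) (projTperp U₁ V₁ H) := by
    conv_lhs => rw [← projT_add_projTperp (U₁ := U₁) (V₁ := V₁) H]
    rw [trInner_add_right, trInner_projT_left, projT_projT hU hV, trInner_projTperp_left W,
      projTperp_projTperp hU hV, trInner_sub_left W _ (projTperp U₁ V₁ H),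
      ← trInner_projTperp_left (U₁ * V₁ᵀ), projTperp_mul_transpose hU, trInner_zero_left, sub_zero]
  have h5 := trInner_le_frobNorm_mul (projT U₁ V₁ (W - U₁ * V₁ᵀ)) (projT U₁ V₁ H)
  have h6 := trInner_le_specNorm_mul_nuclearNorm hab (projTperp U₁ V₁ W) (projTperp U₁ V₁ H)
  have h7 : trInner W H = trInner W X - trInner W Y := by rw [hH, trInner_sub_right]
  rw [trInner_sub_left] at h4
  have h8 : (1 - specNorm (projTperp U₁ V₁ W)) * nuclearNorm (projTperp U₁ V₁ H) ≤
      frobNorm (projT U₁ V₁ (W - U₁ * V₁ᵀ)) * frobNorm (projT U₁ V₁ H) := by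
    linarith
  have hr0 : (0 : ℝ) < r := by exact_mod_cast hr
  have hs : √(2 * (r : ℝ)) ≠ 0 := (Real.sqrt_pos.2 (by positivity)).ne'
  have h9 : 0 < 1 - specNorm (projTperp U₁ V₁ W) := by linarith
  have e : √(2 * r) * gammaOf U₁ V₁ W * frobNorm (projT U₁ V₁ H) =
      frobNorm (projT U₁ V₁ (W - U₁ * V₁ᵀ)) * frobNorm (projT U₁ V₁ H) /
        (1 - specNorm (projTperp U₁ V₁ W)) := by
    rw [gammaOf]
    field_simp
  rw [e, le_div_iff₀ h9, mul_comm]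
  exact h8

end Cone

section ErrorBound

variable {a b r m s : ℕ} {U₁ : Matrix (Fin a) (Fin r) ℝ} {V₁ : Matrix (Fin b) (Fin r) ℝ}
  {Y : Matrix (Fin a) (Fin b) ℝ} {A : Fin m → Matrix (Fin a) (Fin b) ℝ} {c δ : ℝ}

theorem rank_projT_le (Z : Matrix (Fin a) (Fin b) ℝ) : (projT U₁ V₁ Z).rank ≤ 2 * r := by
  have e : projT U₁ V₁ Z = U₁ * (U₁ᵀ * Z) + (Z - U₁ * U₁ᵀ * Z) * V₁ * V₁ᵀ := by
    simp only [projT, Matrix.sub_mul, Matrix.mul_assoc]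
    abel
  have h1 : (U₁ * (U₁ᵀ * Z)).rank ≤ r := (rank_mul_le_left _ _).trans (rank_le_width _)
  have h2 : ((Z - U₁ * U₁ᵀ * Z) * V₁ * V₁ᵀ).rank ≤ r :=
    (rank_mul_le_left _ _).trans (rank_le_width _)
  rw [e]
  exact (rank_add_le _ _).trans (by omega)

/-- Blocks of an SVD of a matrix in `𝒯^⊥` stay in `𝒯^⊥`. -/
theorem projT_svdMat_mul_eq_zero (hU : U₁ᵀ * U₁ = 1) (hV : V₁ᵀ * V₁ = 1)
    {U : Matrix (Fin a) (Fin a) ℝ} {V : Matrix (Fin b) (Fin a) ℝ} (hUU : Uᵀ * U = 1)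
    (hVV : Vᵀ * V = 1) {t e : Fin a → ℝ} {Z : Matrix (Fin a) (Fin b) ℝ}
    (hZ : projTperp U₁ V₁ Z = svdMat U t V) :
    projT U₁ V₁ (svdMat U (fun i => e i * t i) V) = 0 := by
  have hP : U₁ * U₁ᵀ * (1 - U₁ * U₁ᵀ) = 0 := by
    rw [Matrix.mul_sub, Matrix.mul_one, Matrix.mul_assoc U₁ U₁ᵀ (U₁ * U₁ᵀ),
      ← Matrix.mul_assoc U₁ᵀ U₁, hU, Matrix.one_mul, sub_self]
  have hQ : (1 - V₁ * V₁ᵀ) * (V₁ * V₁ᵀ) = 0 := by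
    rw [Matrix.sub_mul, Matrix.one_mul, Matrix.mul_assoc V₁ V₁ᵀ (V₁ * V₁ᵀ),
      ← Matrix.mul_assoc V₁ᵀ V₁, hV, Matrix.one_mul, sub_self]
  have h1 : U₁ * U₁ᵀ * svdMat U t V = 0 := by
    rw [← hZ, projTperp_eq_mul, ← Matrix.mul_assoc, ← Matrix.mul_assoc, hP]
    simp
  have h2 : svdMat U t V * (V₁ * V₁ᵀ) = 0 := by
    rw [← hZ, projTperp_eq_mul, Matrix.mul_assoc, hQ, Matrix.mul_zero]
  have e1 : svdMat U (fun i => e i * t i) V = svdMat U t V * (V * diagonal e * Vᵀ) := by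
    rw [svdMat, svdMat, ← diagonal_mul_diagonal, (Matrix.commute_diagonal e t).eq]
    simp only [Matrix.mul_assoc]
    rw [← Matrix.mul_assoc Vᵀ V, hVV, Matrix.one_mul]
  have e2 : svdMat U (fun i => e i * t i) V = U * diagonal e * Uᵀ * svdMat U t V := by
    rw [svdMat, svdMat, ← diagonal_mul_diagonal]
    simp only [Matrix.mul_assoc]
    rw [← Matrix.mul_assoc Uᵀ U, hUU, Matrix.one_mul]
  have h3 : U₁ * U₁ᵀ * svdMat U (fun i => e i * t i) V = 0 := by
    rw [e1, ← Matrix.mul_assoc, h1, Matrix.zero_mul]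
  have h4 : svdMat U (fun i => e i * t i) V * (V₁ * V₁ᵀ) = 0 := by
    rw [e2, Matrix.mul_assoc, h2, Matrix.mul_zero]
  rw [projT, h3, h4]
  simp

theorem sing_eq_zero_of_le (X : Matrix (Fin a) (Fin b) ℝ) {i : ℕ} (hi : a ≤ i) : sing X i = 0 :=
  le_antisymm ((sing_antitone X ((rank_le_height X).trans hi)).trans_eq (sing_rank_eq_zero X))
    (sing_nonneg X i)

theorem sum_sing_le_nuclearNorm (X : Matrix (Fin a) (Fin b) ℝ) (k : ℕ) :
    ∑ i ∈ Finset.range k, sing X i ≤ nuclearNorm X := by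
  rw [nuclearNorm_eq_sum_range]
  rcases le_total k a with h | h
  · exact Finset.sum_le_sum_of_subset_of_nonneg (Finset.range_mono h) fun _ _ _ => sing_nonneg _ _
  · refine (Finset.sum_subset (Finset.range_mono h) fun i _ hi => ?_).ge
    exact sing_eq_zero_of_le X (by simpa using hi)

theorem IsLeadingSVD.rayleighSet_nonempty (h : IsLeadingSVD Y U₁ V₁) (hr : 1 ≤ r) :
    (rayleighSet A (2 * r + s)).Nonempty :=
  ⟨_, Y, by rw [h.rank_eq]; omega, by rw [h.rank_eq]; omega, rfl⟩

theorem RestrictedEigenvalue.thetaMinus_pos (hA : RestrictedEigenvalue A r s c) (hr : 1 ≤ r)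
    (h : IsLeadingSVD Y U₁ V₁) : 0 < thetaMinus A (2 * r + s) :=
  hA.pos.trans_le (thetaMinus_anti (by omega) (h.rayleighSet_nonempty hr))

/-- The constant `2δ√ϑ₊(2r+s) / ϑ₋(2r+s)`. -/
noncomputable def noiseConst (A : Fin m → Matrix (Fin a) (Fin b) ℝ) (δ : ℝ) (r s : ℕ) : ℝ :=
  2 * δ * √(thetaPlus A (2 * r + s)) / thetaMinus A (2 * r + s)

theorem RestrictedEigenvalue.noiseConst_pos (hA : RestrictedEigenvalue A r s c) (hr : 1 ≤ r)
    (h : IsLeadingSVD Y U₁ V₁) (hδ : 0 < δ) : 0 < noiseConst A δ r s := by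
  have h1 := hA.thetaMinus_pos hr h
  have h2 := h1.trans_le (thetaMinus_le_thetaPlus (h.rayleighSet_nonempty hr))
  exact div_pos (mul_pos (by linarith) (Real.sqrt_pos.2 h2)) h1

/-- The error of an approximately feasible matrix in the cone is controlled on its leading part,
which has rank at most `2r + s`. -/
theorem RestrictedEigenvalue.exists_leading_part (hA : RestrictedEigenvalue A r s c) (hr : 1 ≤ r)
    (h : IsLeadingSVD Y U₁ V₁) (hab : a ≤ b) (hδ : 0 < δ) {H : Matrix (Fin a) (Fin b) ℝ} {g : ℝ}
    (hg : 0 ≤ g) (hcg : c * g < 1) (hH : ‖sampling A H‖ ≤ 2 * δ)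
    (hcone : nuclearNorm (projTperp U₁ V₁ H) ≤ √(2 * r) * g * frobNorm (projT U₁ V₁ H)) :
    ∃ z : ℝ, frobNorm (projT U₁ V₁ H) ≤ z ∧
      4 * s * (frobNorm H ^ 2 - z ^ 2) ≤ nuclearNorm (projTperp U₁ V₁ H) ^ 2 ∧
      z * (1 - c * g) ≤ noiseConst A δ r s := by
  have hU₁ := h.orth_left
  have hV₁ := h.orth_right
  have hs := hA.one_le_s
  have hs0 : (0 : ℝ) < s := by exact_mod_cast hs
  have hr0 : (0 : ℝ) < r := by exact_mod_cast hr
  have hc := hA.c_nonneg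
  obtain ⟨U, V, hU, hV, hsvd⟩ := exists_svd hab (projTperp U₁ V₁ H)
  set t := sing (projTperp U₁ V₁ H) with ht
  set N := nuclearNorm (projTperp U₁ V₁ H) with hN
  set B := svdBlock U t V s with hB
  set T := svdTail U t V s with hT
  have hsplit := svdBlock_zero_add_svdTail (U := U) (V := V) (t := t) hs
  rw [← hsvd, ← hB, ← hT] at hsplit
  have htanti : Antitone t := sing_antitone _
  have ht0 : ∀ i, 0 ≤ t i := sing_nonneg _
  set Z := projT U₁ V₁ H + B 0 with hZ
  have hHZ : H = Z + T := by
    rw [hZ, add_assoc, hsplit, projT_add_projTperp]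
  have hPB : ∀ j, trInner (projT U₁ V₁ H) (B j) = 0 := by
    intro j
    have e : B j = svdMat U (fun i => (if (i : ℕ) / s = j then 1 else 0) * t i) V := by
      rw [hB, svdBlock]
      congr 1
      funext i
      split_ifs <;> simp
    rw [trInner_projT_left, e, projT_svdMat_mul_eq_zero hU₁ hV₁ hU hV hsvd, trInner_zero_right]
  have hTsum : T = ∑ j ∈ Finset.range a, B (j + 1) := svdTail_eq_sum hs
  have hZB : ∀ j, trInner Z (B (j + 1)) = 0 := by
    intro j
    rw [hZ, trInner_add_left, hPB, zero_add]
    exact trInner_svdBlock_svdBlock hU hV (by omega)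
  have hZT : trInner Z T = 0 := by
    rw [hTsum, trInner_sum_right]
    exact Finset.sum_eq_zero fun j _ => hZB j
  have hZrank : Z.rank ≤ 2 * r + s :=
    (rank_add_le _ _).trans (add_le_add (rank_projT_le H) (rank_svdBlock_le hs 0))
  have hZsq : frobNorm Z ^ 2 = frobNorm (projT U₁ V₁ H) ^ 2 + frobNorm (B 0) ^ 2 := by
    rw [frobNorm_sq, hZ, trInner_add_left, trInner_add_right, trInner_add_right,
      trInner_comm (B 0) (projT U₁ V₁ H), hPB, frobNorm_sq, frobNorm_sq]
    ring
  have hHsq : frobNorm H ^ 2 = frobNorm Z ^ 2 + frobNorm T ^ 2 := by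
    conv_lhs => rw [hHZ]
    rw [frobNorm_sq, trInner_add_left, trInner_add_right Z, trInner_add_right T,
      trInner_comm T Z, hZT, frobNorm_sq, frobNorm_sq]
    ring
  have hTle := frobNorm_sq_svdTail_le hs (by have := hA.s_le; omega) hU hV htanti ht0
  rw [← hT, ← nuclearNorm_eq_sum_range] at hTle
  have hPZ : frobNorm (projT U₁ V₁ H) ≤ frobNorm Z :=
    le_of_sq_le_sq (by rw [hZsq]; linarith [sq_nonneg (frobNorm (B 0))]) (frobNorm_nonneg Z)
  refine ⟨frobNorm Z, hPZ, by rw [hHsq]; linarith, ?_⟩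
  have hCpos := hA.noiseConst_pos hr h hδ
  rcases (frobNorm_nonneg Z).eq_or_lt with hz0 | hz0
  · rw [← hz0, zero_mul]; exact hCpos.le
  -- the constant of the correlation bound is `κ = c √s / √(2r)`
  set κ := c * √s / √(2 * r) with hκ
  have hs2 : √(s : ℝ) ^ 2 = s := Real.sq_sqrt hs0.le
  have hr2 : √(2 * (r : ℝ)) ^ 2 = 2 * r := Real.sq_sqrt (by positivity)
  have hsp : 0 < √(s : ℝ) := Real.sqrt_pos.2 hs0
  have hrp : 0 < √(2 * (r : ℝ)) := Real.sqrt_pos.2 (by positivity)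
  have hκ0 : 0 ≤ κ := by positivity
  have hratio : thetaPlus A s / thetaMinus A (2 * r + 2 * s) ≤ 1 + 4 * κ ^ 2 := by
    have e : 4 * κ ^ 2 = 2 * c ^ 2 * s / r := by
      rw [hκ, div_pow, mul_pow, hs2, hr2]
      field_simp
      ring
    rw [e]
    exact hA.ratio_le
  set q := ‖sampling A Z‖ ^ 2 with hq
  have hcross : ∀ j ∈ Finset.range a, |inner ℝ (sampling A Z) (sampling A (B (j + 1)))| *
      frobNorm Z ≤ κ * (q * frobNorm (B (j + 1))) := fun j _ =>
    abs_inner_sampling_le (k := 2 * r + s) (by omega) hκ0 hA.pos hratio hZrank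
      (rank_svdBlock_le hs _) (hZB j)
  have hsumB := sum_frobNorm_svdBlock_le hs hU hV htanti ht0 a
  have hsumB' : √s * ∑ j ∈ Finset.range a, frobNorm (B (j + 1)) ≤ N :=
    hsumB.trans (sum_sing_le_nuclearNorm _ _)
  have hq0 : 0 ≤ q := sq_nonneg _
  have hT1 : -inner ℝ (sampling A Z) (sampling A T) * frobNorm Z ≤
      q * (c * g * frobNorm Z) := by
    calc -inner ℝ (sampling A Z) (sampling A T) * frobNorm Z
        = ∑ j ∈ Finset.range a,
          -inner ℝ (sampling A Z) (sampling A (B (j + 1))) * frobNorm Z := by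
          rw [hTsum, sampling_sum, inner_sum, ← Finset.sum_neg_distrib, Finset.sum_mul]
      _ ≤ ∑ j ∈ Finset.range a, κ * (q * frobNorm (B (j + 1))) :=
          Finset.sum_le_sum fun j hj => (mul_le_mul_of_nonneg_right (neg_le_abs _)
            (frobNorm_nonneg Z)).trans (hcross j hj)
      _ = q * (κ / √s) * (√s * ∑ j ∈ Finset.range a, frobNorm (B (j + 1))) := by
          rw [← Finset.mul_sum, ← Finset.mul_sum]
          field_simp
      _ ≤ q * (κ / √s) * (√(2 * r) * g * frobNorm Z) := by
          refine mul_le_mul_of_nonneg_left ?_ (by positivity)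
          exact hsumB'.trans (hcone.trans (mul_le_mul_of_nonneg_left hPZ (by positivity)))
      _ = q * (c * g * frobNorm Z) := by
          rw [hκ]
          field_simp
  have hinner : inner ℝ (sampling A Z) (sampling A H) =
      q + inner ℝ (sampling A Z) (sampling A T) := by
    conv_lhs => rw [hHZ]
    rw [sampling_add A Z, inner_add_right, real_inner_self_eq_norm_sq]
  have hCS : inner ℝ (sampling A Z) (sampling A H) ≤ ‖sampling A Z‖ * (2 * δ) :=
    (real_inner_le_norm _ _).trans (mul_le_mul_of_nonneg_left hH (norm_nonneg _))
  have hmain : q * (1 - c * g) ≤ ‖sampling A Z‖ * (2 * δ) := by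
    refine le_trans ?_ hCS
    rw [hinner]
    refine le_of_mul_le_mul_right ?_ hz0
    linarith
  have hθm := hA.thetaMinus_pos hr h
  have hqZ := thetaMinus_mul_le (A := A) hZrank
  have hqZ' := le_thetaPlus_mul (A := A) hZrank
  have hθp : 0 < thetaPlus A (2 * r + s) :=
    hθm.trans_le (thetaMinus_le_thetaPlus (h.rayleighSet_nonempty hr))
  have hnorm : ‖sampling A Z‖ ≤ √(thetaPlus A (2 * r + s)) * frobNorm Z := by
    refine le_of_sq_le_sq ?_ (by positivity)
    rw [mul_pow, Real.sq_sqrt hθp.le]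
    exact hqZ'
  rw [noiseConst, le_div_iff₀ hθm]
  have h1 : thetaMinus A (2 * r + s) * frobNorm Z ^ 2 * (1 - c * g) ≤
      √(thetaPlus A (2 * r + s)) * frobNorm Z * (2 * δ) :=
    (mul_le_mul_of_nonneg_right hqZ (by linarith)).trans
      (hmain.trans (mul_le_mul_of_nonneg_right hnorm (by linarith)))
  refine le_of_mul_le_mul_right ?_ hz0
  linarith

theorem gammaOf_nonneg {W : Matrix (Fin a) (Fin b) ℝ} (hW : specNorm (projTperp U₁ V₁ W) < 1) :
    0 ≤ gammaOf U₁ V₁ W :=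
  div_nonneg (frobNorm_nonneg _) (mul_nonneg (Real.sqrt_nonneg _) (by linarith))

/-- The bounds `Ξ` and `Γ` for a solution of the relaxation with weight `W`. -/
theorem SolvesX.error_bound {Ω : Set (Matrix (Fin a) (Fin b) ℝ)}
    {y ξ : EuclideanSpace ℝ (Fin m)} {W X : Matrix (Fin a) (Fin b) ℝ}
    (hX : SolvesX A y δ Ω W X) (hA : RestrictedEigenvalue A r s c) (hr : 1 ≤ r)
    (h : IsLeadingSVD Y U₁ V₁) (hab : a ≤ b) (hδ : 0 < δ) (hξ : ‖ξ‖ ≤ δ)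
    (hy : y = sampling A Y + ξ) (hYΩ : Y ∈ Ω) (hW : specNorm (projTperp U₁ V₁ W) < 1)
    (hcg : c * gammaOf U₁ V₁ W < 1) :
    frobNorm (X - Y) ≤ errBound A δ r s c (gammaOf U₁ V₁ W) ∧
      nuclearNorm (projTperp U₁ V₁ X) ≤ rankBound A δ r s c (gammaOf U₁ V₁ W) := by
  obtain ⟨⟨hX1, -⟩, hmin⟩ := hX
  have hYfeas : ‖sampling A Y - y‖ ≤ δ := by
    rw [hy, sub_add_cancel_left, norm_neg]
    exact hξ
  have hopt : nuclearNorm X - trInner W X ≤ nuclearNorm Y - trInner W Y := hmin ⟨hYfeas, hYΩ⟩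
  have hra : r ≤ a := by have := hA.s_le; omega
  have hcone := nuclearNorm_projTperp_le hab hr hra h hW hopt
  have hH : ‖sampling A (X - Y)‖ ≤ 2 * δ := by
    have e : sampling A (X - Y) = (sampling A X - y) - (sampling A Y - y) := by
      rw [sampling_sub]; abel
    rw [e]
    exact (norm_sub_le _ _).trans (by linarith)
  set g := gammaOf U₁ V₁ W with hg
  have hg0 : 0 ≤ g := gammaOf_nonneg hW
  obtain ⟨z, hz1, hz2, hz3⟩ := hA.exists_leading_part hr h hab hδ hg0 hcg hH hcone
  have hz0 : 0 ≤ z := (frobNorm_nonneg _).trans hz1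
  have hcg' : 0 < 1 - c * g := by linarith
  have hzC : z ≤ noiseConst A δ r s / (1 - c * g) := by rwa [le_div_iff₀ hcg']
  have hs0 : (0 : ℝ) < s := by exact_mod_cast hA.one_le_s
  have hN : nuclearNorm (projTperp U₁ V₁ (X - Y)) ≤ √(2 * r) * g * z :=
    hcone.trans (mul_le_mul_of_nonneg_left hz1 (by positivity))
  have hN0 := nuclearNorm_nonneg (projTperp U₁ V₁ (X - Y))
  constructor
  · have h1 : frobNorm (X - Y) ^ 2 ≤ (z * √(1 + r * g ^ 2 / (2 * s))) ^ 2 := by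
      rw [mul_pow, Real.sq_sqrt (by positivity)]
      have h2 := pow_le_pow_left₀ hN0 hN 2
      rw [mul_pow, mul_pow, Real.sq_sqrt (by positivity)] at h2
      have h3 : frobNorm (X - Y) ^ 2 - z ^ 2 ≤ 2 * r * g ^ 2 * z ^ 2 / (4 * s) := by
        rw [le_div_iff₀ (by positivity)]
        linarith
      have h4 : 2 * r * g ^ 2 * z ^ 2 / (4 * s) = z ^ 2 * (r * g ^ 2 / (2 * s)) := by
        field_simp
        ring
      linarith
    have h2 := le_of_sq_le_sq h1 (by positivity)
    refine h2.trans ?_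
    rw [errBound]
    refine mul_le_mul_of_nonneg_right ?_ (Real.sqrt_nonneg _)
    rw [mul_one_div]
    exact hzC
  · have e : projTperp U₁ V₁ X = projTperp U₁ V₁ (X - Y) := by
      rw [projTperp_sub, h.projTperp_eq_zero, sub_zero]
    rw [e, rankBound]
    refine hN.trans ?_
    calc √(2 * r) * g * z ≤ √(2 * r) * g * (noiseConst A δ r s / (1 - c * g)) :=
          mul_le_mul_of_nonneg_left hzC (by positivity)
      _ = _ := by rw [noiseConst]; ring

end ErrorBound

/-! ### Monotonicity of the scalar bounds -/

section Scalar

theorem betaStep_pos {σ x : ℝ} (hx : 0 < x) (hxσ : 2 * x < σ) : 0 < betaStep σ x := by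
  have h2 : √2 ≤ 2 := Real.sqrt_le_iff.2 ⟨by norm_num, by norm_num⟩
  have h1 : √2 * x < σ := by nlinarith
  exact lt_of_lt_of_le (div_pos (by linarith) (by linarith)) (div_le_betaStep hx.le h1)

theorem betaStep_lt_one {σ x : ℝ} (hx : 0 < x) (hxσ : 2 * x < σ) : betaStep σ x < 1 := by
  have h2 : 0 < √2 := by positivity
  have hs : √2 * √2 = (2 : ℝ) := Real.mul_self_sqrt (by norm_num)
  have hσ : 0 < σ := by linarith
  have hu : √2 * x / σ < √2 / 2 := by
    rw [div_lt_div_iff₀ hσ two_pos]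
    nlinarith
  -- `e^{√2} ≥ 2 + √2 = (1 - √2/2)⁻¹`
  have hexp : 2 + √2 ≤ Real.exp √2 := by
    have := Real.quadratic_le_exp_of_nonneg h2.le
    rw [Real.sq_sqrt (by norm_num)] at this
    linarith
  have h3 : Real.exp (-√2) ≤ 1 - √2 / 2 := by
    rw [Real.exp_neg]
    refine inv_le_of_inv_le₀ ?_ (le_trans (le_of_eq ?_) hexp)
    · nlinarith
    · exact inv_eq_of_mul_eq_one_right (by nlinarith)
  have h4 : -√2 < Real.log (1 - √2 * x / σ) := by
    rw [Real.lt_log_iff_exp_lt (by linarith [Real.exp_pos (-√2)])]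
    linarith
  have e : betaStep σ x = -Real.log (1 - √2 * x / σ) / √2 := by
    rw [betaStep]; ring
  rw [e, div_lt_one h2]
  linarith

theorem betaStep_lt_betaStep {σ x y : ℝ} (hx : 0 ≤ x) (hxy : x < y) (hy : 2 * y < σ) :
    betaStep σ x < betaStep σ y := by
  have h2 : 0 < √2 := by positivity
  have h2' : √2 ≤ 2 := Real.sqrt_le_iff.2 ⟨by norm_num, by norm_num⟩
  have hσ : 0 < σ := by linarith
  have h1 : √2 * x / σ < √2 * y / σ := by gcongr
  have h3 : √2 * y / σ < 1 := by
    rw [div_lt_one hσ]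
    nlinarith
  have h4 := Real.log_lt_log (by linarith) (by linarith : 1 - √2 * y / σ < 1 - √2 * x / σ)
  rw [betaStep, betaStep, neg_mul, neg_mul, neg_lt_neg_iff]
  exact mul_lt_mul_of_pos_left h4 (by positivity)

theorem gammaStep_lt_gammaStep {r : ℕ} (hr : 1 ≤ r) {a a' b b' β β' : ℝ} (ha0 : 0 ≤ a)
    (ha : a ≤ a') (ha1 : a' < 1) (hb : b' ≤ b) (hb1 : b ≤ 1) (hβ0 : 0 ≤ β) (hβ : β < β')
    (hβ1 : β' < 1) : gammaStep r a b β < gammaStep r a' b' β' := by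
  have hr0 : (0 : ℝ) < r := by exact_mod_cast hr
  have h2 : 0 < √2 := by positivity
  have hr2 : 0 < √(2 * (r : ℝ)) := Real.sqrt_pos.2 (by positivity)
  have hden : 0 < √(2 * r) * (1 - a') * (1 - β' ^ 2) :=
    mul_pos (mul_pos hr2 (by linarith)) (by nlinarith)
  refine div_lt_div₀ ?_ ?_ ?_ hden
  · have h1 : √(r : ℝ) * (1 - b) ≤ √r * (1 - b') :=
      mul_le_mul_of_nonneg_left (by linarith) (Real.sqrt_nonneg _)
    have h3 : (√2 * a + 1) * β < (√2 * a' + 1) * β' := by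
      have h4 : √2 * a ≤ √2 * a' := mul_le_mul_of_nonneg_left ha h2.le
      have h5 : 0 ≤ √2 * a := by positivity
      nlinarith
    linarith
  · refine mul_le_mul (mul_le_mul_of_nonneg_left (by linarith) hr2.le) (by nlinarith) (by nlinarith)
      (mul_nonneg hr2.le (by linarith))
  · have ha' := ha0.trans ha
    have hβ' := hβ0.trans hβ.le
    exact add_nonneg (mul_nonneg (Real.sqrt_nonneg _) (by linarith)) (by positivity)

theorem weight_denominator_pos {r : ℕ} (hr : 1 ≤ r) {β : ℝ} (hβ0 : 0 ≤ β) (hβ1 : β < 1) :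
    0 < (1 - β ^ 2) * √r + √2 * β := by
  have hr0 : (0 : ℝ) < √r := Real.sqrt_pos.2 (by exact_mod_cast hr)
  have : 0 < 1 - β ^ 2 := by nlinarith
  positivity

/-- The condition on `ã₁` makes room between `ã₁` and `b̃₁`. -/
theorem lt_of_lt_weight_ratio {r : ℕ} (hr : 1 ≤ r) {a b β : ℝ} (ha0 : 0 ≤ a) (hb1 : b ≤ 1)
    (hβ0 : 0 < β) (hβ1 : β < 1)
    (h : a < ((b - β ^ 2) * √r - β) / ((1 - β ^ 2) * √r + √2 * β)) : a < 1 ∧ a < b := by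
  have hr0 : (0 : ℝ) < √r := Real.sqrt_pos.2 (by exact_mod_cast hr)
  have h2 : 0 < √2 * β := by positivity
  have hD := weight_denominator_pos hr hβ0.le hβ1
  rw [lt_div_iff₀ hD] at h
  have ha1 : a < 1 := by
    by_contra hcon
    push Not at hcon
    nlinarith [mul_le_mul_of_nonneg_right hcon hD.le, mul_le_mul_of_nonneg_right hb1 hr0.le]
  refine ⟨ha1, ?_⟩
  have h3 : 0 ≤ a * (√2 * β) := by positivity
  have h4 : a * (1 - β ^ 2) * √r < (b - β ^ 2) * √r := by nlinarith
  have h5 := lt_of_mul_lt_mul_right h4 hr0.le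
  nlinarith [sq_nonneg β]

/-- The condition on `ã₁` says exactly that the first bound lies below `γ₀ = 1/√2`. -/
theorem gammaStep_lt_of_lt_weight_ratio {r : ℕ} (hr : 1 ≤ r) {a b β : ℝ} (ha1 : a < 1)
    (hβ0 : 0 ≤ β) (hβ1 : β < 1)
    (h : a < ((b - β ^ 2) * √r - β) / ((1 - β ^ 2) * √r + √2 * β)) :
    gammaStep r a b β < 1 / √2 := by
  have hr0 : (0 : ℝ) < √r := Real.sqrt_pos.2 (by exact_mod_cast hr)
  have h2 : 0 < √2 := by positivity
  have hD := weight_denominator_pos hr hβ0 hβ1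
  rw [lt_div_iff₀ hD] at h
  have hβ2 : 0 < 1 - β ^ 2 := by nlinarith
  have h1a : 0 < 1 - a := by linarith
  rw [gammaStep, Real.sqrt_mul zero_le_two, div_lt_div_iff₀ (by positivity) h2]
  have h3 : √r * (1 - b) + (√2 * a + 1) * β < √r * (1 - a) * (1 - β ^ 2) := by nlinarith
  nlinarith [mul_lt_mul_of_pos_right h3 h2]

end Scalar

section Bounds

variable {a b r m s : ℕ} {U₁ : Matrix (Fin a) (Fin r) ℝ} {V₁ : Matrix (Fin b) (Fin r) ℝ}
  {Y : Matrix (Fin a) (Fin b) ℝ} {A : Fin m → Matrix (Fin a) (Fin b) ℝ} {c δ : ℝ}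

theorem gammaOf_zero (hr : 1 ≤ r) (h : IsLeadingSVD Y U₁ V₁) :
    gammaOf U₁ V₁ (0 : Matrix (Fin a) (Fin b) ℝ) = 1 / √2 := by
  have hr0 : (0 : ℝ) < √r := Real.sqrt_pos.2 (by exact_mod_cast hr)
  have h2 : 0 < √2 := by positivity
  have e1 : projT U₁ V₁ (0 : Matrix (Fin a) (Fin b) ℝ) = 0 := by simp [projT]
  have e2 : projTperp U₁ V₁ (0 : Matrix (Fin a) (Fin b) ℝ) = 0 := by simp [projTperp, e1]
  have e3 : frobNorm (U₁ * V₁ᵀ) = √r := by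
    rw [frobNorm_mul_transpose_of_orth h.orth_right, ← Real.sqrt_sq (frobNorm_nonneg U₁),
      frobNorm_sq_of_orth h.orth_left]
  rw [gammaOf, projT_sub, e1, e2, specNorm_zero, zero_sub, frobNorm_neg,
    projT_mul_transpose h.orth_left, e3, Real.sqrt_mul zero_le_two]
  field_simp
  norm_num

theorem RestrictedEigenvalue.mul_lt_one (hA : RestrictedEigenvalue A r s c) {t : ℝ}
    (ht : t ≤ 1 / √2) : c * t < 1 := by
  have h2 : 0 < √2 := by positivity
  calc c * t ≤ c * (1 / √2) := mul_le_mul_of_nonneg_left ht hA.c_nonneg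
    _ = c / √2 := by ring
    _ < 1 := (div_lt_one h2).2 hA.c_lt

theorem RestrictedEigenvalue.errBound_pos (hA : RestrictedEigenvalue A r s c) (hr : 1 ≤ r)
    (h : IsLeadingSVD Y U₁ V₁) (hδ : 0 < δ) {t : ℝ} (hct : c * t < 1) :
    0 < errBound A δ r s c t := by
  have hC := hA.noiseConst_pos hr h hδ
  have h1 : 0 < 1 - c * t := by linarith
  rw [errBound]
  change 0 < noiseConst A δ r s * (1 / (1 - c * t)) * _
  positivity

theorem RestrictedEigenvalue.errBound_lt (hA : RestrictedEigenvalue A r s c) (hr : 1 ≤ r)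
    (h : IsLeadingSVD Y U₁ V₁) (hδ : 0 < δ) {t u : ℝ} (ht : 0 ≤ t) (htu : t < u)
    (hcu : c * u < 1) : errBound A δ r s c t < errBound A δ r s c u := by
  have hC := hA.noiseConst_pos hr h hδ
  have hs0 : (0 : ℝ) < s := by exact_mod_cast hA.one_le_s
  have hr0 : (0 : ℝ) < r := by exact_mod_cast hr
  have h1 : 1 / (1 - c * t) ≤ 1 / (1 - c * u) := by
    have := mul_le_mul_of_nonneg_left htu.le hA.c_nonneg
    exact one_div_le_one_div_of_le (by linarith) (by linarith)
  have h2 : 0 < 1 / (1 - c * u) := by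
    have : 0 < 1 - c * u := by linarith
    positivity
  rw [errBound, errBound]
  change noiseConst A δ r s * (1 / (1 - c * t)) * _ < noiseConst A δ r s * (1 / (1 - c * u)) * _
  refine mul_lt_mul' (mul_le_mul_of_nonneg_left h1 hC.le) ?_ (Real.sqrt_nonneg _) (by positivity)
  refine Real.sqrt_lt_sqrt (by positivity) ?_
  gcongr

theorem RestrictedEigenvalue.rankBound_lt (hA : RestrictedEigenvalue A r s c) (hr : 1 ≤ r)
    (h : IsLeadingSVD Y U₁ V₁) (hδ : 0 < δ) {t u : ℝ} (ht : 0 ≤ t) (htu : t < u)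
    (hcu : c * u < 1) : rankBound A δ r s c t < rankBound A δ r s c u := by
  have hC := hA.noiseConst_pos hr h hδ
  have hr0 : (0 : ℝ) < r := by exact_mod_cast hr
  have h2 : 0 < 1 - c * u := by linarith
  rw [rankBound, rankBound]
  change noiseConst A δ r s * _ < noiseConst A δ r s * _
  refine mul_lt_mul_of_pos_left ?_ hC
  refine div_lt_div₀ (mul_lt_mul_of_pos_left htu (Real.sqrt_pos.2 (by positivity))) ?_
    (mul_nonneg (Real.sqrt_nonneg _) (ht.trans htu.le)) h2
  linarith [mul_le_mul_of_nonneg_left htu.le hA.c_nonneg]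

theorem IsMultiStage.rho_pos {y : EuclideanSpace ℝ (Fin m)} {Ω : Set (Matrix (Fin a) (Fin b) ℝ)}
    {φ : ℝ → EReal} {ρ μ : ℕ → ℝ} {X W : ℕ → Matrix (Fin a) (Fin b) ℝ}
    (h : IsMultiStage A y δ Ω φ ρ μ X W) (k : ℕ) : 0 < ρ (k + 1) := by
  induction k with
  | zero => exact h.rho_one_pos
  | succ k ih =>
    have h1 := h.rho_eq (k + 2) (by omega)
    have h2 := h.one_le_mu (k + 2) (by omega)
    rw [h1]
    exact mul_pos (by linarith) ih

/-- The induction hypothesis at stage `k`: `γ_k ≤ γ̃_k ≤ 1/√2`, the quantities `ã_{k+1}`, `b̃_{k+1}`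
entering `γ̃_{k+1}` are admissible, and `γ̃_{k+1} < γ̃_k`. Here `σ` is the smallest nonzero singular
value of the target. -/
structure StageInvariant (U₁ : Matrix (Fin a) (Fin r) ℝ) (V₁ : Matrix (Fin b) (Fin r) ℝ)
    (φ : ℝ → EReal) (ρ : ℕ → ℝ) (σ : ℝ) (Ξ : ℝ → ℝ) (γt : ℕ → ℝ)
    (W : ℕ → Matrix (Fin a) (Fin b) ℝ) (k : ℕ) : Prop where
  spec_lt : specNorm (projTperp U₁ V₁ (W k)) < 1
  gamma_le : gammaOf U₁ V₁ (W k) ≤ γt k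
  tilde_le : γt k ≤ 1 / √2
  error_lt : 2 * Ξ (γt k) < σ
  a_lt_one : aStep φ (ρ (k + 1)) (Ξ (γt k)) < 1
  a_lt_b : aStep φ (ρ (k + 1)) (Ξ (γt k)) < bStep φ σ (ρ (k + 1)) (Ξ (γt k))
  tilde_lt : γt (k + 1) < γt k

theorem StageInvariant.nonneg {φ : ℝ → EReal} {ρ : ℕ → ℝ} {σ : ℝ} {Ξ : ℝ → ℝ} {γt : ℕ → ℝ}
    {W : ℕ → Matrix (Fin a) (Fin b) ℝ} {k : ℕ} (h : StageInvariant U₁ V₁ φ ρ σ Ξ γt W k) :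
    0 ≤ γt k := (gammaOf_nonneg h.spec_lt).trans h.gamma_le

end Bounds

end LowRank

open LowRank Matrix in
theorem theorem4p1 {n₁ n₂ m r : ℕ} (hn : n₁ ≤ n₂) (hr : 0 < r)
    -- the data: sampling operator, target matrix, noise, measurements, structure set
    (A : Fin m → Matrix (Fin n₁) (Fin n₂) ℝ) (Xbar : Matrix (Fin n₁) (Fin n₂) ℝ)
    (ξ b : EuclideanSpace ℝ (Fin m)) (δ : ℝ) (hδ : 0 < δ) (hξ : ‖ξ‖ ≤ δ)
    (hb : b = sampling A Xbar + ξ)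
    (Ω : Set (Matrix (Fin n₁) (Fin n₂) ℝ)) (hΩc : IsCompact Ω) (hΩ : Convex ℝ Ω) (hXΩ : Xbar ∈ Ω)
    -- the leading factors of an SVD of the target, which has rank `r`
    (U₁ : Matrix (Fin n₁) (Fin r) ℝ) (V₁ : Matrix (Fin n₂) (Fin r) ℝ)
    (hSVD : IsLeadingSVD Xbar U₁ V₁)
    -- the restricted eigenvalue assumption
    (s : ℕ) (c : ℝ) (hA : RestrictedEigenvalue A r s c)
    -- a run of the algorithm
    (φ : ℝ → EReal) (hφ : MemPhi φ) (ρ μ : ℕ → ℝ) (X W : ℕ → Matrix (Fin n₁) (Fin n₂) ℝ)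
    (hXW : IsMultiStage A b δ Ω φ ρ μ X W)
    -- abbreviations
    (Ξ Γ : ℝ → ℝ) (hΞ : Ξ = errBound A δ r s c) (hΓ : Γ = rankBound A δ r s c)
    (σr : ℝ) (hσr : σr = sing Xbar (r - 1))
    (γ γt : ℕ → ℝ) (hγ : ∀ k, γ k = gammaOf U₁ V₁ (W k))
    (hγt : γt = gammaTilde φ Ξ r σr (γ 0) ρ)
    (aT bt βt : ℕ → ℝ) (haT : ∀ k, 1 ≤ k → aT k = aStep φ (ρ k) (Ξ (γt (k - 1))))
    (hbt : ∀ k, 1 ≤ k → bt k = bStep φ σr (ρ k) (Ξ (γt (k - 1))))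
    (hβt : ∀ k, 1 ≤ k → βt k = betaStep σr (Ξ (γt (k - 1))))
    -- the conditions on the smallest nonzero singular value and on the parameters
    (hσ : 2 * Ξ (γ 0) < σr)
    (hρ : aT 1 < ((bt 1 - βt 1 ^ 2) * √r - βt 1) / ((1 - βt 1 ^ 2) * √r + √2 * βt 1))
    (hμ : ∀ k, 2 ≤ k → μ k ∈ Set.Icc 1 (Ξ (γt (k - 2)) / Ξ (γt (k - 1)))) :
    -- all the bounds are well defined
    (∀ k, 1 ≤ k → specNorm (projTperp U₁ V₁ (W (k - 1))) < 1 ∧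
        0 ≤ γ (k - 1) ∧ c * γ (k - 1) < 1 ∧ 0 ≤ γt (k - 1) ∧ c * γt (k - 1) < 1 ∧
        aT k < 1 ∧ βt k < 1) ∧
    -- the error and approximate rank bounds
    (∀ k, 1 ≤ k → frobNorm (X k - Xbar) ≤ Ξ (γ (k - 1)) ∧
        nuclearNorm (projTperp U₁ V₁ (X k)) ≤ Γ (γ (k - 1))) ∧
    -- their decrease
    (∀ k, 2 ≤ k →
        (frobNorm (X k - Xbar) ≤ Ξ (γ (k - 1)) ∧ Ξ (γ (k - 1)) ≤ Ξ (γt (k - 1)) ∧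
          (∀ j, 1 ≤ j → j ≤ k - 1 → Ξ (γt j) < Ξ (γt (j - 1))) ∧ Ξ (γt 0) = Ξ (γ 0)) ∧
        (nuclearNorm (projTperp U₁ V₁ (X k)) ≤ Γ (γ (k - 1)) ∧ Γ (γ (k - 1)) ≤ Γ (γt (k - 1)) ∧
          (∀ j, 1 ≤ j → j ≤ k - 1 → Γ (γt j) < Γ (γt (j - 1))) ∧ Γ (γt 0) = Γ (γ 0))) := by
  have hra : r < n₁ := by have := hA.s_le; have := hA.one_le_s; omega
  have hγt0 : γt 0 = γ 0 := by rw [hγt]; rfl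
  have hγt1 : ∀ k, γt (k + 1) = gammaStep r (aStep φ (ρ (k + 1)) (Ξ (γt k)))
      (bStep φ σr (ρ (k + 1)) (Ξ (γt k))) (betaStep σr (Ξ (γt k))) := by
    intro k; rw [hγt]; rfl
  have hγ0 : γ 0 = 1 / √2 := by rw [hγ, hXW.init, gammaOf_zero hr hSVD]
  have hΞlt : ∀ {t u : ℝ}, 0 ≤ t → t < u → u ≤ 1 / √2 → Ξ t < Ξ u := fun ht htu hu => by
    rw [hΞ]; exact hA.errBound_lt hr hSVD hδ ht htu (hA.mul_lt_one hu)
  have hΓlt : ∀ {t u : ℝ}, 0 ≤ t → t < u → u ≤ 1 / √2 → Γ t < Γ u := fun ht htu hu => by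
    rw [hΓ]; exact hA.rankBound_lt hr hSVD hδ ht htu (hA.mul_lt_one hu)
  have hΞle : ∀ {t u : ℝ}, 0 ≤ t → t ≤ u → u ≤ 1 / √2 → Ξ t ≤ Ξ u := fun ht htu hu => by
    rcases htu.eq_or_lt with rfl | htu
    · exact le_rfl
    · exact (hΞlt ht htu hu).le
  have hΓle : ∀ {t u : ℝ}, 0 ≤ t → t ≤ u → u ≤ 1 / √2 → Γ t ≤ Γ u := fun ht htu hu => by
    rcases htu.eq_or_lt with rfl | htu
    · exact le_rfl
    · exact (hΓlt ht htu hu).le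
  have hΞpos : ∀ {t : ℝ}, t ≤ 1 / √2 → 0 < Ξ t := fun ht => by
    rw [hΞ]; exact hA.errBound_pos hr hSVD hδ (hA.mul_lt_one ht)
  have herr : ∀ k, specNorm (projTperp U₁ V₁ (W k)) < 1 → γ k ≤ 1 / √2 →
      frobNorm (X (k + 1) - Xbar) ≤ Ξ (γ k) ∧
        nuclearNorm (projTperp U₁ V₁ (X (k + 1))) ≤ Γ (γ k) := by
    intro k h1 h2
    rw [hγ] at h2
    rw [hΞ, hΓ, hγ]
    exact (hXW.stepX (k + 1) (by omega)).error_bound hA hr hSVD hn hδ hξ hb hXΩ h1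
      (hA.mul_lt_one h2)
  have inv : ∀ k, StageInvariant U₁ V₁ φ ρ σr Ξ γt W k := by
    intro k
    induction k with
    | zero =>
      have hspec : specNorm (projTperp U₁ V₁ (W 0)) < 1 := by
        rw [hXW.init, projTperp, show projT U₁ V₁ (0 : Matrix (Fin n₁) (Fin n₂) ℝ) = 0 by
          simp [projT], sub_zero, specNorm_zero]
        exact one_pos
      have hle : γt 0 ≤ 1 / √2 := by rw [hγt0, hγ0]
      have hpos := hΞpos hle
      have hσ0 : 2 * Ξ (γt 0) < σr := by rwa [hγt0]
      have ha := hφ.psiConjRight_nonneg (ρ 1 * Ξ (γt 0))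
      have hb1 := hφ.psiConjLeft_le_one (ρ 1 * (σr - Ξ (γt 0)))
      have hβ0 := betaStep_pos hpos hσ0
      have hβ1 := betaStep_lt_one hpos hσ0
      rw [haT 1 le_rfl, hbt 1 le_rfl, hβt 1 le_rfl] at hρ
      obtain ⟨h1, h2⟩ := lt_of_lt_weight_ratio hr ha hb1 hβ0 hβ1 hρ
      refine ⟨hspec, by rw [hγt0, hγ], hle, hσ0, h1, h2, ?_⟩
      exact (hγt1 0).trans_lt (lt_of_lt_of_eq
        (gammaStep_lt_of_lt_weight_ratio hr h1 hβ0.le hβ1 hρ) (hγt0.trans hγ0).symm)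
    | succ k ih =>
      have h0 := gammaOf_nonneg ih.spec_lt
      have hpos := hΞpos ih.tilde_le
      have hx : frobNorm (X (k + 1) - Xbar) ≤ Ξ (γt k) := by
        have h1 := (herr k ih.spec_lt (by rw [hγ]; exact ih.gamma_le.trans ih.tilde_le)).1
        rw [hγ] at h1
        exact h1.trans (hΞle h0 ih.gamma_le ih.tilde_le)
      have hβ1 := betaStep_lt_one hpos ih.error_lt
      have hρk := hXW.rho_pos k
      obtain ⟨hspec, hgam⟩ := gammaOf_le_gammaStep hn hSVD hr hra hφ hρk
        (hXW.stepW (k + 1) (by omega)) hσr hx ih.error_lt ih.a_lt_one ih.a_lt_b hβ1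
      rw [← hγt1] at hgam
      have hnonneg : 0 ≤ γt (k + 1) := (gammaOf_nonneg hspec).trans hgam
      have hle : γt (k + 1) ≤ 1 / √2 := ih.tilde_lt.le.trans ih.tilde_le
      have hpos' := hΞpos hle
      have hlt : Ξ (γt (k + 1)) < Ξ (γt k) := hΞlt hnonneg ih.tilde_lt ih.tilde_le
      have hσ' : 2 * Ξ (γt (k + 1)) < σr := by linarith [ih.error_lt]
      obtain ⟨hμ1, hμ2⟩ := hμ (k + 2) (by omega)
      rw [show k + 2 - 2 = k by omega, show k + 2 - 1 = k + 1 by omega, le_div_iff₀ hpos'] at hμ2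
      have hρ' : ρ (k + 1 + 1) = μ (k + 2) * ρ (k + 1) := hXW.rho_eq (k + 2) (by omega)
      have hak : aStep φ (ρ (k + 1 + 1)) (Ξ (γt (k + 1))) ≤ aStep φ (ρ (k + 1)) (Ξ (γt k)) := by
        refine hφ.psiConjRight_mono ?_
        rw [hρ']
        nlinarith [mul_le_mul_of_nonneg_left hμ2 hρk.le]
      have hbk : bStep φ σr (ρ (k + 1)) (Ξ (γt k)) ≤
          bStep φ σr (ρ (k + 1 + 1)) (Ξ (γt (k + 1))) := by
        refine hφ.psiConjLeft_mono ?_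
        rw [hρ']
        refine mul_le_mul (by nlinarith) (by linarith) (by linarith [ih.error_lt]) ?_
        exact mul_nonneg (by linarith) hρk.le
      refine ⟨hspec, hgam, hle, hσ', hak.trans_lt ih.a_lt_one,
        (hak.trans_lt ih.a_lt_b).trans_le hbk, ?_⟩
      refine (hγt1 (k + 1)).trans_lt (lt_of_lt_of_eq ?_ (hγt1 k).symm)
      exact gammaStep_lt_gammaStep hr (hφ.psiConjRight_nonneg _) hak ih.a_lt_one hbk
        (hφ.psiConjLeft_le_one _) (betaStep_pos hpos' hσ').le
        (betaStep_lt_betaStep hpos'.le hlt ih.error_lt) hβ1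
  have hγle : ∀ k, γ k ≤ γt k := fun k => by rw [hγ]; exact (inv k).gamma_le
  have hγnn : ∀ k, 0 ≤ γ k := fun k => by rw [hγ]; exact gammaOf_nonneg (inv k).spec_lt
  have herr' : ∀ k, 1 ≤ k → frobNorm (X k - Xbar) ≤ Ξ (γ (k - 1)) ∧
      nuclearNorm (projTperp U₁ V₁ (X k)) ≤ Γ (γ (k - 1)) := by
    intro k hk
    have h := herr (k - 1) (inv _).spec_lt ((hγle _).trans (inv _).tilde_le)
    rwa [Nat.sub_add_cancel hk] at h
  have hdec : ∀ j, 1 ≤ j → γt j < γt (j - 1) := by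
    intro j hj
    have h := (inv (j - 1)).tilde_lt
    rwa [Nat.sub_add_cancel hj] at h
  refine ⟨fun k hk => ⟨(inv _).spec_lt, hγnn _, hA.mul_lt_one ((hγle _).trans (inv _).tilde_le),
    (inv _).nonneg, hA.mul_lt_one (inv _).tilde_le, ?_, ?_⟩, herr', fun k hk =>
    ⟨⟨(herr' k (by omega)).1, hΞle (hγnn _) (hγle _) (inv _).tilde_le,
      fun j hj _ => hΞlt (inv j).nonneg (hdec j hj) (inv _).tilde_le, by rw [hγt0]⟩,
    ⟨(herr' k (by omega)).2, hΓle (hγnn _) (hγle _) (inv _).tilde_le,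
      fun j hj _ => hΓlt (inv j).nonneg (hdec j hj) (inv _).tilde_le, by rw [hγt0]⟩⟩⟩
  · have h := (inv (k - 1)).a_lt_one
    rw [Nat.sub_add_cancel hk] at h
    rwa [haT k hk]
  · rw [hβt k hk]
    exact betaStep_lt_one (hΞpos (inv _).tilde_le) (inv _).error_lt
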